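/- A flat knot is an equivalence class of Gauss diagrams (an oriented circle, the skeleton, with finitely many arrows joining pairwise distinct points of it) under the flat Reidemeister moves FR1, FR2, FR3. Diagrams are given by Gauss codes, in which $\mathtt{O}i$ is the tail and $\mathtt{U}i$ the head of the arrow $i$, listed in the order in which they are met along the skeleton. The flat knot $6.464$ is the one with Gauss code $\mathtt{O1O2O3O4O5U6U4O6U1U3U5U2}$, the flat knot $4.2$ is the one with Gauss code $\mathtt{O1O2O3O4U1U3U4U2}$, and $-4.2$ is its reverse, obtained by reversing the orientation of the skeleton. A flat knot is slice if it has a slice movie, i.e. if some diagram of it can be transformed into the trivial diagram (one circle without arrows) by a finite sequence of flat Reidemeister moves, births, deaths and oriented saddle moves of Gauss diagrams of flat links, such that the number of saddles equals the number of births plus the number of deaths and the cobordism surface traced out is connected. For an arrow $e$ of a diagram $D$ let $e^+$ be the loop that runs along the skeleton from the tail to the head of $e$, and let $s$ be the class of the whole curve. The index $n(e)=e^+\cdot s$ is the number of arrow tails minus the number of arrow heads in the open arc $e^+$. The based matrix $T(D)$ is the skew-symmetric integral matrix of intersection numbers of the elements $s$ and $e^+$ ($e\in \mathrm{arr}(D)$).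 A filling is a partition of $\mathrm{arr}(D)$ into subsets $X_1,\dots,X_k$ with one or two elements; it gives the matrix $\widehat T$ of intersection numbers of $s$ and the sums $\sum_{e\in X_i}e^+$ ($1\le i\le k$). The genus of $T(D)$ is $\frac12\min \operatorname{rank}\widehat T$ over all fillings. A flat knot has algebraic genus $g$ if the based matrices of all its diagrams have genus $g$; it is algebraically slice if it has algebraic genus $0$. A flat knot $\beta$ is the $r$-th covering of $\alpha$ if deleting, from any diagram of $\alpha$, all arrows whose index is not divisible by $r$ gives a diagram of $\beta$. Then the flat knot $6.464$ is algebraically slice but not slice. Moreover, its $3$-fold covering is the flat knot $-4.2$, and both $4.2$ and $-4.2$ have algebraic genus $1$. -/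

import Mathlib

namespace FlatKnots

/-! ## Gauss diagrams of flat links -/

/-- A point of a Gauss diagram: `(a, true)` is the tail of the arrow `a` (written `Oa` in Gauss
codes) and `(a, false)` is its head (written `Ua`). -/
abbrev Endpoint := ℕ × Bool

/-- Tail of the arrow `a`. -/
abbrev O (a : ℕ) : Endpoint := (a, true)

/-- Head of the arrow `a`. -/
abbrev U (a : ℕ) : Endpoint := (a, false)

/-- Every arrow that occurs has exactly one tail and exactly one head. -/
def IsGauss (w : List Endpoint) : Prop :=
  w.Nodup ∧ ∀ x ∈ w, (x.1, !x.2) ∈ w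

instance (w : List Endpoint) : Decidable (IsGauss w) := by
  unfold IsGauss; infer_instance

/-- An oriented circle of a Gauss diagram of a flat link: a tag, which is used only to name
connected components of cobordisms, and the cyclic word of the endpoints met along the circle.
A circle without crossings has the empty word. -/
abbrev Circle := ℕ × List Endpoint

/-- All endpoints on a list of circles. -/
def endpoints (C : List Circle) : List Endpoint := C.flatMap Prod.snd

/-- A link diagram with `k` strands cut out. The symbol `Sum.inr i` marks the place of the
`i`-th missing strand. -/
abbrev Tangle (k : ℕ) := List (ℕ × List (Endpoint ⊕ Fin k))

/-- Insert the strands `h` at the marked places. -/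
def Tangle.fill {k : ℕ} (T : Tangle k) (h : Fin k → List Endpoint) : List Circle :=
  T.map fun c => (c.1, c.2.flatMap (Sum.elim (fun x => [x]) h))

/-- The strand of a triangle that carries the endpoint `x` of the arrow shared with the next strand
and the endpoint `y` of the arrow shared with the previous strand. For three oriented lines in the
plane in general position, where an arrow points from line `i` to line `j` when the directions of
`i`, `j` form a positive frame, either `x` comes first exactly on those lines on which `x`, `y` are
of different kinds (a tail and a head), or exactly on those on which they are of the same kind. -/
def triangleStrand (x y : Endpoint) : List Endpoint :=
  if x.2 = y.2 then [y, x] else [x, y]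

/-- The local pictures of the three flat Reidemeister moves on Gauss diagrams. -/
inductive LocalMove : {k : ℕ} → (Fin k → List Endpoint) → (Fin k → List Endpoint) → Prop
  /-- An arrow with adjacent endpoints, of either direction, is removed. -/
  | fr1 (a : ℕ) (e : Bool) : LocalMove ![[(a, e), (a, !e)]] ![[]]
  /-- Two arrows joining the same two strands in opposite directions are removed; the order of the
  two endpoints on each strand is arbitrary. -/
  | fr2 (a b : ℕ) (p q : List Endpoint) (hp : p.Perm [O a, U b]) (hq : q.Perm [U a, O b]) :
      LocalMove ![p, q] ![[], []]
  /-- Three pairwise crossing strands `0`, `1`, `2`, with arrows `a`, `b`, `c` between strands `0, 1`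
  and `1, 2` and `2, 0`, of arbitrary directions `e₀`, `e₁`, `e₂`: the order of the two endpoints on
  each of the three strands is reversed. -/
  | fr3 (a b c : ℕ) (e₀ e₁ e₂ : Bool) :
      LocalMove
        ![triangleStrand (a, e₀) (c, !e₂), triangleStrand (b, e₁) (a, !e₀),
          triangleStrand (c, e₂) (b, !e₁)]
        ![(triangleStrand (a, e₀) (c, !e₂)).reverse, (triangleStrand (b, e₁) (a, !e₀)).reverse,
          (triangleStrand (c, e₂) (b, !e₁)).reverse]

/-- A single step of a homotopy of flat links: change of the presentation of the same Gauss diagram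
(order of the circles, base points, names of the arrows) or one flat Reidemeister move, in either
direction. -/
inductive Move : List Circle → List Circle → Prop
  | perm {C C' : List Circle} (h : C.Perm C') : Move C C'
  | rotate (t : ℕ) (u v : List Endpoint) (C : List Circle) : Move ((t, u ++ v) :: C) ((t, v ++ u) :: C)
  | rename (σ : Equiv.Perm ℕ) (C : List Circle) :
      Move C (C.map fun c => (c.1, c.2.map fun x => (σ x.1, x.2)))
  | reidemeister {k : ℕ} {h h' : Fin k → List Endpoint} (T : Tangle k)
      (hloc : LocalMove h h' ∨ LocalMove h' h)
      (hT : ∀ i, (T.flatMap Prod.snd).count (Sum.inr i) = 1)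
      (hg : IsGauss (endpoints (T.fill h))) (hg' : IsGauss (endpoints (T.fill h'))) :
      Move (T.fill h) (T.fill h')

/-! ## Flat knots -/

/-- A Gauss diagram of a flat knot, given by a Gauss word. -/
structure KnotDiagram where
  word : List Endpoint
  gauss : IsGauss word

/-- Flat knots: Gauss diagrams up to flat Reidemeister moves. -/
def FlatKnot : Type :=
  Quot fun D D' : KnotDiagram => Move [(0, D.word)] [(0, D'.word)]

/-- The flat knot represented by a diagram. -/
def KnotDiagram.toFlatKnot (D : KnotDiagram) : FlatKnot := Quot.mk _ D

/-- The diagram with the reversed orientation of the skeleton. -/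
def KnotDiagram.reverse (D : KnotDiagram) : KnotDiagram where
  word := D.word.reverse
  gauss := ⟨List.nodup_reverse.2 D.gauss.1, fun x hx =>
    List.mem_reverse.2 (D.gauss.2 x (List.mem_reverse.1 hx))⟩

/-! ## Sliceness -/

/-- A still of a movie: the link at some time, and the set of names of the connected components of
the part of the cobordism swept out up to that time. The tag of a circle is the name of the
component of that surface on which the circle lies. -/
structure Still where
  circles : List Circle
  sheets : Finset ℕ

/-- `Movie S₀ b d s S`: there is a movie from `S₀` to `S` made of flat Reidemeister moves, `b` births,
`d` deaths and `s` (oriented) saddle moves. -/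
inductive Movie (S₀ : Still) : ℕ → ℕ → ℕ → Still → Prop
  | start : Movie S₀ 0 0 0 S₀
  | homotopy {b d s : ℕ} {C C' : List Circle} {P : Finset ℕ} :
      Movie S₀ b d s ⟨C, P⟩ → Move C C' → Movie S₀ b d s ⟨C', P⟩
  /-- A circle without crossings appears, on a new component of the surface. -/
  | birth {b d s : ℕ} {C : List Circle} {P : Finset ℕ} (t : ℕ) :
      Movie S₀ b d s ⟨C, P⟩ → t ∉ P → Movie S₀ (b + 1) d s ⟨(t, []) :: C, insert t P⟩
  /-- A circle without crossings is capped off. -/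
  | death {b d s : ℕ} {C : List Circle} {P : Finset ℕ} {t : ℕ} :
      Movie S₀ b d s ⟨(t, []) :: C, P⟩ → Movie S₀ b (d + 1) s ⟨C, P⟩
  /-- A saddle that splits a circle in two. -/
  | split {b d s : ℕ} {C : List Circle} {P : Finset ℕ} {t : ℕ} {u v : List Endpoint} :
      Movie S₀ b d s ⟨(t, u ++ v) :: C, P⟩ →
      Movie S₀ b d (s + 1) ⟨(t, u) :: (t, v) :: C, P⟩
  /-- A saddle that joins two circles; the components of the surface named `t` and `t'` become one,
  named `t`. -/
  | merge {b d s : ℕ} {C : List Circle} {P : Finset ℕ} {t t' : ℕ} {u v : List Endpoint} :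
      Movie S₀ b d s ⟨(t, u) :: (t', v) :: C, P⟩ →
      Movie S₀ b d (s + 1)
        ⟨(t, u ++ v) :: C.map fun c => (if c.1 = t' then t else c.1, c.2),
          P.image fun i => if i = t' then t else i⟩

/-- A flat knot is slice if one of its diagrams has a slice movie: a movie that ends at the trivial
diagram (one circle without crossings), has as many saddles as births and deaths together, and
traces out a connected surface. -/
def FlatKnot.Slice (α : FlatKnot) : Prop :=
  ∃ D : KnotDiagram, D.toFlatKnot = α ∧ ∃ b d s t : ℕ,
    Movie ⟨[(0, D.word)], {0}⟩ b d s ⟨[(t, [])], {t}⟩ ∧ s = b + d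

/-! ## Based matrices and their genus -/

/-- The arrows of a knot diagram. -/
def KnotDiagram.arrows (D : KnotDiagram) : Finset ℕ := (D.word.map Prod.fst).toFinset

/-- `D.arc e x` is `1` if the point `x` lies on the open arc `e⁺` of the skeleton that leads from the
tail to the head of the arrow `e`, and `0` otherwise. -/
def KnotDiagram.arc (D : KnotDiagram) (e : ℕ) (x : Endpoint) : ℤ :=
  let i := D.word.idxOf (O e)
  let j := D.word.idxOf (U e)
  let k := D.word.idxOf x
  if x ∈ D.word ∧ (if i < j then i < k ∧ k < j else i < k ∨ k < j) then 1 else 0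

/-- The index `n(e)`: the number of tails minus the number of heads in `e⁺`. It is the intersection
number of the loop `e⁺` with the whole curve. -/
def KnotDiagram.index (D : KnotDiagram) (e : ℕ) : ℤ :=
  ∑ a ∈ D.arrows, (D.arc e (O a) - D.arc e (U a))

/-- The intersection number of the loops `e⁺` and `f⁺` on the surface: crossings between the interiors
of the two arcs are counted with sign, and the last two terms account for the crossing `e`, where
`e⁺` has its corner; `D.arc f (U e) - D.arc f (O e)` is `1` if the endpoints of `e` and `f` are met
in the cyclic order tail of `e`, tail of `f`, head of `e`, head of `f`, it is `-1` if they are met in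
the order tail of `e`, head of `f`, head of `e`, tail of `f`, and it is `0` if `e` and `f` are not
linked. -/
def KnotDiagram.pairing (D : KnotDiagram) (e f : ℕ) : ℤ :=
  ∑ a ∈ D.arrows, (D.arc e (O a) * D.arc f (U a) - D.arc e (U a) * D.arc f (O a))
    + (D.arc f (U e) - D.arc f (O e))

/-- The based matrix of a diagram. The index `none` stands for the core element `s` (the class of the
whole curve) and `some e` for the class of the loop `e⁺`. -/
def KnotDiagram.basedMatrix (D : KnotDiagram) :
    Matrix (Option D.arrows) (Option D.arrows) ℤ
  | none, none => 0
  | some e, none => D.index e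
  | none, some f => -D.index f
  | some e, some f => D.pairing e f

/-- A filling: a partition of the set `G` into subsets with one or two elements. -/
structure Filling (G : Type) [Fintype G] [DecidableEq G] where
  partition : Finpartition (Finset.univ : Finset G)
  card_part : ∀ X ∈ partition.parts, X.card = 1 ∨ X.card = 2

/-- The elements of `G ⊔ {s}` of which a member of the filled family is the formal sum: `s` itself for
`none`, and the members of the part `X` for `some X`. -/
def Filling.support {G : Type} [Fintype G] [DecidableEq G] (χ : Filling G) :
    Option χ.partition.parts → Finset (Option G)
  | none => {none}
  | some X => (X : Finset G).map Function.Embedding.some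

/-- The matrix of the extension by linearity of the form to `s` and the sums `∑ x ∈ X, x`. -/
def Filling.matrix {G : Type} [Fintype G] [DecidableEq G] (χ : Filling G)
    (T : Matrix (Option G) (Option G) ℤ) :
    Matrix (Option χ.partition.parts) (Option χ.partition.parts) ℤ :=
  fun p q => ∑ x ∈ χ.support p, ∑ y ∈ χ.support q, T x y

/-- The genus of a based matrix: half the minimal rank over all fillings. -/
noncomputable def matrixGenus {G : Type} [Fintype G] [DecidableEq G]
    (T : Matrix (Option G) (Option G) ℤ) : ℚ :=
  ((sInf (Set.range fun χ : Filling G => ((χ.matrix T).map (Int.cast : ℤ → ℚ)).rank) : ℕ) : ℚ) / 2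

/-- The algebraic genus of `α` is `g`: the based matrix of every diagram of `α` has genus `g`. -/
def FlatKnot.HasAlgebraicGenus (α : FlatKnot) (g : ℚ) : Prop :=
  ∀ D : KnotDiagram, D.toFlatKnot = α → matrixGenus D.basedMatrix = g

/-- A flat knot is algebraically slice if its algebraic genus is zero. -/
def FlatKnot.AlgebraicallySlice (α : FlatKnot) : Prop := α.HasAlgebraicGenus 0

/-! ## Coverings -/

/-- Delete all arrows whose index is not a multiple of `r`. -/
def KnotDiagram.covering (D : KnotDiagram) (r : ℤ) : KnotDiagram where
  word := D.word.filter fun x => decide (r ∣ D.index x.1)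
  gauss := ⟨D.gauss.1.filter _, fun x hx => by
    rw [List.mem_filter] at hx ⊢
    exact ⟨D.gauss.2 x hx.1, hx.2⟩⟩

/-- The flat knot `β` is the `r`-th covering of `α`: it is obtained from every diagram of `α` by
deleting the arrows whose index is not a multiple of `r`. -/
def FlatKnot.IsCovering (r : ℤ) (α β : FlatKnot) : Prop :=
  ∀ D : KnotDiagram, D.toFlatKnot = α → (D.covering r).toFlatKnot = β

/-! ## The flat knots 6.464 and 4.2 -/

/-- The diagram `O1O2O3O4O5U6U4O6U1U3U5U2` of the flat knot 6.464. -/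
def diagram6464 : KnotDiagram :=
  ⟨[O 1, O 2, O 3, O 4, O 5, U 6, U 4, O 6, U 1, U 3, U 5, U 2], by decide⟩

/-- The diagram `O1O2O3O4U1U3U4U2` of the flat knot 4.2. -/
def diagram42 : KnotDiagram :=
  ⟨[O 1, O 2, O 3, O 4, U 1, U 3, U 4, U 2], by decide⟩

/-- The flat knot 6.464. -/
def knot6464 : FlatKnot := diagram6464.toFlatKnot

/-- The flat knot 4.2. -/
def knot42 : FlatKnot := diagram42.toFlatKnot

/-- The flat knot −4.2, the reverse of 4.2. -/
def negKnot42 : FlatKnot := diagram42.reverse.toFlatKnot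

end FlatKnots

/-! Non-sliceness comes from numbering the arcs of every still of a slice movie by integers, with
the label rising by one at each tail and falling by one at each head. Connectedness and the saddle
count force the surface to have genus zero. Reading the movie backwards from the trivial diagram,
this gives every circle as many tails as heads: circles being split or merged inherit it because the
total excess on each component of the surface vanishes (`Movie.basic`). So labels close up around
every circle, and they can be chosen compatibly with all saddles (`Movie.labelled`).

The index of an arrow of a labelled link is the height of its head minus the height of its tail; for
a knot it is the usual index (`KnotDiagram.index_eq_ind`). It is zero for the arrow of FR1 and
opposite for the two arrows of FR2. FR3 leaves the three indices unchanged, and they satisfy a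
signed linear relation (`LocalMove.ind`). This has two consequences. The arrows with index divisible
by `r` undergo a movie with the same births, deaths and saddles, so coverings of slice knots are
slice (`FlatKnot.Slice.covering`). And for every odd function `f` the sum of `f` over all indices is
constant along the movie, hence zero for a slice knot (`FlatKnot.Slice.tally_eq_zero`).

The arrows of 6.464 have indices 3, -1, 0, 0, -3, 1, so the second test alone does not detect it.
Deleting arrows 2 and 6 yields -4.2, whose indices are -3, 1, 0, 2; the index -3 is unbalanced, so
neither -4.2 nor 6.464 is slice.

For the algebraic genus, the based matrix is read as a Gram matrix: `crossForm` is a skew form on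
functions on the endpoints, `s` is the constant function 1, and `e⁺` is the indicator of its arc
with value 1/2 at its own corner. The rank of a filling depends only on the span of its vectors
modulo the radical (`rank_gram_le`, `rank_fill_le`). Moving the base point changes the loops by
multiples of `s`. FR1 adds a vector of the radical, FR2 adds two vectors whose sum is in the
radical, and FR3 preserves the Gram matrix up to the choice of vectors (`crossForm_triangle`). Thus
the genus is an invariant (`FlatKnot.matrixGenus_eq`) and one diagram of each knot suffices. For
6.464 one filling has zero matrix. For 4.2 and -4.2 there is a filling of rank 2, and no filling
does better because the index ±3 of arrow 1 is not cancelled by any other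
(`KnotDiagram.two_le_of_wordRank`). -/

namespace FlatKnots

/-! ## Labelled links -/

/-- `1` for a tail and `-1` for a head. -/
def sgn (x : Endpoint) : ℤ := if x.2 then 1 else -1

/-- The number of tails minus the number of heads. -/
def exc (w : List Endpoint) : ℤ := (w.map sgn).sum

@[simp] theorem exc_nil : exc [] = 0 := rfl

@[simp] theorem exc_cons (x : Endpoint) (w : List Endpoint) : exc (x :: w) = sgn x + exc w := by
  simp [exc]

@[simp] theorem exc_append (u v : List Endpoint) : exc (u ++ v) = exc u + exc v := by
  simp [exc]

theorem exc_perm {u v : List Endpoint} (h : u.Perm v) : exc u = exc v := (h.map _).sum_eq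

/-- The heights of the endpoints of a strand along which the label starts with the value `l`,
increases by one at every tail and decreases by one at every head: the lower one of the two
adjacent labels. -/
def heights : ℤ → List Endpoint → List (Endpoint × ℤ)
  | _, [] => []
  | l, x :: w => (x, if x.2 then l else l - 1) :: heights (l + sgn x) w

theorem heights_append (l : ℤ) (u v : List Endpoint) :
    heights l (u ++ v) = heights l u ++ heights (l + exc u) v := by
  induction u generalizing l with
  | nil => simp [heights]
  | cons x u ih => simp [heights, ih, add_assoc]

/-- The contribution of an endpoint to the index of the arrow `a`. -/
def wt (a : ℕ) (p : Endpoint × ℤ) : ℤ := if p.1.1 = a then -(sgn p.1 * p.2) else 0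

/-- The contribution of a strand to the index of the arrow `a`. -/
def strandInd (l : ℤ) (w : List Endpoint) (a : ℕ) : ℤ := ((heights l w).map (wt a)).sum

@[simp] theorem strandInd_nil (l : ℤ) (a : ℕ) : strandInd l [] a = 0 := rfl

theorem strandInd_cons (l : ℤ) (x : Endpoint) (w : List Endpoint) (a : ℕ) :
    strandInd l (x :: w) a =
      wt a (x, if x.2 then l else l - 1) + strandInd (l + sgn x) w a := by
  simp [strandInd, heights]

theorem strandInd_append (l : ℤ) (u v : List Endpoint) (a : ℕ) :
    strandInd l (u ++ v) a = strandInd l u a + strandInd (l + exc u) v a := by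
  simp [strandInd, heights_append]

theorem strandInd_eq_zero (l : ℤ) (w : List Endpoint) (a : ℕ) (h : ∀ x ∈ w, x.1 ≠ a) :
    strandInd l w a = 0 := by
  induction w generalizing l with
  | nil => rfl
  | cons x w ih =>
    rw [strandInd_cons, ih _ fun y hy => h y (List.mem_cons_of_mem _ hy)]
    simp [wt, h x List.mem_cons_self]

/-- A circle with a sheet name, a label at the base point, and a word. -/
abbrev LCircle := ℕ × ℤ × List Endpoint

/-- Forget the label. -/
def LCircle.forget (c : LCircle) : Circle := (c.1, c.2.2)

/-- The index of an arrow of a labelled link: the height of its head minus the height of its tail. -/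
def ind (E : List LCircle) (a : ℕ) : ℤ := (E.map fun c => strandInd c.2.1 c.2.2 a).sum

@[simp] theorem ind_nil (a : ℕ) : ind [] a = 0 := rfl

@[simp] theorem ind_cons (c : LCircle) (E : List LCircle) (a : ℕ) :
    ind (c :: E) a = strandInd c.2.1 c.2.2 a + ind E a := by simp [ind]

/-- The sublink of the arrows whose index is a multiple of `r`. -/
def cov (r : ℤ) (E : List LCircle) : List Circle :=
  E.map fun c => (c.1, c.2.2.filter fun x => decide (r ∣ ind E x.1))

/-- The sum of the values of `f` on the indices of all arrows. -/
def tally (f : ℤ → ℤ) (E : List LCircle) : ℤ :=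
  ((endpoints (E.map LCircle.forget)).map fun x => if x.2 then f (ind E x.1) else 0).sum

/-- Shift the labels by a constant on each sheet. -/
def shift (c : ℕ → ℤ) (E : List LCircle) : List LCircle := E.map fun x => (x.1, x.2.1 + c x.1, x.2.2)

/-- A labelled link diagram with `k` strands cut out. -/
abbrev LTangle (k : ℕ) := List (ℕ × ℤ × List (Endpoint ⊕ Fin k))

/-- Forget the labels. -/
def LTangle.forget {k : ℕ} (T : LTangle k) : Tangle k := T.map fun c => (c.1, c.2.2)

/-- Insert the strands `h` at the marked places. -/
def LTangle.fill {k : ℕ} (T : LTangle k) (h : Fin k → List Endpoint) : List LCircle :=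
  T.map fun c => (c.1, c.2.1, c.2.2.flatMap (Sum.elim (fun x => [x]) h))

theorem LTangle.forget_fill {k : ℕ} (T : LTangle k) (h : Fin k → List Endpoint) :
    (T.fill h).map LCircle.forget = T.forget.fill h := by
  simp [LTangle.fill, LTangle.forget, Tangle.fill, LCircle.forget, Function.comp_def]

/-- Homotopy steps of labelled links. -/
inductive LMove : List LCircle → List LCircle → Prop
  | perm {E E' : List LCircle} (h : E.Perm E') : LMove E E'
  | rotate (t : ℕ) (l : ℤ) (u v : List Endpoint) (E : List LCircle) (h : exc u + exc v = 0) :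
      LMove ((t, l, u ++ v) :: E) ((t, l + exc u, v ++ u) :: E)
  | rename (σ : Equiv.Perm ℕ) (E : List LCircle) :
      LMove E (E.map fun c => (c.1, c.2.1, c.2.2.map fun x => (σ x.1, x.2)))
  | reidemeister {k : ℕ} {h h' : Fin k → List Endpoint} (T : LTangle k)
      (hloc : LocalMove h h' ∨ LocalMove h' h)
      (hT : ∀ i, (T.forget.flatMap Prod.snd).count (Sum.inr i) = 1)
      (hg : IsGauss (endpoints (T.forget.fill h))) (hg' : IsGauss (endpoints (T.forget.fill h'))) :
      LMove (T.fill h) (T.fill h')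

theorem exists_ltangle {k : ℕ} (h : Fin k → List Endpoint) (T : Tangle k) (E : List LCircle)
    (hE : E.map LCircle.forget = T.fill h) : ∃ L : LTangle k, L.forget = T ∧ L.fill h = E := by
  induction T generalizing E with
  | nil =>
    obtain rfl : E = [] := by simpa [Tangle.fill] using hE
    exact ⟨[], rfl, rfl⟩
  | cons c T ih =>
    cases E with
    | nil => simp [Tangle.fill] at hE
    | cons e E =>
      obtain ⟨t, l, w⟩ := e
      obtain ⟨t', c⟩ := c
      simp only [Tangle.fill, List.map_cons, List.cons.injEq, LCircle.forget, Prod.mk.injEq] at hE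
      obtain ⟨⟨rfl, rfl⟩, h2⟩ := hE
      obtain ⟨L, rfl, rfl⟩ := ih E h2
      exact ⟨(t, l, c) :: L, rfl, rfl⟩

theorem perm_lift {α β : Type*} (f : α → β) {l : List β} {m : List β} (h : l.Perm m) :
    ∀ L : List α, L.map f = l → ∃ M : List α, M.map f = m ∧ L.Perm M := by
  induction h with
  | nil => intro L hL; exact ⟨L, hL, List.Perm.refl _⟩
  | cons x _ ih =>
    intro L hL
    obtain ⟨a, L', rfl, rfl, h2⟩ := List.map_eq_cons_iff.1 hL
    obtain ⟨M, rfl, hM⟩ := ih L' h2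
    exact ⟨a :: M, rfl, hM.cons a⟩
  | swap x y l =>
    intro L hL
    obtain ⟨a, L', rfl, rfl, h2⟩ := List.map_eq_cons_iff.1 hL
    obtain ⟨b, L'', rfl, rfl, rfl⟩ := List.map_eq_cons_iff.1 h2
    exact ⟨b :: a :: L'', rfl, List.Perm.swap _ _ _⟩
  | trans _ _ ih1 ih2 =>
    intro L hL
    obtain ⟨M, hM, h1⟩ := ih1 L hL
    obtain ⟨N, hN, h2⟩ := ih2 M hM
    exact ⟨N, hN, h1.trans h2⟩

/-- A homotopy step of links whose circles have as many tails as heads lifts to labelled links. -/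
theorem Move.lift {C C' : List Circle} (hm : Move C C') (h0 : ∀ c ∈ C, exc c.2 = 0)
    (E : List LCircle) (hE : E.map LCircle.forget = C) :
    ∃ E' : List LCircle, E'.map LCircle.forget = C' ∧ LMove E E' := by
  cases hm with
  | perm h =>
    obtain ⟨M, hM, h1⟩ := perm_lift _ h E hE
    exact ⟨M, hM, LMove.perm h1⟩
  | rotate t u v C =>
    obtain ⟨⟨t', l, w⟩, E', rfl, h1, h2⟩ := List.map_eq_cons_iff.1 hE
    simp only [LCircle.forget, Prod.mk.injEq] at h1
    obtain ⟨rfl, rfl⟩ := h1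
    refine ⟨_, ?_, LMove.rotate t' l u v E' ?_⟩
    · simp [LCircle.forget, ← h2]
    · simpa using h0 _ List.mem_cons_self
  | rename σ =>
    refine ⟨_, ?_, LMove.rename σ E⟩
    simp [← hE, LCircle.forget, Function.comp_def]
  | reidemeister T hloc hT hg hg' =>
    obtain ⟨L, rfl, rfl⟩ := exists_ltangle _ T E hE
    exact ⟨_, L.forget_fill _, LMove.reidemeister L hloc hT hg hg'⟩

theorem LMove.shift {E E' : List LCircle} (h : LMove E E') (c : ℕ → ℤ) :
    LMove (shift c E) (shift c E') := by
  cases h with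
  | perm h => exact LMove.perm (h.map _)
  | rotate t l u v E h =>
    simp only [FlatKnots.shift, List.map_cons]
    rw [add_right_comm]
    exact LMove.rotate t _ u v _ h
  | rename σ =>
    have := LMove.rename σ (FlatKnots.shift c E)
    convert this using 1
    simp [FlatKnots.shift, Function.comp_def]
  | reidemeister T hloc hT hg hg' =>
    have hf : LTangle.forget (T.map fun x => (x.1, x.2.1 + c x.1, x.2.2)) = T.forget := by
      simp [LTangle.forget, Function.comp_def]
    have hs : ∀ h, FlatKnots.shift c (T.fill h) =
        LTangle.fill (T.map fun x => (x.1, x.2.1 + c x.1, x.2.2)) h := by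
      intro h; simp [LTangle.fill, FlatKnots.shift, Function.comp_def]
    rw [hs, hs]
    exact LMove.reidemeister _ hloc (by rwa [hf]) (by rwa [hf]) (by rwa [hf])

/-! ## Filling in strands -/

/-- Needed for `List.count` on words that mix endpoints with markers of missing strands. -/
instance {α β : Type*} [BEq α] [BEq β] [LawfulBEq α] [LawfulBEq β] : LawfulBEq (α ⊕ β) where
  eq_of_beq := by
    rintro (x | x) (y | y) h
    · exact congrArg _ (eq_of_beq (α := α) h)
    · cases h
    · cases h
    · exact congrArg _ (eq_of_beq (α := β) h)
  rfl := by
    rintro (x | x)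
    · exact beq_self_eq_true (α := α) x
    · exact beq_self_eq_true (α := β) x

/-- The endpoints of a pattern that are not on a missing strand. -/
def outer {k : ℕ} (c : List (Endpoint ⊕ Fin k)) : List Endpoint := c.filterMap Sum.getLeft?

theorem perm_outer {k : ℕ} (c : List (Endpoint ⊕ Fin k)) (hc : ∀ i, c.count (Sum.inr i) = 1) :
    c.Perm ((outer c).map Sum.inl ++ (List.finRange k).map Sum.inr) := by
  rw [List.perm_iff_count]
  have hl : ∀ d : List (Endpoint ⊕ Fin k), ∀ x, d.count (Sum.inl x) = (outer d).count x := by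
    intro d x
    induction d with
    | nil => rfl
    | cons y d ih =>
      cases y with
      | inl y =>
        have : outer (Sum.inl y :: d) = y :: outer d := rfl
        rw [this, List.count_cons, List.count_cons, ih]
        simp
      | inr y =>
        have : outer (Sum.inr y :: d) = outer d := rfl
        rw [this, List.count_cons, ih]
        simp
  rintro (x | i)
  · rw [List.count_append, List.count_map_of_injective _ _ Sum.inl_injective, hl,
      List.count_eq_zero_of_not_mem (l := List.map Sum.inr _)]
    · rfl
    · simp
  · rw [List.count_append, List.count_map_of_injective _ _ Sum.inr_injective, hc,
      List.count_eq_zero_of_not_mem (l := List.map Sum.inl _)]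
    · simp [List.count_eq_one_of_mem (List.nodup_finRange k) (List.mem_finRange i)]
    · simp

theorem endpoints_fill {k : ℕ} (T : Tangle k) (h : Fin k → List Endpoint) :
    endpoints (T.fill h) = (T.flatMap Prod.snd).flatMap (Sum.elim (fun x => [x]) h) := by
  simp [endpoints, Tangle.fill, List.flatMap_assoc, List.flatMap_map]

theorem flatMap_elim_perm {k : ℕ} (c : List (Endpoint ⊕ Fin k))
    (hc : ∀ i, c.count (Sum.inr i) = 1) (h : Fin k → List Endpoint) :
    (c.flatMap (Sum.elim (fun x => [x]) h)).Perm (outer c ++ (List.finRange k).flatMap h) := by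
  refine ((perm_outer c hc).flatMap_right _).trans ?_
  simp [List.flatMap_append, List.flatMap_map]

/-- The labels at the places of a pattern, if the `i`-th missing strand raises the label by
`ex i`. -/
def patternLabels {k : ℕ} (ex : Fin k → ℤ) :
    ℤ → List (Endpoint ⊕ Fin k) → List ((Endpoint ⊕ Fin k) × ℤ)
  | _, [] => []
  | l, x :: c => (x, l) :: patternLabels ex (l + Sum.elim sgn ex x) c

theorem map_fst_patternLabels {k : ℕ} (ex : Fin k → ℤ) (l : ℤ) (c : List (Endpoint ⊕ Fin k)) :
    (patternLabels ex l c).map Prod.fst = c := by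
  induction c generalizing l with
  | nil => rfl
  | cons x u ih => simp [patternLabels, ih]

theorem strandInd_fill {k : ℕ} (ex : Fin k → ℤ) (h : Fin k → List Endpoint)
    (hex : ∀ i, exc (h i) = ex i) (l : ℤ) (c : List (Endpoint ⊕ Fin k)) (a : ℕ) :
    strandInd l (c.flatMap (Sum.elim (fun x => [x]) h)) a =
      ((patternLabels ex l c).map
        fun p => strandInd p.2 (Sum.elim (fun x => [x]) h p.1) a).sum := by
  induction c generalizing l with
  | nil => rfl
  | cons x c ih =>
    rw [List.flatMap_cons, strandInd_append, patternLabels, List.map_cons, List.sum_cons, ih]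
    cases x <;> simp [hex]

/-- The witness `b` is the label at the unique occurrence of `x`. Being independent of `f`, it
provides the label at which a missing strand is entered. -/
theorem sum_map_single {α : Type*} [DecidableEq α] [BEq α] [LawfulBEq α] (x : α)
    (L : List (α × ℤ))
    (h : (L.map Prod.fst).count x = 1) :
    ∃ b, ∀ f : α × ℤ → ℤ, (L.map fun p => if p.1 = x then f p else 0).sum = f (x, b) := by
  induction L with
  | nil => simp at h
  | cons p L ih =>
    by_cases hp : p.1 = x
    · refine ⟨p.2, fun f => ?_⟩
      have h0 : (L.map Prod.fst).count x = 0 := by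
        simpa [List.count_cons, hp] using h
      rw [List.count_eq_zero] at h0
      have : (L.map fun p => if p.1 = x then f p else 0).sum = 0 := by
        apply List.sum_eq_zero
        intro y hy
        obtain ⟨q, hq, rfl⟩ := List.mem_map.1 hy
        rw [if_neg]
        rintro rfl
        exact h0 (List.mem_map_of_mem hq)
      rw [List.map_cons, List.sum_cons, this, if_pos hp, add_zero, ← hp]
    · obtain ⟨b, hb⟩ := ih (by simpa [List.count_cons, hp] using h)
      exact ⟨b, fun f => by simp [hp, hb]⟩

theorem sum_map_slots {k : ℕ} (L : List ((Endpoint ⊕ Fin k) × ℤ))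
    (h : ∀ i, (L.map Prod.fst).count (Sum.inr i) = 1) :
    ∃ β : Fin k → ℤ, ∀ f : (Endpoint ⊕ Fin k) × ℤ → ℤ, (L.map f).sum =
      (L.map fun p => if p.1.isLeft then f p else 0).sum + ∑ i, f (Sum.inr i, β i) := by
  choose β hβ using fun i => sum_map_single (Sum.inr i) L (h i)
  refine ⟨β, fun f => ?_⟩
  simp_rw [← hβ]
  clear hβ h
  induction L with
  | nil => simp
  | cons p L ih =>
    simp only [List.map_cons, List.sum_cons, ih, Finset.sum_add_distrib]
    obtain ⟨x | i, b⟩ := p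
    · simp; ring
    · simp; ring

/-- The index of an arrow of a filled tangle is the sum of the contributions of the outer part and of
the strands; these depend on the strands only through their excesses and themselves, respectively. -/
theorem ind_fill {k : ℕ} (T : LTangle k)
    (hT : ∀ i, (T.forget.flatMap Prod.snd).count (Sum.inr i) = 1) (ex : Fin k → ℤ) :
    ∃ (out : ℕ → ℤ) (β : Fin k → ℤ),
      (∀ a, (∀ x ∈ outer (T.forget.flatMap Prod.snd), x.1 ≠ a) → out a = 0) ∧
      ∀ h : Fin k → List Endpoint, (∀ i, exc (h i) = ex i) → ∀ a,
        ind (T.fill h) a = out a + ∑ i, strandInd (β i) (h i) a := by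
  -- The labels at all places of the tangle are determined by the excesses `ex` alone, so the outer
  -- contribution and the entry labels `β` are common to both sides of a local move.
  set P : List ((Endpoint ⊕ Fin k) × ℤ) := T.flatMap fun c => patternLabels ex c.2.1 c.2.2 with hP
  have hPf : P.map Prod.fst = T.forget.flatMap Prod.snd := by
    simp [hP, LTangle.forget, List.map_flatMap, List.flatMap_map, map_fst_patternLabels]
  obtain ⟨β, hβ⟩ := sum_map_slots P (by simpa [hPf] using hT)
  refine ⟨fun a => (P.map fun p => if p.1.isLeft then
    strandInd p.2 (Sum.elim (fun x => [x]) (fun _ => []) p.1) a else 0).sum, β, ?_, ?_⟩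
  · intro a ha
    apply List.sum_eq_zero
    intro y hy
    obtain ⟨⟨x | i, b⟩, hq, rfl⟩ := List.mem_map.1 hy
    · simp only [Sum.isLeft_inl, if_true, Sum.elim_inl]
      apply strandInd_eq_zero
      intro z hz
      obtain rfl : z = x := by simpa using hz
      apply ha
      simp only [outer, List.mem_filterMap]
      refine ⟨Sum.inl z, ?_, rfl⟩
      rw [← hPf]
      exact List.mem_map_of_mem hq
    · rfl
  · intro h hex a
    have h1 : ind (T.fill h) a =
        (P.map fun p => strandInd p.2 (Sum.elim (fun x => [x]) h p.1) a).sum := by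
      rw [hP, ind, LTangle.fill]
      clear hβ hPf hP P hT
      induction T with
      | nil => rfl
      | cons c T ih =>
        simp only [List.map_cons, List.sum_cons, List.flatMap_cons, List.map_append,
          List.sum_append, ← ih, strandInd_fill ex h hex]
    rw [h1, hβ]
    congr 3
    ext ⟨x | i, b⟩ <;> simp

/-! ### Excesses and indices in the local pictures of the Reidemeister moves -/

theorem exc_eq_of_localMove {k : ℕ} {h h' : Fin k → List Endpoint} (hl : LocalMove h h') (i : Fin k) :
    exc (h i) = exc (h' i) := by
  cases hl with
  | fr1 a e => fin_cases i; cases e <;> simp [sgn]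
  | fr2 a b p q hp hq =>
    fin_cases i
    · simp [exc_perm hp, sgn]
    · simp [exc_perm hq, sgn]
  | fr3 a b c e0 e1 e2 =>
    fin_cases i <;> simp [exc_perm (List.reverse_perm _)]

theorem IsGauss.filter {w : List Endpoint} (hw : IsGauss w) (p : ℕ → Bool) :
    IsGauss (w.filter fun x => p x.1) :=
  ⟨hw.1.filter _, fun x hx => by
    rw [List.mem_filter] at hx ⊢
    exact ⟨hw.2 x hx.1, hx.2⟩⟩

theorem IsGauss.perm {w w' : List Endpoint} (hw : IsGauss w) (h : w.Perm w') : IsGauss w' :=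
  ⟨h.nodup_iff.1 hw.1, fun x hx => h.mem_iff.1 (hw.2 x (h.mem_iff.2 hx))⟩

/-- Both endpoints of `a` already lie on the inserted strands, and no endpoint occurs twice. -/
theorem outer_ne_of_mem {k : ℕ} (c : List (Endpoint ⊕ Fin k))
    (hc : ∀ i, c.count (Sum.inr i) = 1) (h : Fin k → List Endpoint)
    (hg : (c.flatMap (Sum.elim (fun x => [x]) h)).Nodup) {i j : Fin k} {a : ℕ}
    (hO : O a ∈ h i) (hU : U a ∈ h j) : ∀ x ∈ outer c, x.1 ≠ a := by
  have hd := ((flatMap_elim_perm c hc h).nodup_iff.1 hg)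
  rw [List.nodup_append'] at hd
  rintro ⟨x, e⟩ hx rfl
  refine hd.2.2 hx (List.mem_flatMap.2 ?_)
  cases e
  · exact ⟨j, List.mem_finRange _, hU⟩
  · exact ⟨i, List.mem_finRange _, hO⟩

theorem perm_pair {α : Type*} {p : List α} {x y : α} (h : p.Perm [x, y]) : p = [x, y] ∨ p = [y, x] := by
  have hl := h.length_eq
  match p, hl with
  | [u, v], _ =>
    have h1 : u ∈ [x, y] := h.mem_iff.1 (by simp)
    simp only [List.mem_cons, List.not_mem_nil, or_false] at h1
    rcases h1 with rfl | rfl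
    · rw [List.perm_cons, List.perm_singleton] at h
      exact Or.inl (by rw [h])
    · have h2 := (h.trans (List.Perm.swap _ _ _))
      rw [List.perm_cons, List.perm_singleton] at h2
      exact Or.inr (by rw [h2])

/-- The sum of the values of `f` at the indices of the arrows with a tail in `w`. -/
def tailSum (f : ℤ → ℤ) (N : ℕ → ℤ) (w : List Endpoint) : ℤ :=
  (w.map fun x => if x.2 then f (N x.1) else 0).sum

/-- The endpoints of arrows on which `N` is a multiple of `r`. -/
def keep (r : ℤ) (N : ℕ → ℤ) (w : List Endpoint) : List Endpoint :=
  w.filter fun x => decide (r ∣ N x.1)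

theorem keep_reverse (r : ℤ) (N : ℕ → ℤ) (w : List Endpoint) :
    keep r N w.reverse = (keep r N w).reverse := by simp [keep]

theorem keep_congr {r : ℤ} {N N' : ℕ → ℤ} {w : List Endpoint} (h : ∀ x ∈ w, N x.1 = N' x.1) :
    keep r N w = keep r N' w := by
  apply List.filter_congr
  intro x hx
  rw [h x hx]

theorem tailSum_congr {f : ℤ → ℤ} {N N' : ℕ → ℤ} {w : List Endpoint} (h : ∀ x ∈ w, N x.1 = N' x.1) :
    tailSum f N w = tailSum f N' w := by
  unfold tailSum
  congr 1
  apply List.map_congr_left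
  intro x hx
  rw [h x hx]

theorem tailSum_reverse (f : ℤ → ℤ) (N : ℕ → ℤ) (w : List Endpoint) :
    tailSum f N w.reverse = tailSum f N w := by simp [tailSum]

theorem dvd_of_signed_sum {r x y z : ℤ} {s : Bool → ℤ} (hs : ∀ e, s e * s e = 1) {e0 e1 e2 : Bool}
    (h : s e0 * x + s e1 * y + s e2 * z = 0) (hx : r ∣ x) (hy : r ∣ y) : r ∣ z := by
  have : z = -(s e2 * (s e0 * x + s e1 * y)) := by
    linear_combination (-z) * hs e2 + s e2 * h
  rw [this]
  exact ((hx.mul_left _).add (hy.mul_left _)).mul_left _ |>.neg_right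

/-- At most one of the two endpoints survives, so there is nothing to reverse. -/
theorem keep_triangle {r : ℤ} {N : ℕ → ℤ} {x y : Endpoint} (h : ¬ (r ∣ N x.1 ∧ r ∣ N y.1)) :
    keep r N (triangleStrand x y).reverse = keep r N (triangleStrand x y) := by
  by_cases hx : r ∣ N x.1 <;> by_cases hy : r ∣ N y.1 <;>
    simp_all [keep, triangleStrand] <;> split_ifs <;> simp [hx, hy]

theorem keep_triangle_self {r : ℤ} {N : ℕ → ℤ} {x y : Endpoint} (hx : r ∣ N x.1) (hy : r ∣ N y.1) :
    keep r N (triangleStrand x y) = triangleStrand x y := by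
  unfold keep triangleStrand
  split_ifs <;> simp [hx, hy]

theorem mem_triangleStrand {x y z : Endpoint} : z ∈ triangleStrand x y ↔ z = x ∨ z = y := by
  unfold triangleStrand
  split_ifs <;> simp [or_comm]

/-- An arrow that meets the local picture lies in it entirely; its index is therefore a sum over the
strands, without an outer contribution. -/
theorem LocalMove.exists_mem {k : ℕ} {h h' : Fin k → List Endpoint} (hl : LocalMove h h') {i : Fin k}
    {x : Endpoint} (hx : x ∈ h i) : ∃ i j, O x.1 ∈ h i ∧ U x.1 ∈ h j := by
  cases hl with
  | fr1 a e =>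
    refine ⟨0, 0, ?_⟩
    fin_cases i
    simp only [Fin.zero_eta, Matrix.cons_val_zero, List.mem_cons, List.not_mem_nil, or_false] at hx ⊢
    rcases hx with rfl | rfl <;> cases e <;> simp
  | fr2 a b p q hp hq =>
    have hf : x.1 = a ∨ x.1 = b := by
      fin_cases i
      · have := hp.mem_iff.1 hx
        simp at this; rcases this with rfl | rfl <;> simp
      · have := hq.mem_iff.1 hx
        simp at this; rcases this with rfl | rfl <;> simp
    rcases hf with h | h <;> rw [h]
    · exact ⟨0, 1, hp.mem_iff.2 (by simp), hq.mem_iff.2 (by simp)⟩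
    · exact ⟨1, 0, hq.mem_iff.2 (by simp), hp.mem_iff.2 (by simp)⟩
  | fr3 a b c e0 e1 e2 =>
    have hf : x.1 = a ∨ x.1 = b ∨ x.1 = c := by
      fin_cases i <;> rcases mem_triangleStrand.1 hx with rfl | rfl <;> simp
    rcases hf with h | h | h <;> rw [h]
    · cases e0
      · exact ⟨1, 0, mem_triangleStrand.2 (Or.inr rfl), mem_triangleStrand.2 (Or.inl rfl)⟩
      · exact ⟨0, 1, mem_triangleStrand.2 (Or.inl rfl), mem_triangleStrand.2 (Or.inr rfl)⟩
    · cases e1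
      · exact ⟨2, 1, mem_triangleStrand.2 (Or.inr rfl), mem_triangleStrand.2 (Or.inl rfl)⟩
      · exact ⟨1, 2, mem_triangleStrand.2 (Or.inl rfl), mem_triangleStrand.2 (Or.inr rfl)⟩
    · cases e2
      · exact ⟨0, 2, mem_triangleStrand.2 (Or.inr rfl), mem_triangleStrand.2 (Or.inl rfl)⟩
      · exact ⟨2, 0, mem_triangleStrand.2 (Or.inl rfl), mem_triangleStrand.2 (Or.inr rfl)⟩

theorem LocalMove.mem_of_mem {k : ℕ} {h h' : Fin k → List Endpoint} (hl : LocalMove h h') {i : Fin k}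
    {x : Endpoint} (hx : x ∈ h' i) : x ∈ h i := by
  cases hl with
  | fr1 a e => fin_cases i; simp at hx
  | fr2 a b p q hp hq => fin_cases i <;> simp at hx
  | fr3 a b c e0 e1 e2 => fin_cases i <;> exact List.mem_reverse.1 hx

/-- Behaviour of the indices of the arrows in the local pictures of the Reidemeister moves. -/
theorem LocalMove.ind {k : ℕ} {h h' : Fin k → List Endpoint} (hl : LocalMove h h') (β : Fin k → ℤ)
    (hnd : ((List.finRange k).flatMap h).Nodup) (N N' : ℕ → ℤ)
    (hN : ∀ a i j, O a ∈ h i → U a ∈ h j → N a = ∑ i, strandInd (β i) (h i) a)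
    (hN' : ∀ a i j, O a ∈ h' i → U a ∈ h' j → N' a = ∑ i, strandInd (β i) (h' i) a) (r : ℤ) :
    ((∀ i, keep r N (h i) = keep r N' (h' i)) ∨
      LocalMove (fun i => keep r N (h i)) (fun i => keep r N' (h' i))) ∧
    ∀ f : ℤ → ℤ, (∀ n, f (-n) = -f n) →
      ∑ i, tailSum f N (h i) = ∑ i, tailSum f N' (h' i) := by
  cases hl with
  | fr1 a e =>
    -- An adjacent tail and head have the same height, whichever comes first.
    have h0 : N a = 0 := by
      rw [hN a 0 0 (by cases e <;> simp) (by cases e <;> simp)]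
      cases e <;> simp [strandInd_cons, wt, sgn] <;> ring
    refine ⟨Or.inr ?_, fun f hf => ?_⟩
    · convert LocalMove.fr1 a e using 1
      · funext i; fin_cases i; simp [keep, h0]
      · funext i; fin_cases i; simp [keep]
    · have := hf 0
      cases e <;> simp [tailSum, h0] <;> simp at this <;> omega
  | fr2 a b p q hp hq =>
    have hab : a ≠ b := by
      rintro rfl
      have h1 : O a ∈ p := hp.mem_iff.2 (by simp)
      have h2 : O a ∈ q := hq.mem_iff.2 (by simp)
      simp [List.finRange_succ, List.nodup_append'] at hnd
      exact hnd.2.2 h1 h2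
    have hba := hab.symm
    have ha := hN a 0 1 (hp.mem_iff.2 (by simp)) (hq.mem_iff.2 (by simp))
    have hb := hN b 1 0 (hq.mem_iff.2 (by simp)) (hp.mem_iff.2 (by simp))
    -- On each strand the tail of one arrow is adjacent to the head of the other, and these have
    -- equal heights. The two arrows thus join the same two heights in opposite directions.
    have hs : N b = -N a := by
      rw [ha, hb]
      rcases perm_pair hp with rfl | rfl <;> rcases perm_pair hq with rfl | rfl <;>
        simp [Fin.sum_univ_two, strandInd_cons, wt, sgn, hab, hba] <;> ring
    have hf : ∀ x, x ∈ p ∨ x ∈ q → x.1 = a ∨ x.1 = b := by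
      rintro x (hx | hx)
      · have := hp.mem_iff.1 hx
        simp at this; rcases this with rfl | rfl <;> simp
      · have := hq.mem_iff.1 hx
        simp at this; rcases this with rfl | rfl <;> simp
    refine ⟨?_, fun f hf => ?_⟩
    · by_cases hd : r ∣ N a
      · right
        have : ∀ x, x ∈ p ∨ x ∈ q → r ∣ N x.1 := by
          intro x hx
          rcases hf x hx with h | h <;> rw [h]
          · exact hd
          · rw [hs]; exact hd.neg_right
        convert LocalMove.fr2 a b p q hp hq using 1
        · funext i
          fin_cases i
          · exact List.filter_eq_self.2 fun x hx => decide_eq_true (this x (Or.inl hx))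
          · exact List.filter_eq_self.2 fun x hx => decide_eq_true (this x (Or.inr hx))
        · funext i; fin_cases i <;> simp [keep]
      · left
        have : ∀ x, x ∈ p ∨ x ∈ q → ¬ r ∣ N x.1 := by
          intro x hx
          rcases hf x hx with h | h <;> rw [h]
          · exact hd
          · rw [hs]; simpa using hd
        intro i
        fin_cases i
        · exact List.filter_eq_nil_iff.2 fun x hx => by simpa using this x (Or.inl hx)
        · exact List.filter_eq_nil_iff.2 fun x hx => by simpa using this x (Or.inr hx)
    · have h1 : tailSum f N p = tailSum f N [O a, U b] := (hp.map _).sum_eq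
      have h2 : tailSum f N q = tailSum f N [U a, O b] := (hq.map _).sum_eq
      simp [Fin.sum_univ_two, h1, h2]
      simp [tailSum, hs, hf]
  | fr3 a b c e0 e1 e2 =>
    have hd : a ≠ b ∧ b ≠ c ∧ a ≠ c := by
      refine ⟨?_, ?_, ?_⟩ <;> rintro rfl <;> revert hnd <;> cases e0 <;> cases e1 <;> cases e2 <;>
        simp [List.finRange_succ, triangleStrand]
    obtain ⟨hab, hbc, hac⟩ := hd
    have hba := hab.symm
    have hcb := hbc.symm
    have hca := hac.symm
    have hm : ∀ d, d = a ∨ d = b ∨ d = c → ∃ i j,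
        O d ∈ (![triangleStrand (a, e0) (c, !e2), triangleStrand (b, e1) (a, !e0),
          triangleStrand (c, e2) (b, !e1)] : Fin 3 → _) i ∧
        U d ∈ (![triangleStrand (a, e0) (c, !e2), triangleStrand (b, e1) (a, !e0),
          triangleStrand (c, e2) (b, !e1)] : Fin 3 → _) j := by
      have hloc := LocalMove.fr3 a b c e0 e1 e2
      rintro d (rfl | rfl | rfl)
      · exact hloc.exists_mem (i := 0) (mem_triangleStrand.2 (Or.inl rfl))
      · exact hloc.exists_mem (i := 1) (mem_triangleStrand.2 (Or.inl rfl))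
      · exact hloc.exists_mem (i := 2) (mem_triangleStrand.2 (Or.inl rfl))
    have hrev : ∀ i, (![(triangleStrand (a, e0) (c, !e2)).reverse,
        (triangleStrand (b, e1) (a, !e0)).reverse,
        (triangleStrand (c, e2) (b, !e1)).reverse] : Fin 3 → List Endpoint) i =
        ((![triangleStrand (a, e0) (c, !e2), triangleStrand (b, e1) (a, !e0),
          triangleStrand (c, e2) (b, !e1)] : Fin 3 → _) i).reverse := by
      intro i; fin_cases i <;> rfl
    have key : ∀ d, d = a ∨ d = b ∨ d = c →
        N d = ∑ i, strandInd (β i) ((![triangleStrand (a, e0) (c, !e2),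
          triangleStrand (b, e1) (a, !e0), triangleStrand (c, e2) (b, !e1)] : Fin 3 → _) i) d ∧
        N' d = ∑ i, strandInd (β i) ((![(triangleStrand (a, e0) (c, !e2)).reverse,
        (triangleStrand (b, e1) (a, !e0)).reverse,
        (triangleStrand (c, e2) (b, !e1)).reverse] : Fin 3 → _) i) d := by
      intro d hd
      obtain ⟨i, j, hi, hj⟩ := hm d hd
      refine ⟨hN d i j hi hj, hN' d i j ?_ ?_⟩
      · rw [hrev]; simpa using hi
      · rw [hrev]; simpa using hj
    obtain ⟨ha, ha'⟩ := key a (by simp)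
    obtain ⟨hb, hb'⟩ := key b (by simp)
    obtain ⟨hc, hc'⟩ := key c (by simp)
    -- A signed index is the height on the next strand minus the height on the previous one. The
    -- cyclic sum therefore reduces to height differences within the strands. Such a difference is
    -- zero on a strand with a tail and a head. Strands with two endpoints of the same kind occur
    -- either not at all or as one with two tails and one with two heads, whose contributions
    -- cancel.
    have hNN : N a = N' a ∧ N b = N' b ∧ N c = N' c ∧
        sgn (0, e0) * N a + sgn (0, e1) * N b + sgn (0, e2) * N c = 0 := by
      rw [ha, hb, hc, ha', hb', hc']
      clear * - hab hba hac hca hbc hcb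
      cases e0 <;> cases e1 <;> cases e2 <;>
        simp [Fin.sum_univ_three, triangleStrand, strandInd_cons, wt, sgn, *] <;> omega
    obtain ⟨hNa, hNb, hNc, hrel⟩ := hNN
    have hmem : ∀ i, ∀ x ∈ (![triangleStrand (a, e0) (c, !e2), triangleStrand (b, e1) (a, !e0),
          triangleStrand (c, e2) (b, !e1)] : Fin 3 → List Endpoint) i, N x.1 = N' x.1 := by
      intro i x hx
      fin_cases i <;> rcases mem_triangleStrand.1 hx with rfl | rfl <;> assumption
    have hK : ∀ i, keep r N' ((![(triangleStrand (a, e0) (c, !e2)).reverse,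
        (triangleStrand (b, e1) (a, !e0)).reverse,
        (triangleStrand (c, e2) (b, !e1)).reverse] : Fin 3 → List Endpoint) i) =
        (keep r N ((![triangleStrand (a, e0) (c, !e2), triangleStrand (b, e1) (a, !e0),
          triangleStrand (c, e2) (b, !e1)] : Fin 3 → _) i)).reverse := by
      intro i
      rw [hrev, keep_reverse, keep_congr (hmem i)]
    refine ⟨?_, fun f hf => ?_⟩
    · have hs : ∀ e, sgn (0, e) * sgn (0, e) = 1 := by intro e; cases e <;> rfl
      have ht1 : r ∣ N a → r ∣ N b → r ∣ N c := dvd_of_signed_sum hs hrel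
      have ht2 : r ∣ N b → r ∣ N c → r ∣ N a := dvd_of_signed_sum hs (e0 := e1) (e1 := e2) (e2 := e0) (by linear_combination hrel)
      have ht3 : r ∣ N a → r ∣ N c → r ∣ N b :=
        dvd_of_signed_sum hs (e0 := e0) (e1 := e2) (e2 := e1) (by linear_combination hrel)
      -- By the linear relation, exactly two of the three indices cannot be multiples of `r`. Either
      -- the whole triangle survives, or at most one arrow does and the move becomes invisible.
      by_cases hall : r ∣ N a ∧ r ∣ N b ∧ r ∣ N c
      · obtain ⟨ka, kb, kc⟩ := hall
        right
        have hself : ∀ i, keep r N ((![triangleStrand (a, e0) (c, !e2),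
            triangleStrand (b, e1) (a, !e0), triangleStrand (c, e2) (b, !e1)] :
              Fin 3 → List Endpoint) i) =
            (![triangleStrand (a, e0) (c, !e2), triangleStrand (b, e1) (a, !e0),
              triangleStrand (c, e2) (b, !e1)] : Fin 3 → List Endpoint) i := by
          intro i
          fin_cases i <;> refine keep_triangle_self ?_ ?_ <;> assumption
        convert LocalMove.fr3 a b c e0 e1 e2 using 1
        · funext i
          exact hself i
        · funext i
          rw [hK, hself, hrev]
      · left
        intro i
        rw [hK, ← keep_reverse]
        symm
        fin_cases i <;> apply keep_triangle <;> simp only <;> tauto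
    · refine Finset.sum_congr rfl fun i _ => ?_
      rw [hrev, tailSum_reverse, tailSum_congr (hmem i)]

/-! ### Sublinks and signed counts of indices under homotopies of labelled links -/

theorem cov_eq (r : ℤ) (E : List LCircle) : cov r E = E.map fun c => (c.1, keep r (ind E) c.2.2) := rfl

theorem endpoints_map_keep (r : ℤ) (N : ℕ → ℤ) (C : List Circle) :
    endpoints (C.map fun c => (c.1, keep r N c.2)) = keep r N (endpoints C) := by
  simp [endpoints, keep, List.flatMap_map, List.filter_flatMap]

theorem tally_eq (f : ℤ → ℤ) (E : List LCircle) :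
    tally f E = tailSum f (ind E) (endpoints (E.map LCircle.forget)) := rfl

theorem tailSum_append (f : ℤ → ℤ) (N : ℕ → ℤ) (u v : List Endpoint) :
    tailSum f N (u ++ v) = tailSum f N u + tailSum f N v := by simp [tailSum]

theorem tailSum_perm (f : ℤ → ℤ) (N : ℕ → ℤ) {u v : List Endpoint} (h : u.Perm v) :
    tailSum f N u = tailSum f N v := (h.map _).sum_eq

theorem tailSum_flatMap {k : ℕ} (f : ℤ → ℤ) (N : ℕ → ℤ) (h : Fin k → List Endpoint) :
    tailSum f N ((List.finRange k).flatMap h) = ∑ i, tailSum f N (h i) := by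
  rw [← List.sum_ofFn, List.ofFn_eq_map]
  induction List.finRange k with
  | nil => rfl
  | cons i l ih => simp [tailSum_append, ih]

/-- Keep only the outer endpoints on which `N` is a multiple of `r`. -/
def Tangle.keep {k : ℕ} (r : ℤ) (N : ℕ → ℤ) (T : Tangle k) : Tangle k :=
  T.map fun c => (c.1, c.2.filter (Sum.elim (fun x => decide (r ∣ N x.1)) fun _ => true))

theorem Tangle.keep_fill {k : ℕ} (r : ℤ) (N : ℕ → ℤ) (T : Tangle k) (h : Fin k → List Endpoint) :
    (T.fill h).map (fun c => (c.1, FlatKnots.keep r N c.2)) =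
      (T.keep r N).fill fun i => FlatKnots.keep r N (h i) := by
  simp only [Tangle.fill, Tangle.keep, List.map_map]
  apply List.map_congr_left
  rintro ⟨t, c⟩ -
  simp only [Function.comp_apply, Prod.mk.injEq, true_and]
  induction c with
  | nil => rfl
  | cons x c ih =>
    rw [List.flatMap_cons, FlatKnots.keep, List.filter_append]
    rw [FlatKnots.keep] at ih
    rw [ih]
    cases x with
    | inl x => by_cases hx : r ∣ N x.1 <;> simp [hx]
    | inr i => simp [List.filter_cons, FlatKnots.keep]

theorem Tangle.keep_congr {k : ℕ} {r : ℤ} {N N' : ℕ → ℤ} {T : Tangle k}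
    (h : ∀ x ∈ outer (T.flatMap Prod.snd), N x.1 = N' x.1) : T.keep r N = T.keep r N' := by
  unfold Tangle.keep
  apply List.map_congr_left
  rintro ⟨t, c⟩ hc
  congr 1
  apply List.filter_congr
  rintro (x | i) hx
  · simp only [Sum.elim_inl]
    rw [h x]
    simp only [outer, List.mem_filterMap]
    exact ⟨Sum.inl x, List.mem_flatMap.2 ⟨_, hc, hx⟩, rfl⟩
  · rfl

theorem Tangle.count_keep {k : ℕ} (r : ℤ) (N : ℕ → ℤ) (T : Tangle k) (i : Fin k) :
    ((T.keep r N).flatMap Prod.snd).count (Sum.inr i) = (T.flatMap Prod.snd).count (Sum.inr i) := by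
  have : (T.keep r N).flatMap Prod.snd =
      (T.flatMap Prod.snd).filter (Sum.elim (fun x => decide (r ∣ N x.1)) fun _ => true) := by
    simp [Tangle.keep, List.flatMap_map, List.filter_flatMap]
  rw [this, List.count_filter]
  rfl

theorem cov_fill {k : ℕ} (r : ℤ) (T : LTangle k) (h : Fin k → List Endpoint) :
    cov r (T.fill h) = (T.forget.keep r (ind (T.fill h))).fill
      fun i => keep r (ind (T.fill h)) (h i) := by
  rw [← Tangle.keep_fill, ← LTangle.forget_fill, List.map_map]
  rfl

theorem isGauss_keep {w : List Endpoint} (hw : IsGauss w) (r : ℤ) (N : ℕ → ℤ) :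
    IsGauss (keep r N w) := hw.filter fun a => decide (r ∣ N a)

theorem isGauss_cov {E : List LCircle} (hE : IsGauss (endpoints (E.map LCircle.forget))) (r : ℤ) :
    IsGauss (endpoints (cov r E)) := by
  have : cov r E = (E.map LCircle.forget).map fun c => (c.1, keep r (ind E) c.2) := by
    rw [cov_eq, List.map_map]; rfl
  rw [this, endpoints_map_keep]
  exact isGauss_keep hE _ _

/-- Local moves preserve the excess of each strand, so labels outside the picture do not change.
Arrows outside keep their indices, and the arrows inside are governed by `LocalMove.ind`. Both
directions of the move are recorded because a homotopy step may use either one. -/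
theorem fill_localMove {k : ℕ} {h h' : Fin k → List Endpoint} (hl : LocalMove h h') (T : LTangle k)
    (hT : ∀ i, (T.forget.flatMap Prod.snd).count (Sum.inr i) = 1)
    (hg : IsGauss (endpoints (T.forget.fill h))) (hg' : IsGauss (endpoints (T.forget.fill h')))
    (r : ℤ) :
    (cov r (T.fill h) = cov r (T.fill h') ∨
      (Move (cov r (T.fill h)) (cov r (T.fill h')) ∧ Move (cov r (T.fill h')) (cov r (T.fill h)))) ∧
    ∀ f : ℤ → ℤ, (∀ n, f (-n) = -f n) → tally f (T.fill h) = tally f (T.fill h') := by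
  obtain ⟨out, β, hout, hind⟩ := ind_fill T hT fun i => exc (h i)
  have hN := hind h fun _ => rfl
  have hN' := hind h' fun i => (exc_eq_of_localMove hl i).symm
  have e1 := endpoints_fill T.forget h
  have e2 := endpoints_fill T.forget h'
  have p1 := flatMap_elim_perm _ hT h
  have p2 := flatMap_elim_perm _ hT h'
  rw [← e1] at p1
  rw [← e2] at p2
  have g1 := hg.perm p1
  have g2 := hg'.perm p2
  have n1 := List.nodup_append'.1 g1.1
  have n2 := List.nodup_append'.1 g2.1
  have hloc := hl.ind β n1.2.1 (ind (T.fill h)) (ind (T.fill h'))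
    (fun a i j hi hj => by
      rw [hN, hout, zero_add]
      exact outer_ne_of_mem _ hT h (e1 ▸ hg.1) hi hj)
    (fun a i j hi hj => by
      rw [hN', hout, zero_add]
      exact outer_ne_of_mem _ hT h' (e2 ▸ hg'.1) hi hj) r
  have houter : ∀ x ∈ outer (T.forget.flatMap Prod.snd),
      ind (T.fill h) x.1 = ind (T.fill h') x.1 := by
    intro x hx
    rw [hN, hN', Finset.sum_eq_zero, Finset.sum_eq_zero]
    · intro i _
      refine strandInd_eq_zero _ _ _ fun y hy hxy => ?_
      obtain ⟨i, j, hi, hj⟩ := hl.exists_mem (hl.mem_of_mem hy)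
      exact outer_ne_of_mem _ hT h (e1 ▸ hg.1) hi hj x hx hxy.symm
    · intro i _
      refine strandInd_eq_zero _ _ _ fun y hy hxy => ?_
      obtain ⟨i, j, hi, hj⟩ := hl.exists_mem hy
      exact outer_ne_of_mem _ hT h (e1 ▸ hg.1) hi hj x hx hxy.symm
  refine ⟨?_, fun f hf => ?_⟩
  · rw [cov_fill, cov_fill, ← Tangle.keep_congr houter]
    rcases hloc.1 with h1 | h1
    · left
      congr 1
      funext i
      exact h1 i
    · right
      have c1 : IsGauss (endpoints (cov r (T.fill h))) :=
        isGauss_cov (by rwa [LTangle.forget_fill]) r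
      have c2 : IsGauss (endpoints (cov r (T.fill h'))) :=
        isGauss_cov (by rwa [LTangle.forget_fill]) r
      rw [cov_fill] at c1 c2
      rw [← Tangle.keep_congr houter] at c2
      have hc : ∀ i, ((T.forget.keep r (ind (T.fill h))).flatMap Prod.snd).count (Sum.inr i) = 1 :=
        fun i => by rw [Tangle.count_keep, hT]
      exact ⟨Move.reidemeister _ (Or.inl h1) hc c1 c2, Move.reidemeister _ (Or.inr h1) hc c2 c1⟩
  · rw [tally_eq, tally_eq, LTangle.forget_fill, LTangle.forget_fill, tailSum_perm _ _ p1,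
      tailSum_perm _ _ p2, tailSum_append, tailSum_append, tailSum_flatMap, tailSum_flatMap,
      hloc.2 f hf, tailSum_congr houter]

theorem ind_perm {E E' : List LCircle} (h : E.Perm E') : ind E = ind E' :=
  funext fun _ => (h.map _).sum_eq

theorem endpoints_perm {C C' : List Circle} (h : C.Perm C') :
    (endpoints C).Perm (endpoints C') := h.flatMap_right _

theorem ind_rename (σ : Equiv.Perm ℕ) (E : List LCircle) (a : ℕ) :
    ind (E.map fun c => (c.1, c.2.1, c.2.2.map fun x => (σ x.1, x.2))) (σ a) = ind E a := by
  have h : ∀ l w, strandInd l (w.map fun x => (σ x.1, x.2)) (σ a) = strandInd l w a := by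
    intro l w
    induction w generalizing l with
    | nil => rfl
    | cons x w ih => simp [strandInd_cons, wt, sgn, ih]
  simp [ind, h, Function.comp_def]

theorem keep_rename (r : ℤ) (N N' : ℕ → ℤ) (σ : Equiv.Perm ℕ) (h : ∀ a, N' (σ a) = N a)
    (w : List Endpoint) :
    keep r N' (w.map fun x => (σ x.1, x.2)) = (keep r N w).map fun x => (σ x.1, x.2) := by
  simp [keep, List.filter_map, Function.comp_def, h]

/-- Coverings and signed counts of indices under homotopies of labelled links. -/
theorem LMove.cov_tally {E E' : List LCircle} (hm : LMove E E') (r : ℤ) :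
    (cov r E = cov r E' ∨ Move (cov r E) (cov r E')) ∧
    ∀ f : ℤ → ℤ, (∀ n, f (-n) = -f n) → tally f E = tally f E' := by
  cases hm with
  | perm h =>
    refine ⟨Or.inr ?_, fun f _ => ?_⟩
    · rw [cov_eq, cov_eq, ← ind_perm h]
      exact Move.perm (h.map _)
    · rw [tally_eq, tally_eq, ← ind_perm h, tailSum_perm _ _ (endpoints_perm (h.map _))]
  | rotate t l u v E h =>
    have hi : ind ((t, l, u ++ v) :: E) = ind ((t, l + exc u, v ++ u) :: E) := by
      funext a
      simp only [ind_cons, strandInd_append]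
      rw [add_assoc l, h, add_zero, add_comm (strandInd l u a)]
    refine ⟨Or.inr ?_, fun f _ => ?_⟩
    · rw [cov_eq, cov_eq, ← hi]
      simp only [List.map_cons, keep, List.filter_append]
      exact Move.rotate _ _ _ _
    · rw [tally_eq, tally_eq, ← hi]
      apply tailSum_perm
      simp only [endpoints, LCircle.forget, List.map_cons, List.flatMap_cons]
      exact List.perm_append_comm.append_right _
  | rename σ =>
    refine ⟨Or.inr ?_, fun f _ => ?_⟩
    · rw [cov_eq, cov_eq]
      convert Move.rename σ (E.map fun c => (c.1, keep r (ind E) c.2.2)) using 1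
      rw [List.map_map, List.map_map]
      apply List.map_congr_left
      intro c _
      simp only [Function.comp_apply]
      rw [keep_rename r (ind E) _ σ (ind_rename σ E)]
    · rw [tally_eq, tally_eq]
      simp [endpoints, LCircle.forget, List.flatMap_map, tailSum, List.map_flatMap,
        Function.comp_def, ind_rename]
  | reidemeister T hloc hT hg hg' =>
    rcases hloc with hl | hl
    · have := fill_localMove hl T hT hg hg' r
      exact ⟨this.1.imp_right And.left, this.2⟩
    · have := fill_localMove hl T hT hg' hg r
      exact ⟨(this.1.imp Eq.symm And.right), fun f hf => (this.2 f hf).symm⟩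

/-! ## Labelled movies -/

/-- The sum of the excesses of the circles on the sheet `t`. -/
def sheetExc (C : List Circle) (t : ℕ) : ℤ := (C.map fun c => if c.1 = t then exc c.2 else 0).sum

@[simp] theorem sheetExc_nil (t : ℕ) : sheetExc [] t = 0 := rfl

@[simp] theorem sheetExc_cons (c : Circle) (C : List Circle) (t : ℕ) :
    sheetExc (c :: C) t = (if c.1 = t then exc c.2 else 0) + sheetExc C t := by simp [sheetExc]

theorem exc_fill {k : ℕ} {h h' : Fin k → List Endpoint} (he : ∀ i, exc (h i) = exc (h' i))
    (c : List (Endpoint ⊕ Fin k)) :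
    exc (c.flatMap (Sum.elim (fun x => [x]) h)) = exc (c.flatMap (Sum.elim (fun x => [x]) h')) := by
  induction c with
  | nil => rfl
  | cons x c ih => cases x <;> simp [ih, he]

theorem exc_rename (σ : ℕ → ℕ) (w : List Endpoint) :
    exc (w.map fun x => (σ x.1, x.2)) = exc w := by
  simp only [exc, List.map_map]
  rfl

/-- Homotopies preserve the sheets and the excesses of the circles. -/
theorem Move.perm_exc {C C' : List Circle} (hm : Move C C') :
    (C.map fun c => (c.1, exc c.2)).Perm (C'.map fun c => (c.1, exc c.2)) := by
  cases hm with
  | perm h => exact h.map _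
  | rotate t u v C => simp [add_comm]
  | rename σ => simp [Function.comp_def, exc_rename]
  | @reidemeister k h h' T hloc hT hg hg' =>
    have : ∀ i, exc (h i) = exc (h' i) := by
      intro i
      rcases hloc with hl | hl
      · exact exc_eq_of_localMove hl i
      · exact (exc_eq_of_localMove hl i).symm
    simp [Tangle.fill, Function.comp_def, exc_fill this]

theorem Move.sheetExc_eq {C C' : List Circle} (hm : Move C C') (t : ℕ) :
    sheetExc C t = sheetExc C' t := by
  have := (hm.perm_exc.map fun p => if p.1 = t then p.2 else 0).sum_eq
  simpa [sheetExc, Function.comp_def] using this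

theorem Move.length_eq {C C' : List Circle} (hm : Move C C') : C.length = C'.length := by
  simpa using hm.perm_exc.length_eq

theorem Move.tags {C C' : List Circle} (hm : Move C C') {P : Finset ℕ} (h : ∀ c ∈ C, c.1 ∈ P) :
    ∀ c ∈ C', c.1 ∈ P := by
  intro c hc
  have := hm.perm_exc.mem_iff.2 (List.mem_map_of_mem hc)
  obtain ⟨d, hd, he⟩ := List.mem_map.1 this
  have : d.1 = c.1 := (Prod.mk.inj he).1
  exact this ▸ h d hd

theorem Move.exc_zero {C C' : List Circle} (hm : Move C C') (h : ∀ c ∈ C', exc c.2 = 0) :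
    ∀ c ∈ C, exc c.2 = 0 := by
  intro c hc
  have := hm.perm_exc.mem_iff.1 (List.mem_map_of_mem hc)
  obtain ⟨d, hd, he⟩ := List.mem_map.1 this
  have : exc d.2 = exc c.2 := (Prod.mk.inj he).2
  exact this ▸ h d hd

/-- Exchanging tails and heads permutes the word and negates the excess. -/
theorem exc_eq_zero_of_isGauss {w : List Endpoint} (hw : IsGauss w) : exc w = 0 := by
  have h1 : w.Perm (w.map fun x => (x.1, !x.2)) := by
    rw [List.perm_ext_iff_of_nodup hw.1]
    · intro x
      constructor
      · intro hx
        exact List.mem_map.2 ⟨_, hw.2 x hx, by simp⟩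
      · intro hx
        obtain ⟨y, hy, rfl⟩ := List.mem_map.1 hx
        exact hw.2 y hy
    · refine hw.1.map ?_
      rintro ⟨a, e⟩ ⟨b, f⟩ h
      simpa using h
  have h2 : exc (w.map fun x => (x.1, !x.2)) = -exc w := by
    clear h1 hw
    induction w with
    | nil => rfl
    | cons x w ih =>
      obtain ⟨a, e⟩ := x
      cases e <;> simp [sgn, ih] <;> ring
  have := exc_perm h1
  omega

theorem card_merge {P : Finset ℕ} {t t' : ℕ} (ht : t ∈ P) (ht' : t' ∈ P) (h : t ≠ t') :
    (P.image fun i => if i = t' then t else i).card + 1 = P.card := by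
  have : (P.image fun i => if i = t' then t else i) = P.erase t' := by
    ext i
    simp only [Finset.mem_image, Finset.mem_erase]
    constructor
    · rintro ⟨j, hj, rfl⟩
      split_ifs with h1
      · exact ⟨h, ht⟩
      · exact ⟨h1, hj⟩
    · rintro ⟨h1, h2⟩
      exact ⟨i, h2, by simp [h1]⟩
  rw [this, Finset.card_erase_add_one ht']

theorem sheetExc_relabel (t t' i : ℕ) (C : List Circle) :
    sheetExc (C.map fun c => (if c.1 = t' then t else c.1, c.2)) i =
      if i = t then (if t = t' then sheetExc C t else sheetExc C t + sheetExc C t')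
      else if i = t' then 0 else sheetExc C i := by
  induction C with
  | nil => simp
  | cons c C ih =>
    rw [List.map_cons, sheetExc_cons, ih]
    simp only [sheetExc_cons]
    grind

/-- Basic facts on the stills of a movie of a knot; the last one is a bound for the Euler
characteristic. -/
theorem Movie.basic {w : List Endpoint} (hw : IsGauss w) {b d s : ℕ} {S : Still}
    (h : Movie ⟨[(0, w)], {0}⟩ b d s S) :
    (∀ c ∈ S.circles, c.1 ∈ S.sheets) ∧ (∀ t, sheetExc S.circles t = 0) ∧
      S.circles.length + b + d + 1 ≤ s + 2 * S.sheets.card := by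
  induction h with
  | start => simp [exc_eq_zero_of_isGauss hw]
  | homotopy _ hm ih =>
    obtain ⟨h1, h2, h3⟩ := ih
    exact ⟨hm.tags h1, fun t => by rw [← h2 t]; exact (hm.sheetExc_eq t).symm,
      by simpa [hm.length_eq] using h3⟩
  | birth t _ ht ih =>
    obtain ⟨h1, h2, h3⟩ := ih
    refine ⟨?_, ?_, ?_⟩
    · simp only [List.mem_cons, forall_eq_or_imp]
      exact ⟨by simp, fun c hc => Finset.mem_insert_of_mem (h1 c hc)⟩
    · intro t; simpa using h2 t
    · rw [Finset.card_insert_of_notMem ht, List.length_cons]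
      simp only at h3
      omega
  | death _ ih =>
    obtain ⟨h1, h2, h3⟩ := ih
    refine ⟨fun c hc => h1 c (List.mem_cons_of_mem _ hc), ?_, ?_⟩
    · intro t; simpa using h2 t
    · simp only [List.length_cons] at h3 ⊢
      omega
  | split _ ih =>
    obtain ⟨h1, h2, h3⟩ := ih
    refine ⟨?_, ?_, ?_⟩
    · simp only [List.mem_cons, forall_eq_or_imp] at h1 ⊢
      exact ⟨h1.1, h1.1, h1.2⟩
    · intro t
      rw [← h2 t]
      simp only [sheetExc_cons]
      split_ifs <;> simp <;> ring
    · simp only [List.length_cons] at h3 ⊢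
      omega
  | @merge b d s C P t t' u v _ ih =>
    obtain ⟨h1, h2, h3⟩ := ih
    simp only [List.mem_cons, forall_eq_or_imp] at h1
    refine ⟨?_, ?_, ?_⟩
    · simp only [List.mem_cons, forall_eq_or_imp, List.mem_map, Finset.mem_image]
      constructor
      · exact ⟨t, h1.1, by simp⟩
      · rintro c ⟨e, he, rfl⟩
        exact ⟨e.1, h1.2.2 e he, rfl⟩
    · intro i
      rw [sheetExc_cons, sheetExc_relabel]
      have e1 := h2 t
      have e2 := h2 t'
      have e3 := h2 i
      simp only [sheetExc_cons, exc_append] at e1 e2 e3 ⊢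
      grind
    -- Merging two circles of one sheet creates genus and leaves a slack of two in the bound;
    -- merging different sheets keeps the slack as it was.
    · by_cases h : t = t'
      · subst h
        have : (P.image fun i => if i = t then t else i) = P := by
          rw [show (fun i => if i = t then t else i) = id from by
            funext i
            split_ifs with hi <;> simp [hi], Finset.image_id]
        simp only [this, List.length_cons, List.length_map] at h3 ⊢
        omega
      · have := card_merge h1.1 h1.2.1 h
        simp only [List.length_cons, List.length_map] at h3 ⊢
        omega

/-! ### Labelling the movies of surfaces of genus zero -/

/-- Raising all heights by `m` adds `m` for a head of `a` on the strand and subtracts `m` for a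
tail. On a single circle the two cancel, which is why the index of an arrow of a knot does not
depend on the base label. -/
theorem strandInd_add (l m : ℤ) (w : List Endpoint) (a : ℕ) :
    strandInd (l + m) w a = strandInd l w a - m * exc (w.filter fun x => decide (x.1 = a)) := by
  induction w generalizing l with
  | nil => simp
  | cons x w ih =>
    rw [strandInd_cons, strandInd_cons, add_right_comm, ih]
    by_cases hx : x.1 = a
    · rw [List.filter_cons_of_pos (by simpa using hx), exc_cons]
      simp only [wt, hx, if_true]
      split_ifs <;> ring
    · rw [List.filter_cons_of_neg (by simpa using hx)]
      simp only [wt, hx, if_false]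
      ring

theorem ind_singleton {w : List Endpoint} (hw : IsGauss w) (t : ℕ) (l : ℤ) :
    ind [(t, l, w)] = ind [(0, 0, w)] := by
  funext a
  simp only [ind_cons, ind_nil, add_zero]
  rw [← zero_add l, strandInd_add, exc_eq_zero_of_isGauss (hw.filter fun b => decide (b = a))]
  ring

theorem tally_congr {E E' : List LCircle} (f : ℤ → ℤ) (hi : ind E = ind E')
    (he : endpoints (E.map LCircle.forget) = endpoints (E'.map LCircle.forget)) :
    tally f E = tally f E' := by rw [tally_eq, tally_eq, hi, he]

theorem sheetExc_eq_zero {C : List Circle} (h : ∀ c ∈ C, exc c.2 = 0) (t : ℕ) :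
    sheetExc C t = 0 := by
  apply List.sum_eq_zero
  intro y hy
  obtain ⟨c, hc, rfl⟩ := List.mem_map.1 hy
  split_ifs
  · exact h c hc
  · rfl

/-- A movie that sweeps out a surface of genus zero, and whose circles have as many tails as heads, can be
labelled, uniquely up to a shift on each component of the surface. Passing to the sublinks of the
arrows of indices divisible by `r` gives a movie, and signed counts of indices are constant. -/
theorem Movie.labelled {w : List Endpoint} (hw : IsGauss w) (r : ℤ) {b d s : ℕ} {S : Still}
    (h : Movie ⟨[(0, w)], {0}⟩ b d s S)
    (heq : S.circles.length + b + d + 1 = s + 2 * S.sheets.card)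
    (hexc : ∀ c ∈ S.circles, exc c.2 = 0) :
    ∃ E : List LCircle, E.map LCircle.forget = S.circles ∧ ∀ c : ℕ → ℤ,
      Movie ⟨cov r [(0, 0, w)], {0}⟩ b d s ⟨cov r (shift c E), S.sheets⟩ ∧
      ∀ f : ℤ → ℤ, (∀ n, f (-n) = -f n) → tally f (shift c E) = tally f [(0, 0, w)] := by
  induction h with
  | start =>
    refine ⟨[(0, 0, w)], rfl, fun c => ⟨?_, fun f _ => ?_⟩⟩
    · have : cov r (shift c [(0, 0, w)]) = cov r [(0, 0, w)] := by
        simp only [cov_eq, shift, List.map_cons, List.map_nil, ind_singleton hw 0 (0 + c 0)]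
      rw [this]
      exact Movie.start
    · exact tally_congr f (ind_singleton hw 0 (0 + c 0)) rfl
  | homotopy _ hm ih =>
    have h0 := hm.exc_zero hexc
    obtain ⟨E, hE, H⟩ := ih (by simpa [hm.length_eq] using heq) h0
    obtain ⟨E', hE', hl⟩ := hm.lift h0 E hE
    refine ⟨E', hE', fun c => ?_⟩
    have h1 := (hl.shift c).cov_tally r
    refine ⟨?_, fun f hf => by rw [← h1.2 f hf, (H c).2 f hf]⟩
    rcases h1.1 with h2 | h2
    · rw [← h2]; exact (H c).1
    · exact (H c).1.homotopy h2
  | birth t _ ht ih =>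
    simp only [List.mem_cons, forall_eq_or_imp] at hexc
    rw [Finset.card_insert_of_notMem ht, List.length_cons] at heq
    obtain ⟨E, hE, H⟩ := ih (by simp only; omega) hexc.2
    -- The label 0 is arbitrary: the new circle has a sheet of its own, and the claim covers all
    -- shifts of sheets.
    refine ⟨(t, 0, []) :: E, by rw [List.map_cons, hE]; rfl, fun c => ?_⟩
    have hi : ind (shift c ((t, 0, []) :: E)) = ind (shift c E) := by
      funext a; simp [shift]
    refine ⟨?_, fun f hf => ?_⟩
    · have : cov r (shift c ((t, 0, []) :: E)) = (t, []) :: cov r (shift c E) := by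
        rw [cov_eq, hi]; rfl
      rw [this]
      exact (H c).1.birth t ht
    · rw [← (H c).2 f hf]
      exact tally_congr f hi (by simp [shift, LCircle.forget, endpoints])
  | @death b d s C P t _ ih =>
    obtain ⟨E, hE, H⟩ := ih (by simp only [List.length_cons] at heq ⊢; omega) (by simpa using hexc)
    obtain ⟨⟨t', l, w'⟩, E', rfl, h1, h2⟩ := List.map_eq_cons_iff.1 hE
    simp only [LCircle.forget, Prod.mk.injEq] at h1
    obtain ⟨rfl, rfl⟩ := h1
    refine ⟨E', h2, fun c => ?_⟩
    have hi : ind (shift c ((t', l, []) :: E')) = ind (shift c E') := by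
      funext a; simp [shift]
    refine ⟨?_, fun f hf => ?_⟩
    · have : cov r (shift c ((t', l, []) :: E')) = (t', []) :: cov r (shift c E') := by
        rw [cov_eq, hi]; rfl
      have h3 := (H c).1
      rw [this] at h3
      exact h3.death
    · rw [← (H c).2 f hf]
      exact tally_congr f hi.symm (by simp [shift, LCircle.forget, endpoints])
  | @split b d s C P t u v _ ih =>
    simp only [List.mem_cons, forall_eq_or_imp] at hexc
    obtain ⟨hu, hv, hC⟩ := hexc
    obtain ⟨E, hE, H⟩ := ih (by simp only [List.length_cons] at heq ⊢; omega) (by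
      simp only [List.mem_cons, forall_eq_or_imp, exc_append, hu, hv]
      exact ⟨rfl, hC⟩)
    obtain ⟨⟨t', l, w'⟩, E', rfl, h1, h2⟩ := List.map_eq_cons_iff.1 hE
    simp only [LCircle.forget, Prod.mk.injEq] at h1
    obtain ⟨rfl, rfl⟩ := h1
    -- The second circle also starts at `l`, since the label returns to `l` after `u`.
    refine ⟨(t', l, u) :: (t', l, v) :: E', by simp [LCircle.forget, ← h2], fun c => ?_⟩
    have hi : ind (shift c ((t', l, u ++ v) :: E')) =
        ind (shift c ((t', l, u) :: (t', l, v) :: E')) := by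
      funext a; simp [shift, strandInd_append, hu, add_assoc]
    refine ⟨?_, fun f hf => ?_⟩
    · have h3 := (H c).1
      rw [cov_eq r (shift c _), hi] at h3
      simp only [shift, List.map_cons, keep, List.filter_append] at h3
      exact h3.split
    · rw [← (H c).2 f hf]
      exact tally_congr f hi.symm (by simp [shift, LCircle.forget, endpoints])
  | @merge b d s C P t t' u v hm ih =>
    obtain ⟨hb1, hb2, hb3⟩ := hm.basic hw
    simp only [List.mem_cons, forall_eq_or_imp, List.mem_map, forall_exists_index, and_imp,
      forall_apply_eq_imp_iff₂, exc_append] at hexc hb1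
    obtain ⟨huv, hC⟩ := hexc
    -- Otherwise the saddle would add genus, and equality after it would violate the bound of
    -- `Movie.basic` before it.
    have htt : t ≠ t' := by
      rintro rfl
      have : (P.image fun i => if i = t then t else i) = P := by
        rw [show (fun i => if i = t then t else i) = id from by
          funext i
          split_ifs with hi <;> simp [hi], Finset.image_id]
      simp only [this, List.length_cons, List.length_map] at heq hb3
      omega
    have hcard := card_merge hb1.1 hb1.2.1 htt
    -- The excesses on the sheet `t` add up to zero, all other circles of this sheet have excess
    -- zero, and `v` lies on a different sheet.
    have hu : exc u = 0 := by
      have := hb2 t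
      simpa [htt.symm, sheetExc_eq_zero hC] using this
    have hv : exc v = 0 := by omega
    obtain ⟨E, hE, H⟩ := ih (by simp only [List.length_cons, List.length_map] at heq ⊢; omega) (by
      simp only [List.mem_cons, forall_eq_or_imp]
      exact ⟨hu, hv, hC⟩)
    obtain ⟨⟨t1, l, u1⟩, E1, rfl, h1, h2⟩ := List.map_eq_cons_iff.1 hE
    obtain ⟨⟨t2, m, v1⟩, E', rfl, h3, h4⟩ := List.map_eq_cons_iff.1 h2
    simp only [LCircle.forget, Prod.mk.injEq] at h1 h3
    obtain ⟨rfl, rfl⟩ := h1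
    obtain ⟨rfl, rfl⟩ := h3
    refine ⟨(t1, l, u1 ++ v1) :: E'.map fun c => (if c.1 = t2 then t1 else c.1,
      if c.1 = t2 then c.2.1 + (l - m) else c.2.1, c.2.2), ?_, fun c => ?_⟩
    · simp only [LCircle.forget, ← h4, List.map_cons, List.map_map]
      rfl
    -- Before the merge, the second sheet is shifted so that the base label of `v1` becomes that of
    -- `u1`. This changes the indices of arrows between the two sheets, and it is the reason for
    -- carrying all shifts through the induction.
    set c' : ℕ → ℤ := fun i => if i = t2 then c t1 + (l - m) else c i with hc'
    have hi : ind (shift c' ((t1, l, u1) :: (t2, m, v1) :: E')) =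
        ind (shift c ((t1, l, u1 ++ v1) :: E'.map fun c => (if c.1 = t2 then t1 else c.1,
          if c.1 = t2 then c.2.1 + (l - m) else c.2.1, c.2.2))) := by
      funext a
      simp only [shift, List.map_cons, ind_cons, strandInd_append, hu, hc', htt, if_false, if_true,
        add_assoc, List.map_map]
      congr 2
      · ring_nf
      · simp only [ind, List.map_map]
        congr 1
        apply List.map_congr_left
        intro e _
        simp only [Function.comp_apply]
        split_ifs <;> ring_nf
    refine ⟨?_, fun f hf => ?_⟩
    · have h5 := (H c').1
      rw [cov_eq r (shift c' _), hi] at h5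
      simp only [shift, List.map_cons] at h5
      have h6 := h5.merge
      convert h6 using 2
      simp [cov_eq, shift, keep, Function.comp_def]
    · rw [← (H c').2 f hf]
      exact tally_congr f hi.symm (by simp [shift, LCircle.forget, endpoints, List.flatMap_map])

/-! ## Flat knots: coverings and signed counts of indices -/

theorem strandInd_of_notMem (l : ℤ) (w : List Endpoint) (a : ℕ) (hO : O a ∉ w) (hU : U a ∉ w) :
    strandInd l w a = 0 := by
  apply strandInd_eq_zero
  rintro ⟨b, e⟩ hx rfl
  cases e
  · exact hU hx
  · exact hO hx

/-- The index of an arrow as a sum over the endpoints of a word. -/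
theorem strandInd_eq_sum {w : List Endpoint} (hw : w.Nodup) {a : ℕ} (hO : O a ∈ w) (hU : U a ∈ w)
    (l : ℤ) : strandInd l w a = (w.map fun x => sgn x *
      ((if w.idxOf x < w.idxOf (U a) then 1 else 0) -
        if w.idxOf x < w.idxOf (O a) then 1 else 0)).sum - 1 := by
  have aux : ∀ (u v : List Endpoint) (y : Endpoint), y ∉ u →
      ((u ++ y :: v).map fun x => sgn x *
        if (u ++ y :: v).idxOf x < (u ++ y :: v).idxOf y then 1 else 0).sum = exc u +
        (v.map fun x => sgn x * if x ∈ u then 1 else 0).sum := by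
    intro u v y hy
    have h1 : (u ++ y :: v).idxOf y = u.length := by
      rw [List.idxOf_append_of_notMem hy]; simp
    have h2 : ∀ x, (u ++ y :: v).idxOf x < u.length ↔ x ∈ u := by
      intro x
      constructor
      · intro hx
        by_contra hxu
        rw [List.idxOf_append_of_notMem hxu] at hx
        omega
      · intro hx
        rw [List.idxOf_append_of_mem hx]
        exact List.idxOf_lt_length_iff.2 hx
    simp only [h1, h2, List.map_append, List.sum_append, List.map_cons, List.sum_cons, hy, if_false,
      mul_zero, zero_add]
    congr 1
    rw [exc]
    congr 1
    apply List.map_congr_left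
    intro x hx
    simp [hx]
  -- The signed count of endpoints before `y` is the excess of the prefix. The index is the
  -- difference of two prefix excesses, less one because the height of a head is the label after it.
  have aux2 : ∀ (u v : List Endpoint) (y : Endpoint), (u ++ y :: v).Nodup →
      ((u ++ y :: v).map fun x => sgn x *
        if (u ++ y :: v).idxOf x < (u ++ y :: v).idxOf y then 1 else 0).sum = exc u := by
    intro u v y hn
    have hn' := List.nodup_append'.1 hn
    rw [aux u v y fun h => hn'.2.2 h List.mem_cons_self]
    have : (v.map fun x => sgn x * if x ∈ u then 1 else 0).sum = 0 := by
      apply List.sum_eq_zero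
      intro z hz
      obtain ⟨x, hx, rfl⟩ := List.mem_map.1 hz
      have : x ∉ u := fun h => hn'.2.2 h (List.mem_cons_of_mem _ hx)
      simp [this]
    rw [this, add_zero]
  have hsub : ∀ L : List Endpoint, (L.map fun x => sgn x *
      ((if w.idxOf x < w.idxOf (U a) then 1 else 0) -
        if w.idxOf x < w.idxOf (O a) then (1 : ℤ) else 0)).sum =
      (L.map fun x => sgn x * if w.idxOf x < w.idxOf (U a) then 1 else 0).sum -
      (L.map fun x => sgn x * if w.idxOf x < w.idxOf (O a) then 1 else 0).sum := by
    intro L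
    induction L with
    | nil => rfl
    | cons x L ih => simp only [List.map_cons, List.sum_cons, ih]; ring
  rw [hsub]
  obtain ⟨u, v, rfl⟩ := List.append_of_mem hO
  rw [aux2 u v _ hw]
  have hn := List.nodup_append'.1 hw
  have hOu : O a ∉ u := fun h => hn.2.2 h List.mem_cons_self
  have hOv : O a ∉ v := (List.nodup_cons.1 hn.2.1).1
  rw [List.mem_append, List.mem_cons] at hU
  rcases hU with hU | hU | hU
  · obtain ⟨p, q, rfl⟩ := List.append_of_mem hU
    have hq : U a ∉ q := by
      have := (List.nodup_append'.1 hn.1).2.1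
      exact (List.nodup_cons.1 this).1
    have hp : U a ∉ p := fun h => (List.nodup_append'.1 hn.1).2.2 h List.mem_cons_self
    have hv : U a ∉ v := fun h => hn.2.2 (by simp) (List.mem_cons_of_mem _ h)
    simp only [List.mem_append, List.mem_cons, not_or] at hOu
    have e := aux2 p (q ++ O a :: v) (U a) (by simpa using hw)
    simp only [List.append_assoc, List.cons_append] at e ⊢
    rw [e]
    simp only [strandInd_append, strandInd_cons, strandInd_of_notMem _ _ _ hOv hv,
      strandInd_of_notMem _ _ _ hOu.1 hp, strandInd_of_notMem _ _ _ hOu.2.2 hq]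
    simp [wt, sgn]
    ring
  · simp at hU
  · obtain ⟨p, q, rfl⟩ := List.append_of_mem hU
    have hn2 := List.nodup_append'.1 (List.nodup_cons.1 hn.2.1).2
    have hq : U a ∉ q := (List.nodup_cons.1 hn2.2.1).1
    have hp : U a ∉ p := fun h => hn2.2.2 h List.mem_cons_self
    have hu : U a ∉ u := fun h => hn.2.2 h (by simp)
    simp only [List.mem_append, List.mem_cons, not_or] at hOv
    have e := aux2 (u ++ O a :: p) q (U a) (by simpa using hw)
    simp only [List.append_assoc, List.cons_append] at e ⊢
    rw [e]
    simp only [strandInd_append, strandInd_cons, strandInd_of_notMem _ _ _ hOu hu,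
      strandInd_of_notMem _ _ _ hOv.1 hp, strandInd_of_notMem _ _ _ hOv.2.2 hq]
    simp [wt, sgn]
    ring

theorem sum_endpoints {w : List Endpoint} (hw : IsGauss w) {R : Type*} [CommRing R] (F : Endpoint → R) :
    (w.map fun x => (sgn x : R) * F x).sum =
      ∑ a ∈ (w.map Prod.fst).toFinset, (F (O a) - F (U a)) := by
  have h1 : (w.map fun x => (sgn x : R) * F x).sum = ∑ x ∈ w.toFinset, (sgn x : R) * F x := by
    rw [List.sum_toFinset _ hw.1]
  have h2 : w.toFinset = (w.map Prod.fst).toFinset ×ˢ Finset.univ := by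
    ext ⟨a, e⟩
    simp only [List.mem_toFinset, Finset.mem_product, Finset.mem_univ, and_true, List.mem_map]
    constructor
    · intro h; exact ⟨_, h, rfl⟩
    · rintro ⟨⟨b, f⟩, hb, rfl⟩
      by_cases h : e = f
      · rwa [h]
      · have := hw.2 _ hb
        rwa [show e = !f by cases e <;> cases f <;> simp_all]
  rw [h1, h2, Finset.sum_product]
  apply Finset.sum_congr rfl
  intro a _
  simp [sgn]
  ring

theorem KnotDiagram.mem_arrows (D : KnotDiagram) {a : ℕ} :
    a ∈ D.arrows ↔ O a ∈ D.word ∧ U a ∈ D.word := by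
  simp only [arrows, List.mem_toFinset, List.mem_map]
  constructor
  · rintro ⟨⟨b, e⟩, hb, rfl⟩
    have := D.gauss.2 _ hb
    cases e
    · exact ⟨this, hb⟩
    · exact ⟨hb, this⟩
  · rintro ⟨h, -⟩
    exact ⟨_, h, rfl⟩

theorem idxOf_inj_iff {w : List Endpoint} {x y : Endpoint} (hx : x ∈ w) :
    w.idxOf x = w.idxOf y ↔ x = y := List.idxOf_inj hx

theorem KnotDiagram.index_eq_ind (D : KnotDiagram) {e : ℕ} (he : e ∈ D.arrows) :
    D.index e = ind [(0, 0, D.word)] e := by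
  obtain ⟨hO, hU⟩ := D.mem_arrows.1 he
  simp only [ind_cons, ind_nil, add_zero]
  rw [strandInd_eq_sum D.gauss.1 hO hU]
  have h1 := sum_endpoints D.gauss (R := ℤ) (D.arc e)
  have h0 := exc_eq_zero_of_isGauss D.gauss
  simp only [Int.cast_id] at h1
  rw [KnotDiagram.index, KnotDiagram.arrows, ← h1]
  have h2 : (D.word.map fun x => if x = O e then (1 : ℤ) else 0).sum = 1 := by
    rw [← List.sum_toFinset _ D.gauss.1]; simp [hO]
  have hne : D.word.idxOf (O e) ≠ D.word.idxOf (U e) := by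
    rw [Ne, idxOf_inj_iff hO]; simp
  -- The difference of the two prefix indicators is the indicator of the open arc together with its
  -- starting point `O e`, which gives the extra unit. If the arc passes the base point, the
  -- difference is smaller by one at every endpoint, which costs the total excess.
  have key : ∀ L : List Endpoint, (∀ x ∈ L, x ∈ D.word) →
      (L.map fun x => sgn x * ((if D.word.idxOf x < D.word.idxOf (U e) then 1 else 0) -
        if D.word.idxOf x < D.word.idxOf (O e) then (1 : ℤ) else 0)).sum =
      (L.map fun x => sgn x * D.arc e x).sum +
        (L.map fun x => if x = O e then (1 : ℤ) else 0).sum -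
        (if D.word.idxOf (O e) < D.word.idxOf (U e) then 0 else exc L) := by
    intro L hL
    induction L with
    | nil => simp
    | cons x L ih =>
      simp only [List.map_cons, List.sum_cons, exc_cons]
      rw [ih fun y hy => hL y (List.mem_cons_of_mem _ hy)]
      have hx := hL x List.mem_cons_self
      have hx1 : x = O e ↔ D.word.idxOf x = D.word.idxOf (O e) := (idxOf_inj_iff hx).symm
      have hx2 : D.word.idxOf x = D.word.idxOf (U e) → sgn x = -1 := by
        intro h
        rw [(idxOf_inj_iff hx).1 h]; rfl
      have hx3 : x = O e → sgn x = 1 := by rintro rfl; rfl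
      simp only [KnotDiagram.arc, hx, true_and]
      rw [hx1] at hx3
      simp only [hx1]
      clear hx1 ih
      generalize D.word.idxOf x = k at *
      generalize D.word.idxOf (O e) = i at *
      generalize D.word.idxOf (U e) = j at *
      split_ifs <;> omega
  rw [key _ fun _ h => h, h2, h0]
  simp

/-- A knot diagram as a labelled link. -/
def KnotDiagram.labelled (D : KnotDiagram) : List LCircle := [(0, 0, D.word)]

theorem KnotDiagram.cov_labelled (D : KnotDiagram) (r : ℤ) :
    cov r D.labelled = [(0, (D.covering r).word)] := by
  simp only [cov_eq, labelled, List.map_cons, List.map_nil, KnotDiagram.covering]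
  congr 2
  apply List.filter_congr
  intro x hx
  have : x.1 ∈ D.arrows := by
    simp only [KnotDiagram.arrows, List.mem_toFinset]
    exact List.mem_map_of_mem hx
  rw [D.index_eq_ind this]

theorem KnotDiagram.covering_tally_of_move {D D' : KnotDiagram}
    (hm : Move [(0, D.word)] [(0, D'.word)]) (r : ℤ) :
    (D.covering r).toFlatKnot = (D'.covering r).toFlatKnot ∧
      ∀ f : ℤ → ℤ, (∀ n, f (-n) = -f n) → tally f D.labelled = tally f D'.labelled := by
  obtain ⟨E, hE, hl⟩ := hm.lift (by simpa using exc_eq_zero_of_isGauss D.gauss) D.labelled rfl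
  obtain ⟨⟨t, l, w⟩, E', rfl, h1, h2⟩ := List.map_eq_cons_iff.1 hE
  simp only [LCircle.forget, Prod.mk.injEq] at h1
  obtain ⟨rfl, rfl⟩ := h1
  obtain rfl : E' = [] := by simpa using h2
  have hi : ind [(0, l, D'.word)] = ind D'.labelled := ind_singleton D'.gauss 0 l
  obtain ⟨hc, ht⟩ := hl.cov_tally r
  have hcov : cov r [(0, l, D'.word)] = [(0, (D'.covering r).word)] := by
    rw [← D'.cov_labelled, cov_eq, hi]; rfl
  rw [hcov, D.cov_labelled] at hc
  refine ⟨?_, fun f hf => ?_⟩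
  · rcases hc with hc | hc
    · have : (D.covering r) = (D'.covering r) := by
        have : (D.covering r).word = (D'.covering r).word := by simpa using hc
        cases hA : D.covering r
        cases hB : D'.covering r
        simpa [hA, hB] using this
      rw [this]
    · exact Quot.sound hc
  · rw [ht f hf]
    exact tally_congr f hi rfl

/-- The `r`-th covering of a flat knot. -/
def FlatKnot.covering (r : ℤ) (α : FlatKnot) : FlatKnot :=
  Quot.lift (fun D : KnotDiagram => (D.covering r).toFlatKnot)
    (fun _ _ h => (KnotDiagram.covering_tally_of_move h r).1) α

theorem FlatKnot.isCovering_covering (r : ℤ) (α : FlatKnot) : IsCovering r α (α.covering r) := by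
  rintro D rfl
  rfl

theorem FlatKnot.tally_eq {f : ℤ → ℤ} (hf : ∀ n, f (-n) = -f n) {D D' : KnotDiagram}
    (h : D.toFlatKnot = D'.toFlatKnot) : tally f D.labelled = tally f D'.labelled :=
  congrArg (Quot.lift (fun D : KnotDiagram => tally f D.labelled)
    fun _ _ h => (KnotDiagram.covering_tally_of_move h 0).2 f hf) h

/-- A slice movie of a knot gives a slice movie of its covering, and the signed counts of indices of a
slice knot vanish. -/
theorem KnotDiagram.slice_movie {D : KnotDiagram} {b d s t : ℕ}
    (h : Movie ⟨[(0, D.word)], {0}⟩ b d s ⟨[(t, [])], {t}⟩) (hs : s = b + d) (r : ℤ) :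
    Movie ⟨[(0, (D.covering r).word)], {0}⟩ b d s ⟨[(t, [])], {t}⟩ ∧
      ∀ f : ℤ → ℤ, (∀ n, f (-n) = -f n) → tally f D.labelled = 0 := by
  obtain ⟨E, hE, H⟩ := h.labelled D.gauss r (by simp; omega) (by simp)
  obtain ⟨⟨t', l, w⟩, E', rfl, h1, h2⟩ := List.map_eq_cons_iff.1 hE
  simp only [LCircle.forget, Prod.mk.injEq] at h1
  obtain ⟨rfl, rfl⟩ := h1
  obtain rfl : E' = [] := by simpa using h2
  obtain ⟨hm, ht⟩ := H 0
  refine ⟨?_, fun f hf => ?_⟩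
  · rw [← D.cov_labelled]
    exact hm
  · rw [KnotDiagram.labelled, ← ht f hf]
    rfl

theorem FlatKnot.Slice.covering {α : FlatKnot} (h : α.Slice) (r : ℤ) : (α.covering r).Slice := by
  obtain ⟨D, rfl, b, d, s, t, hm, hs⟩ := h
  exact ⟨D.covering r, rfl, b, d, s, t, (KnotDiagram.slice_movie hm hs r).1, hs⟩

theorem FlatKnot.Slice.tally_eq_zero {D : KnotDiagram} (h : D.toFlatKnot.Slice) {f : ℤ → ℤ}
    (hf : ∀ n, f (-n) = -f n) : tally f D.labelled = 0 := by
  obtain ⟨D', h', b, d, s, t, hm, hs⟩ := h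
  rw [← FlatKnot.tally_eq hf h']
  exact (KnotDiagram.slice_movie hm hs 0).2 f hf

/-! ### The covering of 6.464 and the obstruction -/

theorem covering_knot6464 : knot6464.covering 3 = negKnot42 := by
  -- The reverse of 4.2, with the base point moved in front of the tails to match the covering of
  -- 6.464.
  let D : KnotDiagram := ⟨[O 4, O 3, O 2, O 1, U 2, U 4, U 3, U 1], by decide⟩
  have h1 : diagram42.reverse.toFlatKnot = D.toFlatKnot :=
    Quot.sound (Move.rotate 0 [U 2, U 4, U 3, U 1] [O 4, O 3, O 2, O 1] [])
  have h2 : D.toFlatKnot = (diagram6464.covering 3).toFlatKnot := by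
    apply Quot.sound
    have hw : (diagram6464.covering 3).word = [O 1, O 3, O 4, O 5, U 4, U 1, U 3, U 5] := by decide
    rw [hw]
    -- Comparing the two words forces 4 ↦ 1, 3 ↦ 3, 2 ↦ 4, 1 ↦ 5; the 4-cycle 4 → 1 → 5 → 2 → 4
    -- extends this.
    have := Move.rename (Equiv.swap 1 5 * Equiv.swap 5 2 * Equiv.swap 2 4) [(0, D.word)]
    convert this using 1
    rfl
  exact h2.symm.trans h1.symm

theorem not_slice_negKnot42 : ¬ negKnot42.Slice := by
  intro h
  -- This counts arrows of index 3 minus arrows of index -3. The indices of -4.2 are -3, 1, 0, 2, so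
  -- the value is -1.
  have := h.tally_eq_zero (f := fun n => if n = 3 then 1 else if n = -3 then -1 else 0) (by
    intro n; split_ifs <;> omega)
  revert this
  decide

theorem not_slice_knot6464 : ¬ knot6464.Slice := fun h =>
  not_slice_negKnot42 (covering_knot6464 ▸ h.covering 3)

/-! ## Ranks of fillings -/

/-- Writing each `u i` in terms of the `w k` with coefficient matrix `C`, the first Gram matrix is
`C G Cᵀ`, where `G` is the second. Hence only spans matter for the rank of a filling: repeated
vectors, scaling and added multiples of `s` are harmless. -/
theorem rank_gram_le {V W ι κ : Type*} [AddCommGroup V] [Module ℚ V] [AddCommGroup W] [Module ℚ W]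
    [Fintype ι] [Fintype κ] (B : LinearMap.BilinForm ℚ V) (B' : LinearMap.BilinForm ℚ W) (v : ι → V)
    (w : κ → W) (u : ι → W) (hu : ∀ i, u i ∈ Submodule.span ℚ (Set.range w))
    (h : ∀ i j, B (v i) (v j) = B' (u i) (u j)) :
    (Matrix.of fun i j => B (v i) (v j)).rank ≤ (Matrix.of fun k l => B' (w k) (w l)).rank := by
  classical
  choose c hc using fun i => (Submodule.mem_span_range_iff_exists_fun ℚ).1 (hu i)
  have : (Matrix.of fun i j => B (v i) (v j)) =
      Matrix.of c * (Matrix.of fun k l => B' (w k) (w l)) * (Matrix.of c).transpose := by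
    ext i j
    simp only [Matrix.mul_apply, Matrix.of_apply, Matrix.transpose_apply, h, ← hc, map_sum,
      LinearMap.sum_apply, map_smul, LinearMap.smul_apply, smul_eq_mul, Finset.sum_mul]
    simp only [Finset.mul_sum]
    exact Finset.sum_congr rfl fun k _ => Finset.sum_congr rfl fun l _ => by ring
  rw [this]
  exact (Matrix.rank_mul_le_left _ _).trans (Matrix.rank_mul_le_right _ _)

section

variable {V W : Type*} [AddCommGroup V] [Module ℚ V] [AddCommGroup W] [Module ℚ W]

/-- The vectors `s` and `d e`, `d e + d (τ e)` that belong to the filling given by the orbits of an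
involution `τ`. -/
def fillVec (s : V) (d : ℕ → V) (τ : ℕ → ℕ) : Option ℕ → V
  | none => s
  | some e => d e + if τ e = e then 0 else d (τ e)

/-- Restriction of a family to `s` and the members of `A`. -/
def onArrows (A : Finset ℕ) (v : Option ℕ → V) : Option A → V := fun p => v (p.map Subtype.val)

/-- There is a filling of rank at most `r`. -/
def FillRank (B : LinearMap.BilinForm ℚ V) (s : V) (d : ℕ → V) (A : Finset ℕ) (r : ℕ) : Prop :=
  ∃ τ : ℕ → ℕ, Function.Involutive τ ∧ (∀ e ∈ A, τ e ∈ A) ∧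
    (Matrix.of fun p q => B (onArrows A (fillVec s d τ) p) (onArrows A (fillVec s d τ) q)).rank ≤ r

theorem fillVec_none_mem (s : V) (d : ℕ → V) (τ : ℕ → ℕ) (A : Finset ℕ) :
    s ∈ Submodule.span ℚ (Set.range (onArrows A (fillVec s d τ))) :=
  Submodule.subset_span ⟨none, rfl⟩

theorem fillVec_some_mem (s : V) (d : ℕ → V) (τ : ℕ → ℕ) {A : Finset ℕ} {e : ℕ} (he : e ∈ A) :
    (d e + if τ e = e then 0 else d (τ e)) ∈
      Submodule.span ℚ (Set.range (onArrows A (fillVec s d τ))) :=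
  Submodule.subset_span ⟨some ⟨e, he⟩, rfl⟩

/-- Change of the vectors by multiples of `s`, scaling, and renaming do not matter. -/
theorem FillRank.of_eq {B : LinearMap.BilinForm ℚ V} {B' : LinearMap.BilinForm ℚ W} {s : V} {s' : W}
    {d : ℕ → V} {d' : ℕ → W} {A A' : Finset ℕ} {r : ℕ} (h : FillRank B' s' d' A' r)
    (σ : Equiv.Perm ℕ) (hA : ∀ e, σ e ∈ A' ↔ e ∈ A) (m : ℚ) (c : ℕ → ℚ)
    (hB : ∀ x y, B x y = -B y x) (hB' : ∀ x y, B' x y = -B' y x)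
    (hs : ∀ e ∈ A, B s (d e) = B' s' (m • d' (σ e) + c e • s'))
    (hd : ∀ e ∈ A, ∀ f ∈ A, B (d e) (d f) =
      B' (m • d' (σ e) + c e • s') (m • d' (σ f) + c f • s')) : FillRank B s d A r := by
  obtain ⟨τ, hτ, hτA, hr⟩ := h
  set T : ℕ → ℕ := fun e => σ.symm (τ (σ e)) with hT
  have hTA : ∀ e ∈ A, T e ∈ A := fun e he => by
    rw [← hA]; simpa [hT] using hτA _ ((hA e).2 he)
  refine ⟨T, fun e => by simp [hT, hτ (σ e)], hTA, ?_⟩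
  set u : ℕ → W := fun e => m • d' (σ e) + c e • s' with hu
  refine le_trans (rank_gram_le B B' _ _ (onArrows A (fillVec s' u T)) ?_ ?_) hr
  · rintro (_ | ⟨e, he⟩)
    · exact fillVec_none_mem _ _ _ _
    · have h1 := fillVec_some_mem s' d' τ ((hA e).2 he)
      have h0 := fillVec_none_mem s' d' τ A'
      have hte : T e = e ↔ τ (σ e) = σ e := by simp [hT, Equiv.symm_apply_eq]
      have e1 : σ (T e) = τ (σ e) := by simp [hT]
      by_cases hh : T e = e
      · have : onArrows A (fillVec s' u T) (some ⟨e, he⟩) =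
            m • (d' (σ e) + if τ (σ e) = σ e then 0 else d' (τ (σ e))) + c e • s' := by
          simp [onArrows, fillVec, hh, hte.1 hh, hu]
        rw [this]
        exact Submodule.add_mem _ (Submodule.smul_mem _ _ h1) (Submodule.smul_mem _ _ h0)
      · have : onArrows A (fillVec s' u T) (some ⟨e, he⟩) =
            m • (d' (σ e) + if τ (σ e) = σ e then 0 else d' (τ (σ e))) + (c e + c (T e)) • s' := by
          simp only [onArrows, fillVec, hh, mt hte.2 hh, hu, e1, Option.map_some, if_false]
          module
        rw [this]
        exact Submodule.add_mem _ (Submodule.smul_mem _ _ h1) (Submodule.smul_mem _ _ h0)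
  · have hds : ∀ e ∈ A, B (d e) s = B' (u e) s' := fun e he => by
      rw [hB, hs e he, hB']; simp [hu]
    have hss : B s s = B' s' s' := by
      have h1 := hB s s
      have h2 := hB' s' s'
      linarith
    have key : ∀ x ∈ A, ∀ y ∈ A, B (d x) (d y) = B' (u x) (u y) := hd
    have hs' : ∀ e ∈ A, B s (d e) = B' s' (u e) := hs
    clear_value u T
    rintro (_ | ⟨e, he⟩) (_ | ⟨f, hf⟩)
    · exact hss
    · have := hTA f hf
      simp only [onArrows, fillVec, Option.map_some, Option.map_none]
      split_ifs <;> simp only [map_add, map_zero, hs' _ hf, hs' _ this]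
    · have := hTA e he
      simp only [onArrows, fillVec, Option.map_some, Option.map_none]
      split_ifs <;> simp only [map_add, map_zero, LinearMap.add_apply, LinearMap.zero_apply,
        hds _ he, hds _ this]
    · have h1 := hTA e he
      have h2 := hTA f hf
      simp only [onArrows, fillVec, Option.map_some]
      split_ifs <;> simp only [map_add, map_zero, LinearMap.add_apply, LinearMap.zero_apply,
        key _ he _ hf, key _ he _ h2, key _ h1 _ hf, key _ h1 _ h2]

theorem eq_on_span {B B' : LinearMap.BilinForm ℚ V} {S : Set V} (h : ∀ x ∈ S, ∀ y ∈ S, B x y = B' x y)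
    {x y : V} (hx : x ∈ Submodule.span ℚ S) (hy : y ∈ Submodule.span ℚ S) : B x y = B' x y := by
  induction hx, hy using Submodule.span_induction₂ with
  | mem_mem x y hx hy => exact h x hx y hy
  | zero_left => simp
  | zero_right => simp
  | add_left _ _ _ _ _ _ h1 h2 => simp [h1, h2]
  | add_right _ _ _ _ _ _ h1 h2 => simp [h1, h2]
  | smul_left _ _ _ _ _ h1 => simp [h1]
  | smul_right _ _ _ _ _ h1 => simp [h1]

theorem eq_zero_on_span {B : LinearMap.BilinForm ℚ V} {S : Set V} {k : V} (h : ∀ x ∈ S, B k x = 0)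
    {x : V} (hx : x ∈ Submodule.span ℚ S) : B k x = 0 := by
  induction hx using Submodule.span_induction with
  | mem x hx => exact h x hx
  | zero => simp
  | add _ _ _ _ h1 h2 => simp [h1, h2]
  | smul _ _ _ h1 => simp [h1]

theorem fillVec_mem_span (s : V) (d : ℕ → V) {τ : ℕ → ℕ} {A : Finset ℕ} (hτ : ∀ e ∈ A, τ e ∈ A)
    (p : Option A) :
    onArrows A (fillVec s d τ) p ∈ Submodule.span ℚ (insert s (d '' A)) := by
  obtain _ | ⟨e, he⟩ := p
  · exact Submodule.subset_span (Set.mem_insert _ _)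
  · refine Submodule.add_mem _ (Submodule.subset_span (Or.inr ⟨e, he, rfl⟩)) ?_
    split_ifs
    · exact Submodule.zero_mem _
    · exact Submodule.subset_span (Or.inr ⟨_, hτ e he, rfl⟩)

theorem span_mono_arrows (s : V) (d : ℕ → V) {A A' : Finset ℕ} (h : A' ⊆ A) {x : V}
    (hx : x ∈ Submodule.span ℚ (insert s (d '' A'))) :
    x ∈ Submodule.span ℚ (insert s (d '' A)) :=
  Submodule.span_mono (Set.insert_subset_insert (Set.image_mono (by exact_mod_cast h))) hx

/-- The corrections `k` lie in the radical of `B`, so adding them to the vectors of the first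
filling leaves its Gram matrix unchanged and brings the vectors into the span of the second. Three
forms are needed because deleting arrows also deletes terms of the intersection form; `B₁` and `B₂`
need agree with `B` only on the vectors that remain. -/
theorem rank_fill_le {B B₁ B₂ : LinearMap.BilinForm ℚ V} {s : V} {d : ℕ → V} {A A₁ A₂ : Finset ℕ}
    {τ₁ τ₂ : ℕ → ℕ} (h₁ : A₁ ⊆ A) (hτ₁ : ∀ e ∈ A₁, τ₁ e ∈ A₁) (hτ₂ : ∀ e ∈ A₂, τ₂ e ∈ A₂)
    (hB : ∀ x y, B x y = -B y x)
    (hB₁ : ∀ x ∈ insert s (d '' A₁), ∀ y ∈ insert s (d '' A₁), B x y = B₁ x y)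
    (hB₂ : ∀ x ∈ insert s (d '' A₂), ∀ y ∈ insert s (d '' A₂), B x y = B₂ x y)
    (hk : ∀ e ∈ A₁, ∃ k ∈ Submodule.span ℚ (insert s (d '' A)),
      (∀ x ∈ insert s (d '' A), B k x = 0) ∧
      (d e + if τ₁ e = e then 0 else d (τ₁ e)) + k ∈
        Submodule.span ℚ (Set.range (onArrows A₂ (fillVec s d τ₂)))) :
    (Matrix.of fun p q => B₁ (onArrows A₁ (fillVec s d τ₁) p) (onArrows A₁ (fillVec s d τ₁) q)).rank ≤
    (Matrix.of fun p q => B₂ (onArrows A₂ (fillVec s d τ₂) p) (onArrows A₂ (fillVec s d τ₂) q)).rank := by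
  have hk' : ∀ p : Option A₁, ∃ k ∈ Submodule.span ℚ (insert s (d '' A)),
      (∀ x ∈ insert s (d '' A), B k x = 0) ∧ onArrows A₁ (fillVec s d τ₁) p + k ∈
        Submodule.span ℚ (Set.range (onArrows A₂ (fillVec s d τ₂))) := by
    rintro (_ | ⟨e, he⟩)
    · exact ⟨0, Submodule.zero_mem _, by simp, by
        rw [add_zero]; exact fillVec_none_mem s d τ₂ A₂⟩
    · exact hk e he
  choose k hkm hk0 hks using hk'
  have hle : Submodule.span ℚ (Set.range (onArrows A₂ (fillVec s d τ₂))) ≤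
      Submodule.span ℚ (insert s (d '' A₂)) := by
    rw [Submodule.span_le]
    rintro _ ⟨p, rfl⟩
    exact fillVec_mem_span s d hτ₂ p
  refine rank_gram_le B₁ B₂ _ _ (fun p => onArrows A₁ (fillVec s d τ₁) p + k p) hks fun p q => ?_
  have hp := fillVec_mem_span s d hτ₁ p
  have hq := fillVec_mem_span s d hτ₁ q
  rw [← eq_on_span hB₁ hp hq, ← eq_on_span hB₂ (hle (hks p)) (hle (hks q)), map_add, map_add,
    LinearMap.add_apply, LinearMap.add_apply,
    eq_zero_on_span (hk0 p) (span_mono_arrows s d h₁ hq), eq_zero_on_span (hk0 p) (hkm q),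
    hB _ (k q), eq_zero_on_span (hk0 q) (span_mono_arrows s d h₁ hp)]
  ring

/-- Adding an arrow in the radical. -/
theorem fillRank_insert_iff {B B' : LinearMap.BilinForm ℚ V} {s : V} {d : ℕ → V} {A : Finset ℕ} {a : ℕ}
    (ha : a ∉ A) {r : ℕ} (hB : ∀ x y, B x y = -B y x)
    (hBB : ∀ x ∈ insert s (d '' A), ∀ y ∈ insert s (d '' A), B x y = B' x y)
    (hrad : ∀ x ∈ insert s (d '' (insert a A : Finset ℕ)), B (d a) x = 0) :
    FillRank B s d (insert a A) r ↔ FillRank B' s d A r := by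
  have hsub : A ⊆ insert a A := Finset.subset_insert _ _
  have hda : d a ∈ Submodule.span ℚ (insert s (d '' (insert a A : Finset ℕ))) :=
    Submodule.subset_span (Or.inr ⟨a, by simp, rfl⟩)
  constructor
  · rintro ⟨τ, hτ, hτA, hr⟩
    -- The partner of `a`, if there is one, becomes a singleton; its vector changes by the radical
    -- vector `d a`.
    set T : ℕ → ℕ := fun x => if τ x = a then x else if x = a then a else τ x with hT
    have hTA : ∀ e ∈ A, T e ∈ A := by
      intro e he
      have := hτA e (hsub he)
      simp only [hT]
      grind
    refine ⟨T, ?_, hTA, le_trans (rank_fill_le hsub hTA hτA hB hBB (fun _ _ _ _ => rfl)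
      fun e he => ?_) hr⟩
    · intro x
      have h1 := hτ x
      have h2 := hτ a
      simp only [hT]
      grind
    · have hne : e ≠ a := fun h => ha (h ▸ he)
      have h1 := fillVec_some_mem s d τ (hsub he)
      by_cases h : τ e = a
      · refine ⟨d a, hda, hrad, ?_⟩
        simpa [hT, h, hne.symm] using h1
      · refine ⟨0, Submodule.zero_mem _, by simp, ?_⟩
        simpa [hT, h, hne] using h1
  · rintro ⟨τ, hτ, hτA, hr⟩
    set T : ℕ → ℕ := fun x => if x ∈ A then τ x else x with hT
    have hTA : ∀ e ∈ insert a A, T e ∈ insert a A := by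
      intro e he
      simp only [hT]
      grind
    refine ⟨T, ?_, hTA, le_trans (rank_fill_le subset_rfl hTA hτA hB (fun _ _ _ _ => rfl) hBB
      fun e he => ?_) hr⟩
    · intro x
      have h1 := hτ x
      simp only [hT]
      grind
    · by_cases h : e = a
      · refine ⟨-d a, Submodule.neg_mem _ hda, by simpa using hrad, ?_⟩
        simp [hT, h, ha]
      · have heA : e ∈ A := by simpa [h] using he
        refine ⟨0, Submodule.zero_mem _, by simp, ?_⟩
        simpa [hT, heA] using fillVec_some_mem s d τ heA

/-- Adding two arrows whose sum is in the radical. -/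
theorem fillRank_insert_insert_iff {B B' : LinearMap.BilinForm ℚ V} {s : V} {d : ℕ → V} {A : Finset ℕ}
    {a b : ℕ} (ha : a ∉ A) (hb : b ∉ A) (hab : a ≠ b) {r : ℕ} (hB : ∀ x y, B x y = -B y x)
    (hBB : ∀ x ∈ insert s (d '' A), ∀ y ∈ insert s (d '' A), B x y = B' x y)
    (hrad : ∀ x ∈ insert s (d '' (insert a (insert b A) : Finset ℕ)), B (d a + d b) x = 0) :
    FillRank B s d (insert a (insert b A)) r ↔ FillRank B' s d A r := by
  have hsub : A ⊆ insert a (insert b A) :=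
    (Finset.subset_insert _ _).trans (Finset.subset_insert _ _)
  have hdab : d a + d b ∈ Submodule.span ℚ (insert s (d '' (insert a (insert b A) : Finset ℕ))) :=
    Submodule.add_mem _ (Submodule.subset_span (Or.inr ⟨a, by simp, rfl⟩))
      (Submodule.subset_span (Or.inr ⟨b, by simp, rfl⟩))
  constructor
  · rintro ⟨τ, hτ, hτA, hr⟩
    -- The former partners of `a` and `b` are paired with each other, or left single when only one
    -- exists: `(d e + d a) + (d f + d b)` is `d e + d f` up to the radical vector `d a + d b`.
    set T : ℕ → ℕ := fun x => if x = a ∨ x = b then x else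
      if τ x = a then (if τ b = b then x else τ b) else
      if τ x = b then (if τ a = a then x else τ a) else τ x with hT
    have hTA : ∀ e ∈ A, T e ∈ A := by
      intro e he
      have h1 := hτA e (hsub he)
      have h2 := hτA a (by simp)
      have h3 := hτA b (by simp)
      have h4 := hτ a
      have h5 := hτ b
      have h6 := hτ e
      simp only [hT]
      grind
    refine ⟨T, ?_, hTA, le_trans (rank_fill_le hsub hTA hτA hB hBB (fun _ _ _ _ => rfl)
      fun e he => ?_) hr⟩
    · intro x
      have h1 := hτ x
      have h2 := hτ a
      have h3 := hτ b
      simp only [hT]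
      grind
    · have hne : e ≠ a := fun h => ha (h ▸ he)
      have hne' : e ≠ b := fun h => hb (h ▸ he)
      have h1 := fillVec_some_mem s d τ (hsub he)
      have h2 := fillVec_some_mem s d τ (A := insert a (insert b A)) (e := a) (by simp)
      have h3 := fillVec_some_mem s d τ (A := insert a (insert b A)) (e := b) (by simp)
      have h4 := hτ a
      have h5 := hτ b
      have h6 := hτ e
      by_cases h : τ e = a
      · refine ⟨d a + d b, hdab, hrad, ?_⟩
        convert Submodule.add_mem _ h1 h3 using 1
        by_cases hbb : τ b = b
        · simp [hT, h, hne, hne', hne.symm, hbb]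
          try abel
        · have : τ b ≠ e := by grind
          simp [hT, h, hne, hne', hne.symm, hbb, this]
          try abel
      · by_cases h' : τ e = b
        · refine ⟨d a + d b, hdab, hrad, ?_⟩
          convert Submodule.add_mem _ h1 h2 using 1
          by_cases haa : τ a = a
          · simp [hT, h', hne, hne', hne'.symm, haa, hab.symm]
            try abel
          · have : τ a ≠ e := by grind
            simp [hT, h', hne, hne', hne'.symm, haa, this, hab.symm]
            try abel
        · refine ⟨0, Submodule.zero_mem _, by simp, ?_⟩
          simpa [hT, h, h', hne, hne'] using h1
  · rintro ⟨τ, hτ, hτA, hr⟩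
    -- Pairing `a` with `b` adds only the radical vector `d a + d b` to the filling.
    set T : ℕ → ℕ := fun x => if x ∈ A then τ x else if x = a then b else if x = b then a else x
      with hT
    have hTA : ∀ e ∈ insert a (insert b A), T e ∈ insert a (insert b A) := by
      intro e he
      simp only [hT]
      grind
    refine ⟨T, ?_, hTA, le_trans (rank_fill_le subset_rfl hTA hτA hB (fun _ _ _ _ => rfl) hBB
      fun e he => ?_) hr⟩
    · intro x
      have h1 := hτ x
      simp only [hT]
      grind
    · by_cases h : e = a
      · refine ⟨-(d a + d b), Submodule.neg_mem _ hdab, fun x hx => by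
          rw [map_neg, LinearMap.neg_apply, hrad x hx, neg_zero], ?_⟩
        have : (d e + if T e = e then 0 else d (T e)) = d a + d b := by
          simp [hT, h, ha, hab.symm]
        rw [this, add_neg_cancel]
        exact Submodule.zero_mem _
      · by_cases h' : e = b
        · refine ⟨-(d a + d b), Submodule.neg_mem _ hdab, fun x hx => by
          rw [map_neg, LinearMap.neg_apply, hrad x hx, neg_zero], ?_⟩
          have : (d e + if T e = e then 0 else d (T e)) = d a + d b := by
            simp [hT, h', hb, hab, hab.symm, add_comm]
          rw [this, add_neg_cancel]
          exact Submodule.zero_mem _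
        · have heA : e ∈ A := by simpa [h, h'] using he
          refine ⟨0, Submodule.zero_mem _, by simp, ?_⟩
          simpa [hT, heA] using fillVec_some_mem s d τ heA

end

/-! ## Loops as functions on the endpoints -/

/-- The intersection form of closed curves on a flat knot diagram, in terms of the (averaged)
multiplicities with which the curves run through the endpoints of the arrows. -/
def crossForm (A : Finset ℕ) : LinearMap.BilinForm ℚ (Endpoint → ℚ) :=
  LinearMap.mk₂ ℚ (fun g h => ∑ a ∈ A, (g (O a) * h (U a) - g (U a) * h (O a)))
    (fun g g' h => by
      rw [← Finset.sum_add_distrib]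
      exact Finset.sum_congr rfl fun a _ => by simp only [Pi.add_apply]; ring)
    (fun c g h => by
      rw [smul_eq_mul, Finset.mul_sum]
      exact Finset.sum_congr rfl fun a _ => by simp only [Pi.smul_apply, smul_eq_mul]; ring)
    (fun g h h' => by
      rw [← Finset.sum_add_distrib]
      exact Finset.sum_congr rfl fun a _ => by simp only [Pi.add_apply]; ring)
    (fun c g h => by
      rw [smul_eq_mul, Finset.mul_sum]
      exact Finset.sum_congr rfl fun a _ => by simp only [Pi.smul_apply, smul_eq_mul]; ring)

theorem crossForm_apply (A : Finset ℕ) (g h : Endpoint → ℚ) :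
    crossForm A g h = ∑ a ∈ A, (g (O a) * h (U a) - g (U a) * h (O a)) := rfl

theorem crossForm_skew (A : Finset ℕ) (g h : Endpoint → ℚ) : crossForm A g h = -crossForm A h g := by
  rw [crossForm_apply, crossForm_apply, ← Finset.sum_neg_distrib]
  exact Finset.sum_congr rfl fun a _ => by ring

/-- `-1`, `0`, `1` if `x` comes before, at, after `y` in `w`. -/
def ord (w : List Endpoint) (x y : Endpoint) : ℚ :=
  if w.idxOf x < w.idxOf y then -1 else if w.idxOf y < w.idxOf x then 1 else 0

/-- Twice the loop `e⁺`, up to a multiple of the whole curve. -/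
def loopVec (ε : Endpoint → Endpoint → ℚ) (e : ℕ) : Endpoint → ℚ := fun y => ε (U e) y - ε (O e) y

/-- There is a filling of rank at most `r` of the based matrix of the word `w`. -/
def WordRank (w : List Endpoint) (r : ℕ) : Prop :=
  FillRank (crossForm (w.map Prod.fst).toFinset) (1 : Endpoint → ℚ) (loopVec (ord w))
    (w.map Prod.fst).toFinset r

/-- The loop `e⁺`. -/
def KnotDiagram.arcVec (D : KnotDiagram) (e : ℕ) : Endpoint → ℚ :=
  fun x => (D.arc e x : ℚ) + (if x.1 = e then 1 / 2 else 0)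

/-- When the tail precedes the head, `loopVec` is 2 inside the arc, 1 at its ends and 0 outside. In
the other case it is minus twice the complementary arc, which is repaired by adding the whole curve.
-/
theorem KnotDiagram.arcVec_eq (D : KnotDiagram) {e : ℕ} (he : e ∈ D.arrows) {x : Endpoint}
    (hx : x ∈ D.word) : D.arcVec e x = (1 / 2) * loopVec (ord D.word) e x +
      if D.word.idxOf (O e) < D.word.idxOf (U e) then 0 else 1 := by
  obtain ⟨hO, hU⟩ := D.mem_arrows.1 he
  have h1 : D.word.idxOf (O e) = D.word.idxOf x ↔ O e = x := idxOf_inj_iff hO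
  have h2 : D.word.idxOf (U e) = D.word.idxOf x ↔ U e = x := idxOf_inj_iff hU
  have h3 : D.word.idxOf (O e) ≠ D.word.idxOf (U e) := by
    rw [Ne, idxOf_inj_iff hO]; simp
  have h4 : x.1 = e ↔ O e = x ∨ U e = x := by
    obtain ⟨a, f⟩ := x
    cases f <;> simp [eq_comm]
  simp only [KnotDiagram.arcVec, KnotDiagram.arc, hx, true_and, loopVec, ord, h4, ← h1, ← h2]
  generalize D.word.idxOf x = k at *
  generalize D.word.idxOf (O e) = i at *
  generalize D.word.idxOf (U e) = j at *
  clear h1 h2 h4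
  split_ifs <;> first | (exfalso; omega) | norm_num

/-- Both sides are the linking sign of the two chords. This merges the half contributions of the
corners at `e` and at `f` into the single correction term of `pairing`. -/
theorem KnotDiagram.arc_link (D : KnotDiagram) {e f : ℕ} (he : e ∈ D.arrows) (hf : f ∈ D.arrows) :
    D.arc e (O f) - D.arc e (U f) = D.arc f (U e) - D.arc f (O e) := by
  obtain ⟨hO, hU⟩ := D.mem_arrows.1 he
  obtain ⟨hO', hU'⟩ := D.mem_arrows.1 hf
  have h1 : D.word.idxOf (O e) ≠ D.word.idxOf (U f) := by rw [Ne, idxOf_inj_iff hO]; simp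
  have h2 : D.word.idxOf (O f) ≠ D.word.idxOf (U e) := by rw [Ne, idxOf_inj_iff hO']; simp
  have h3 : D.word.idxOf (O e) = D.word.idxOf (O f) ↔ e = f := by rw [idxOf_inj_iff hO]; simp
  have h4 : D.word.idxOf (U e) = D.word.idxOf (U f) ↔ e = f := by rw [idxOf_inj_iff hU]; simp
  have h5 := h3.trans h4.symm
  have h6 : D.word.idxOf (O e) ≠ D.word.idxOf (U e) := by rw [Ne, idxOf_inj_iff hO]; simp
  have h7 : D.word.idxOf (O f) ≠ D.word.idxOf (U f) := by rw [Ne, idxOf_inj_iff hO']; simp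
  simp only [KnotDiagram.arc, hO, hU, hO', hU', true_and]
  clear h3 h4
  generalize D.word.idxOf (O e) = i at *
  generalize D.word.idxOf (U e) = j at *
  generalize D.word.idxOf (O f) = k at *
  generalize D.word.idxOf (U f) = l at *
  grind

theorem KnotDiagram.crossForm_arcVec (D : KnotDiagram) {e f : ℕ} (he : e ∈ D.arrows)
    (hf : f ∈ D.arrows) : crossForm D.arrows (D.arcVec e) (D.arcVec f) = D.pairing e f := by
  have hl : ((D.arc e (O f) : ℚ) - D.arc e (U f)) = D.arc f (U e) - D.arc f (O e) := by
    exact_mod_cast D.arc_link he hf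
  -- The value 1/2 at a corner produces half a linking sign at `e` and half a linking sign at `f`.
  have h : ∀ a ∈ D.arrows, D.arcVec e (O a) * D.arcVec f (U a) - D.arcVec e (U a) * D.arcVec f (O a) =
      ((D.arc e (O a) : ℚ) * D.arc f (U a) - D.arc e (U a) * D.arc f (O a)) +
      ((if a = e then (1 / 2) * ((D.arc f (U e) : ℚ) - D.arc f (O e)) else 0) +
      (if a = f then (1 / 2) * ((D.arc e (O f) : ℚ) - D.arc e (U f)) else 0)) := by
    intro a _
    simp only [KnotDiagram.arcVec]
    split_ifs with h1 h2 h2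
    · subst h1; subst h2; ring
    · subst h1; ring
    · subst h2; ring
    · ring
  rw [crossForm_apply, Finset.sum_congr rfl h, Finset.sum_add_distrib, Finset.sum_add_distrib,
    Finset.sum_ite_eq', Finset.sum_ite_eq', if_pos he, if_pos hf, hl, KnotDiagram.pairing]
  push_cast
  ring

theorem KnotDiagram.crossForm_arcVec_one (D : KnotDiagram) (e : ℕ) :
    crossForm D.arrows (D.arcVec e) 1 = D.index e := by
  rw [crossForm_apply, KnotDiagram.index]
  push_cast
  refine Finset.sum_congr rfl fun a _ => ?_
  simp [KnotDiagram.arcVec]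

theorem crossForm_congr {A : Finset ℕ} {g g' h h' : Endpoint → ℚ}
    (h1 : ∀ a ∈ A, g (O a) = g' (O a) ∧ g (U a) = g' (U a))
    (h2 : ∀ a ∈ A, h (O a) = h' (O a) ∧ h (U a) = h' (U a)) :
    crossForm A g h = crossForm A g' h' := by
  rw [crossForm_apply, crossForm_apply]
  refine Finset.sum_congr rfl fun a ha => ?_
  rw [(h1 a ha).1, (h1 a ha).2, (h2 a ha).1, (h2 a ha).2]

/-- The two families of loops differ by the factor 2 and by multiples of `s`. The version built from
`ord` is skew in its two arguments, which makes it convenient for the Reidemeister moves. -/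
theorem KnotDiagram.wordRank_iff (D : KnotDiagram) (r : ℕ) :
    WordRank D.word r ↔ FillRank (crossForm D.arrows) 1 D.arcVec D.arrows r := by
  have key : ∀ e ∈ D.arrows, ∀ a ∈ D.arrows,
      D.arcVec e (O a) = (1 / 2) * loopVec (ord D.word) e (O a) +
        (if D.word.idxOf (O e) < D.word.idxOf (U e) then 0 else 1) ∧
      D.arcVec e (U a) = (1 / 2) * loopVec (ord D.word) e (U a) +
        (if D.word.idxOf (O e) < D.word.idxOf (U e) then 0 else 1) := fun e he a ha =>
    ⟨D.arcVec_eq he (D.mem_arrows.1 ha).1, D.arcVec_eq he (D.mem_arrows.1 ha).2⟩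
  constructor
  · intro h
    refine FillRank.of_eq h 1 (by simp [KnotDiagram.arrows]) (1 / 2)
      (fun e => if D.word.idxOf (O e) < D.word.idxOf (U e) then 0 else 1) (crossForm_skew _)
      (crossForm_skew _) (fun e he => crossForm_congr (fun _ _ => ⟨rfl, rfl⟩) fun a ha => ?_)
      (fun e he f hf => crossForm_congr (fun a ha => ?_) fun a ha => ?_)
    · simpa only [Equiv.Perm.one_apply, Pi.add_apply, Pi.smul_apply, Pi.one_apply, smul_eq_mul,
        mul_one] using key _ he _ ha
    · simpa only [Equiv.Perm.one_apply, Pi.add_apply, Pi.smul_apply, Pi.one_apply, smul_eq_mul,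
        mul_one] using key _ he _ ha
    · simpa only [Equiv.Perm.one_apply, Pi.add_apply, Pi.smul_apply, Pi.one_apply, smul_eq_mul,
        mul_one] using key _ hf _ ha
  · intro h
    refine FillRank.of_eq h 1 (by simp [KnotDiagram.arrows]) 2
      (fun e => if D.word.idxOf (O e) < D.word.idxOf (U e) then 0 else -2) (crossForm_skew _)
      (crossForm_skew _) (fun e he => crossForm_congr (fun _ _ => ⟨rfl, rfl⟩) fun a ha => ?_)
      (fun e he f hf => crossForm_congr (fun a ha => ?_) fun a ha => ?_)
    · simp only [Equiv.Perm.one_apply, Pi.add_apply, Pi.smul_apply, Pi.one_apply, smul_eq_mul,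
        mul_one, key e he a ha]
      split_ifs <;> constructor <;> ring
    · simp only [Equiv.Perm.one_apply, Pi.add_apply, Pi.smul_apply, Pi.one_apply, smul_eq_mul,
        mul_one, key e he a ha]
      split_ifs <;> constructor <;> ring
    · simp only [Equiv.Perm.one_apply, Pi.add_apply, Pi.smul_apply, Pi.one_apply, smul_eq_mul,
        mul_one, key f hf a ha]
      split_ifs <;> constructor <;> ring

/-! ### Based matrices as Gram matrices, fillings as involutions -/

/-- The vectors of the based matrix. -/
def KnotDiagram.baseVec (D : KnotDiagram) : Option D.arrows → Endpoint → ℚ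
  | none => 1
  | some e => D.arcVec e

theorem KnotDiagram.basedMatrix_eq (D : KnotDiagram) (p q : Option D.arrows) :
    (D.basedMatrix p q : ℚ) = crossForm D.arrows (D.baseVec p) (D.baseVec q) := by
  rcases p with _ | ⟨e, he⟩ <;> rcases q with _ | ⟨f, hf⟩
  · have := crossForm_skew D.arrows 1 1
    simp only [basedMatrix, baseVec]
    push_cast
    linarith
  · simp only [basedMatrix, baseVec]
    rw [crossForm_skew, D.crossForm_arcVec_one]
    push_cast; rfl
  · simp only [basedMatrix, baseVec]
    rw [D.crossForm_arcVec_one]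
  · simp only [basedMatrix, baseVec]
    rw [D.crossForm_arcVec he hf]

theorem KnotDiagram.filling_matrix_eq (D : KnotDiagram) (χ : Filling D.arrows) :
    (χ.matrix D.basedMatrix).map (Int.cast : ℤ → ℚ) = Matrix.of fun p q =>
      crossForm D.arrows (∑ x ∈ χ.support p, D.baseVec x) (∑ x ∈ χ.support q, D.baseVec x) := by
  ext p q
  simp only [Matrix.map_apply, Filling.matrix, Matrix.of_apply, map_sum, LinearMap.sum_apply]
  push_cast
  rw [Finset.sum_comm]
  simp only [D.basedMatrix_eq]

/-- Partitions into parts of size one or two are exactly the orbit partitions of involutions.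
Indexing by arrows instead of parts lists the vector of a pair twice, which does not affect the
span. -/
theorem KnotDiagram.fillRank_iff (D : KnotDiagram) (r : ℕ) :
    FillRank (crossForm D.arrows) 1 D.arcVec D.arrows r ↔
      ∃ χ : Filling D.arrows, ((χ.matrix D.basedMatrix).map (Int.cast : ℤ → ℚ)).rank ≤ r := by
  classical
  constructor
  · rintro ⟨τ, hτ, hτA, hr⟩
    let T : D.arrows → D.arrows := fun e => ⟨τ e, hτA e e.2⟩
    have hT : ∀ e, T (T e) = e := fun e => Subtype.ext (hτ e)
    let P : Finpartition (Finset.univ : Finset D.arrows) :=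
      Finpartition.ofExistsUnique (Finset.univ.image fun e => {e, T e}) (fun _ _ => Finset.subset_univ _)
        (fun e _ => by
          refine ⟨{e, T e}, ⟨by simp, by simp⟩, ?_⟩
          rintro X ⟨hX, heX⟩
          obtain ⟨f, -, rfl⟩ := Finset.mem_image.1 hX
          rw [Finset.mem_insert, Finset.mem_singleton] at heX
          rcases heX with rfl | rfl
          · rfl
          · rw [hT, Finset.pair_comm])
        (fun h => by
          obtain ⟨e, -, he⟩ := Finset.mem_image.1 h
          exact (Finset.insert_ne_empty _ _) he)
    have hP : ∀ X ∈ P.parts, ∃ e, X = {e, T e} := by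
      intro X hX
      obtain ⟨e, -, he⟩ := Finset.mem_image.1 hX
      exact ⟨e, he.symm⟩
    refine ⟨⟨P, fun X hX => ?_⟩, ?_⟩
    · obtain ⟨e, rfl⟩ := hP X hX
      by_cases h : e = T e
      · left; rw [← h]; simp
      · right; exact Finset.card_pair h
    · rw [D.filling_matrix_eq]
      refine le_trans (rank_gram_le _ _ _ _ _ ?_ fun _ _ => rfl) hr
      rintro (_ | ⟨X, hX⟩)
      · simpa [Filling.support, KnotDiagram.baseVec] using
          fillVec_none_mem (1 : Endpoint → ℚ) D.arcVec τ D.arrows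
      · obtain ⟨e, rfl⟩ := hP X hX
        have h1 := fillVec_some_mem (1 : Endpoint → ℚ) D.arcVec τ e.2
        convert h1 using 1
        simp only [Filling.support, Finset.sum_map, Function.Embedding.some_apply,
          KnotDiagram.baseVec]
        by_cases h : e = T e
        · have h' : τ e = e := congrArg Subtype.val h.symm
          rw [← h]; simp [h']
        · have h' : τ e ≠ e := fun h' => h (Subtype.ext h'.symm)
          rw [Finset.sum_pair h, if_neg h']
  · rintro ⟨χ, hr⟩
    have hpart : ∀ e : D.arrows, ∃ f, χ.partition.part e = {e, f} := by
      intro e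
      have he : e ∈ χ.partition.part e := χ.partition.mem_part (Finset.mem_univ e)
      rcases χ.card_part _ (χ.partition.part_mem.2 (Finset.mem_univ e)) with h | h
      · obtain ⟨x, hx⟩ := Finset.card_eq_one.1 h
        rw [hx, Finset.mem_singleton] at he
        exact ⟨x, by rw [hx, he]; simp⟩
      · obtain ⟨x, y, -, hxy⟩ := Finset.card_eq_two.1 h
        rw [hxy, Finset.mem_insert, Finset.mem_singleton] at he
        rcases he with rfl | rfl
        · exact ⟨_, hxy⟩
        · exact ⟨_, by rw [hxy, Finset.pair_comm]⟩
    choose T hT using hpart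
    have hTT : ∀ e, T (T e) = e := by
      intro e
      have h1 : T e ∈ χ.partition.part e := by rw [hT]; simp
      have h2 : χ.partition.part (T e) = χ.partition.part e :=
        χ.partition.part_eq_of_mem (χ.partition.part_mem.2 (Finset.mem_univ e)) h1
      rw [hT, hT] at h2
      have h3 : e ∈ ({T e, T (T e)} : Finset D.arrows) := by rw [h2]; simp
      have h4 : T (T e) ∈ ({e, T e} : Finset D.arrows) := by rw [← h2]; simp
      rw [Finset.mem_insert, Finset.mem_singleton] at h3 h4
      rcases h4 with h4 | h4
      · exact h4
      · rcases h3 with h3 | h3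
        · rw [← h3, ← h3]
        · exact h3.symm
    let τ : ℕ → ℕ := fun e => if he : e ∈ D.arrows then T ⟨e, he⟩ else e
    have hτ : ∀ e : D.arrows, τ e = T e := fun e => by simp [τ]
    refine ⟨τ, fun e => ?_, fun e he => ?_, ?_⟩
    · by_cases he : e ∈ D.arrows
      · rw [hτ ⟨e, he⟩, hτ, hTT]
      · simp [τ, he]
    · rw [hτ ⟨e, he⟩]; exact (T _).2
    · rw [D.filling_matrix_eq] at hr
      refine le_trans (rank_gram_le _ _ _ _ _ ?_ fun _ _ => rfl) hr
      rintro (_ | e)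
      · refine Submodule.subset_span ⟨none, ?_⟩
        simp [Filling.support, KnotDiagram.baseVec, onArrows, fillVec]
      · refine Submodule.subset_span
          ⟨some ⟨_, χ.partition.part_mem.2 (Finset.mem_univ e)⟩, ?_⟩
        simp only [Filling.support, Finset.sum_map, Function.Embedding.some_apply,
          KnotDiagram.baseVec, onArrows, fillVec, Option.map_some, hT, hτ]
        by_cases h : e = T e
        · rw [← h]; simp
        · have h' : (T e : ℕ) ≠ e := fun h' => h (Subtype.ext h'.symm)
          rw [Finset.sum_pair h, if_neg h']

/-- `WordRank` describes the upward closure of the set of ranks of fillings, so both have the same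
infimum. Nonemptiness comes from the filling by singletons. -/
theorem KnotDiagram.matrixGenus_eq (D : KnotDiagram) :
    matrixGenus D.basedMatrix = ((sInf {r | WordRank D.word r} : ℕ) : ℚ) / 2 := by
  have hex : (Set.range fun χ : Filling D.arrows =>
      ((χ.matrix D.basedMatrix).map (Int.cast : ℤ → ℚ)).rank).Nonempty := by
    have : FillRank (crossForm D.arrows) 1 D.arcVec D.arrows (Fintype.card (Option D.arrows)) :=
      ⟨id, fun _ => rfl, fun _ h => h, Matrix.rank_le_card_width _⟩
    obtain ⟨χ, -⟩ := (D.fillRank_iff _).1 this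
    exact ⟨_, χ, rfl⟩
  have : sInf (Set.range fun χ : Filling D.arrows =>
      ((χ.matrix D.basedMatrix).map (Int.cast : ℤ → ℚ)).rank) = sInf {r | WordRank D.word r} := by
    have h : ∀ r, WordRank D.word r ↔
        ∃ x ∈ (Set.range fun χ : Filling D.arrows =>
          ((χ.matrix D.basedMatrix).map (Int.cast : ℤ → ℚ)).rank), x ≤ r := by
      intro r
      rw [D.wordRank_iff, D.fillRank_iff]
      simp
    apply le_antisymm
    · refine le_csInf ?_ fun r hr => ?_
      · obtain ⟨x, hx⟩ := hex
        exact ⟨x, (h x).2 ⟨x, hx, le_rfl⟩⟩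
      · obtain ⟨x, hx, hxr⟩ := (h r).1 hr
        exact (Nat.sInf_le hx).trans hxr
    · exact Nat.sInf_le ((h _).2 ⟨_, Nat.sInf_mem hex, le_rfl⟩)
  rw [matrixGenus, this]

/-! ## The order of the endpoints -/

theorem ord_self (w : List Endpoint) (x : Endpoint) : ord w x x = 0 := by simp [ord]

theorem ord_antisymm (w : List Endpoint) (x y : Endpoint) : ord w x y = -ord w y x := by
  unfold ord
  split_ifs <;> first | (exfalso; omega) | norm_num

theorem ord_congr {w w' : List Endpoint} {x y x' y' : Endpoint}
    (h : w.idxOf x < w.idxOf y ↔ w'.idxOf x' < w'.idxOf y')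
    (h' : w.idxOf y < w.idxOf x ↔ w'.idxOf y' < w'.idxOf x') : ord w x y = ord w' x' y' := by
  simp only [ord, h, h']

theorem ord_filter (w : List Endpoint) (P : Endpoint → Bool) {x y : Endpoint} (hx : P x = true)
    (hy : P y = true) : ord (w.filter P) x y = ord w x y := by
  have key : ∀ x y, P x = true → P y = true →
      ((w.filter P).idxOf x < (w.filter P).idxOf y ↔ w.idxOf x < w.idxOf y) := by
    intro x y hx hy
    induction w with
    | nil => rfl
    | cons z w ih =>
      by_cases hz : P z = true
      · rw [List.filter_cons_of_pos hz]
        simp only [List.idxOf_cons]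
        cases (z == x) <;> cases (z == y) <;> simp [ih]
      · rw [List.filter_cons_of_neg hz, ih]
        have h1 : z ≠ x := fun h => hz (h ▸ hx)
        have h2 : z ≠ y := fun h => hz (h ▸ hy)
        simp [h1, h2]
  exact ord_congr (key x y hx hy) (key y x hy hx)

theorem ord_map {σ : Equiv.Perm ℕ} (w : List Endpoint) (x y : Endpoint) :
    ord (w.map fun x => (σ x.1, x.2)) (σ x.1, x.2) (σ y.1, y.2) = ord w x y := by
  have key : ∀ x : Endpoint,
      (w.map fun x => (σ x.1, x.2)).idxOf (σ x.1, x.2) = w.idxOf x := by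
    intro x
    induction w with
    | nil => rfl
    | cons z w ih =>
      rw [List.map_cons, List.idxOf_cons, List.idxOf_cons, ih]
      congr 1
      rw [Bool.eq_iff_iff, beq_iff_eq, beq_iff_eq, Prod.ext_iff, Prod.ext_iff]
      simp
  exact ord_congr (by rw [key, key]) (by rw [key, key])

/-- Moving `u` to the back changes the order only between `u` and `v`, and the change is a
difference of a function of `x` and the same function of `y`. -/
theorem ord_rotate {u v : List Endpoint} (hn : (u ++ v).Nodup) {x y : Endpoint} (hx : x ∈ u ++ v)
    (hy : y ∈ u ++ v) : ord (u ++ v) x y =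
      ord (v ++ u) x y + (if x ∈ u then -1 else 1) - (if y ∈ u then -1 else 1) := by
  have hd := (List.nodup_append'.1 hn).2.2
  have key : ∀ x ∈ u ++ v, (x ∈ u ∧ (u ++ v).idxOf x = u.idxOf x ∧ u.idxOf x < u.length ∧
      (v ++ u).idxOf x = v.length + u.idxOf x) ∨
      (x ∉ u ∧ (v ++ u).idxOf x = v.idxOf x ∧ v.idxOf x < v.length ∧
      (u ++ v).idxOf x = u.length + v.idxOf x) := by
    intro x hx
    by_cases hxu : x ∈ u
    · left
      have hxv : x ∉ v := fun h => hd hxu h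
      exact ⟨hxu, List.idxOf_append_of_mem hxu, List.idxOf_lt_length_iff.2 hxu,
        List.idxOf_append_of_notMem hxv⟩
    · right
      have hxv : x ∈ v := (List.mem_append.1 hx).resolve_left hxu
      exact ⟨hxu, List.idxOf_append_of_mem hxv, List.idxOf_lt_length_iff.2 hxv,
        List.idxOf_append_of_notMem hxu⟩
  unfold ord
  rcases key x hx with ⟨h1, h2, h3, h4⟩ | ⟨h1, h2, h3, h4⟩ <;>
    rcases key y hy with ⟨k1, k2, k3, k4⟩ | ⟨k1, k2, k3, k4⟩ <;>
    simp only [h1, h2, h4, k1, k2, k4, if_true, if_false] <;>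
    split_ifs <;> first | (exfalso; omega) | norm_num

theorem idxOf_mid {A p B : List Endpoint} (hn : (A ++ (p ++ B)).Nodup) {x : Endpoint} (hx : x ∈ p) :
    (A ++ (p ++ B)).idxOf x = A.length + p.idxOf x := by
  have hd := (List.nodup_append'.1 hn).2.2
  rw [List.idxOf_append_of_notMem fun h => hd h (by simp [hx]), List.idxOf_append_of_mem hx]

theorem ord_mid {A p B : List Endpoint} (hn : (A ++ (p ++ B)).Nodup) {x y : Endpoint} (hx : x ∈ p)
    (hy : y ∈ p) : ord (A ++ (p ++ B)) x y = ord p x y :=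
  ord_congr (by rw [idxOf_mid hn hx, idxOf_mid hn hy]; omega)
    (by rw [idxOf_mid hn hx, idxOf_mid hn hy]; omega)

theorem ord_adjacent {A p B : List Endpoint} (hn : (A ++ (p ++ B)).Nodup) {x y z : Endpoint}
    (hx : x ∈ p) (hy : y ∈ p) (hz : z ∉ p) :
    ord (A ++ (p ++ B)) x z = ord (A ++ (p ++ B)) y z := by
  have h1 := List.idxOf_lt_length_iff.2 hx
  have h2 := List.idxOf_lt_length_iff.2 hy
  unfold ord
  rw [idxOf_mid hn hx, idxOf_mid hn hy]
  by_cases hzA : z ∈ A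
  · have h3 := List.idxOf_lt_length_iff.2 hzA
    rw [List.idxOf_append_of_mem hzA]
    split_ifs <;> first | (exfalso; omega) | rfl
  · rw [List.idxOf_append_of_notMem hzA, List.idxOf_append_of_notMem hz]
    split_ifs <;> first | (exfalso; omega) | rfl

theorem exists_fill_mid {k : ℕ} {c : List (Endpoint ⊕ Fin k)} (h : Fin k → List Endpoint) {i : Fin k}
    (hc : c.count (Sum.inr i) = 1) :
    ∃ A B, c.flatMap (Sum.elim (fun x => [x]) h) = A ++ (h i ++ B) := by
  have : Sum.inr i ∈ c := List.count_pos_iff.1 (by omega)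
  obtain ⟨α, β, rfl⟩ := List.append_of_mem this
  exact ⟨_, _, by rw [List.flatMap_append, List.flatMap_cons]; rfl⟩

theorem ord_fill_perm {k : ℕ} (c : List (Endpoint ⊕ Fin k)) {h h' : Fin k → List Endpoint}
    (hp : ∀ i, (h i).Perm (h' i)) {x y : Endpoint} (hxy : ∀ i, ¬ (x ∈ h i ∧ y ∈ h i)) :
    ord (c.flatMap (Sum.elim (fun x => [x]) h)) x y =
      ord (c.flatMap (Sum.elim (fun x => [x]) h')) x y := by
  have key : ∀ x y, (∀ i, ¬ (x ∈ h i ∧ y ∈ h i)) →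
      ((c.flatMap (Sum.elim (fun x => [x]) h)).idxOf x <
        (c.flatMap (Sum.elim (fun x => [x]) h)).idxOf y ↔
      (c.flatMap (Sum.elim (fun x => [x]) h')).idxOf x <
        (c.flatMap (Sum.elim (fun x => [x]) h')).idxOf y) := by
    intro x y hxy
    induction c with
    | nil => rfl
    | cons z c ih =>
      rw [List.flatMap_cons, List.flatMap_cons]
      have hb : (Sum.elim (fun x => [x]) h z).Perm (Sum.elim (fun x => [x]) h' z) := by
        cases z with
        | inl z => exact List.Perm.refl _
        | inr i => exact hp i
      have hxyb : ¬ (x ∈ Sum.elim (fun x => [x]) h z ∧ y ∈ Sum.elim (fun x => [x]) h z) ∨ x = y := by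
        cases z with
        | inl z =>
          by_cases hh : x = y
          · exact Or.inr hh
          · left
            simp only [Sum.elim_inl, List.mem_singleton]
            rintro ⟨rfl, rfl⟩
            exact hh rfl
        | inr i => exact Or.inl (hxy i)
      generalize Sum.elim (fun x => [x]) h z = b at *
      generalize Sum.elim (fun x => [x]) h' z = b' at *
      generalize c.flatMap (Sum.elim (fun x => [x]) h) = r at *
      generalize c.flatMap (Sum.elim (fun x => [x]) h') = r' at *
      have hl := hb.length_eq
      rcases hxyb with hxyb | rfl
      · have pos : ∀ {b r : List Endpoint} {x : Endpoint}, x ∈ b →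
            (b ++ r).idxOf x < b.length := fun hx => by
          rw [List.idxOf_append_of_mem hx]; exact List.idxOf_lt_length_iff.2 hx
        by_cases hx : x ∈ b
        · have hy : y ∉ b := fun hy => hxyb ⟨hx, hy⟩
          have hy' : y ∉ b' := fun hy' => hy (hb.mem_iff.2 hy')
          have h1 := pos (r := r) hx
          have h2 := pos (r := r') (hb.mem_iff.1 hx)
          rw [List.idxOf_append_of_notMem hy, List.idxOf_append_of_notMem hy']
          constructor <;> intro <;> omega
        · have hx' : x ∉ b' := fun hx' => hx (hb.mem_iff.2 hx')
          rw [List.idxOf_append_of_notMem hx, List.idxOf_append_of_notMem hx']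
          by_cases hy : y ∈ b
          · have h1 := pos (r := r) hy
            have h2 := pos (r := r') (hb.mem_iff.1 hy)
            constructor <;> intro <;> omega
          · have hy' : y ∉ b' := fun hy' => hy (hb.mem_iff.2 hy')
            rw [List.idxOf_append_of_notMem hy, List.idxOf_append_of_notMem hy']
            omega
      · simp
  exact ord_congr (key x y hxy) (key y x fun i hi => hxy i hi.symm)

theorem fill_filter {k : ℕ} (c : List (Endpoint ⊕ Fin k)) (h : Fin k → List Endpoint)
    (P : Endpoint → Bool) (hout : ∀ x ∈ outer c, P x = true) :
    (c.flatMap (Sum.elim (fun x => [x]) h)).filter P =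
      c.flatMap (Sum.elim (fun x => [x]) fun i => (h i).filter P) := by
  rw [List.filter_flatMap]
  apply List.flatMap_congr
  rintro (x | i) hx
  · have : P x = true := hout x (List.mem_filterMap.2 ⟨_, hx, rfl⟩)
    simp [this]
  · rfl

/-! ## Invariance of the ranks of fillings -/

theorem mem_arrows_of_isGauss {w : List Endpoint} (hw : IsGauss w) {a : ℕ} :
    a ∈ (w.map Prod.fst).toFinset ↔ O a ∈ w ∧ U a ∈ w := KnotDiagram.mem_arrows ⟨w, hw⟩

theorem fillRank_congr {A : Finset ℕ} {d d' : ℕ → Endpoint → ℚ} {r : ℕ}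
    (h : ∀ e ∈ A, ∀ a ∈ A, d e (O a) = d' e (O a) ∧ d e (U a) = d' e (U a)) :
    FillRank (crossForm A) 1 d A r ↔ FillRank (crossForm A) 1 d' A r := by
  have key : ∀ d d' : ℕ → Endpoint → ℚ,
      (∀ e ∈ A, ∀ a ∈ A, d e (O a) = d' e (O a) ∧ d e (U a) = d' e (U a)) →
      FillRank (crossForm A) 1 d' A r → FillRank (crossForm A) 1 d A r := by
    intro d d' h hr
    refine hr.of_eq 1 (fun _ => Iff.rfl) 1 0 (crossForm_skew _) (crossForm_skew _)
      (fun e he => crossForm_congr (fun _ _ => ⟨rfl, rfl⟩) fun a ha => ?_)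
      (fun e he f hf => crossForm_congr (fun a ha => ?_) fun a ha => ?_)
    · simpa using h e he a ha
    · simpa using h e he a ha
    · simpa using h f hf a ha
  exact ⟨key _ _ fun e he a ha => ⟨(h e he a ha).1.symm, (h e he a ha).2.symm⟩, key _ _ h⟩

/-- In a loop, the part of the change of `ord` that depends on the evaluation point cancels between
head and tail. What is left is the constant `κ (U e) - κ (O e)`, a multiple of `s`. -/
theorem wordRank_rotate {u v : List Endpoint} (hg : IsGauss (u ++ v)) {r : ℕ}
    (h : WordRank (v ++ u) r) : WordRank (u ++ v) r := by
  set κ : Endpoint → ℚ := fun x => if x ∈ u then -1 else 1 with hκ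
  have key : ∀ e ∈ ((u ++ v).map Prod.fst).toFinset, ∀ a ∈ ((u ++ v).map Prod.fst).toFinset,
      loopVec (ord (u ++ v)) e (O a) = loopVec (ord (v ++ u)) e (O a) + (κ (U e) - κ (O e)) ∧
      loopVec (ord (u ++ v)) e (U a) = loopVec (ord (v ++ u)) e (U a) + (κ (U e) - κ (O e)) := by
    intro e he a ha
    obtain ⟨h1, h2⟩ := (mem_arrows_of_isGauss hg).1 he
    obtain ⟨h3, h4⟩ := (mem_arrows_of_isGauss hg).1 ha
    simp only [loopVec]
    rw [ord_rotate hg.1 h2 h3, ord_rotate hg.1 h1 h3, ord_rotate hg.1 h2 h4, ord_rotate hg.1 h1 h4]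
    constructor <;> ring
  have hA : ((v ++ u).map Prod.fst).toFinset = ((u ++ v).map Prod.fst).toFinset := by
    ext; simp [or_comm]
  unfold WordRank at h ⊢
  rw [hA] at h
  refine h.of_eq 1 (fun _ => Iff.rfl) 1 (fun e => κ (U e) - κ (O e)) (crossForm_skew _)
    (crossForm_skew _)
      (fun e he => crossForm_congr (fun _ _ => ⟨rfl, rfl⟩) fun a ha => ?_)
      (fun e he f hf => crossForm_congr (fun a ha => ?_) fun a ha => ?_)
  · simpa using key e he a ha
  · simpa using key e he a ha
  · simpa using key f hf a ha

theorem wordRank_rename (σ : Equiv.Perm ℕ) {w : List Endpoint} {r : ℕ}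
    (h : WordRank (w.map fun x => (σ x.1, x.2)) r) : WordRank w r := by
  have hA : ((w.map fun x => (σ x.1, x.2)).map Prod.fst).toFinset =
      (w.map Prod.fst).toFinset.map σ.toEmbedding := by
    ext a
    simp
    constructor
    · rintro ⟨b, h, rfl⟩; simpa using h
    · intro h; exact ⟨σ.symm a, h, by simp⟩
  have hd : ∀ e (x : Endpoint), loopVec (ord (w.map fun x => (σ x.1, x.2))) (σ e) (σ x.1, x.2) =
      loopVec (ord w) e x := by
    intro e x
    have h1 := ord_map (σ := σ) w (U e) x
    have h2 := ord_map (σ := σ) w (O e) x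
    simp only [loopVec]
    simp only at h1 h2
    rw [h1, h2]
  unfold WordRank at h ⊢
  rw [hA] at h
  refine h.of_eq σ (by simp) 1 0 (crossForm_skew _) (crossForm_skew _)
    (fun e _ => ?_) fun e _ f _ => ?_
  · rw [crossForm_apply, crossForm_apply, Finset.sum_map]
    refine Finset.sum_congr rfl fun a _ => ?_
    have h1 := hd e (O a)
    have h2 := hd e (U a)
    simp only at h1 h2
    simp [h1, h2]
  · rw [crossForm_apply, crossForm_apply, Finset.sum_map]
    refine Finset.sum_congr rfl fun a _ => ?_
    have h1 := hd e (O a)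
    have h2 := hd e (U a)
    have h3 := hd f (O a)
    have h4 := hd f (U a)
    simp only at h1 h2 h3 h4
    simp [h1, h2, h3, h4]

theorem arrows_filter (w : List Endpoint) (P : ℕ → Bool) :
    ((w.filter fun x => P x.1).map Prod.fst).toFinset =
      (w.map Prod.fst).toFinset.filter fun a => P a = true := by
  ext a
  simp only [List.mem_toFinset, List.mem_map, List.mem_filter, Finset.mem_filter]
  constructor
  · rintro ⟨x, ⟨h1, h2⟩, rfl⟩; exact ⟨⟨x, h1, rfl⟩, h2⟩
  · rintro ⟨⟨x, h1, rfl⟩, h2⟩; exact ⟨x, ⟨h1, h2⟩, rfl⟩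

theorem wordRank_filter (w : List Endpoint) (P : ℕ → Bool) (r : ℕ) :
    WordRank (w.filter fun x => P x.1) r ↔
      FillRank (crossForm ((w.map Prod.fst).toFinset.filter fun a => P a = true)) 1
        (loopVec (ord w)) ((w.map Prod.fst).toFinset.filter fun a => P a = true) r := by
  unfold WordRank
  rw [arrows_filter]
  refine fillRank_congr fun e he a ha => ?_
  have he := (Finset.mem_filter.1 he).2
  have ha := (Finset.mem_filter.1 ha).2
  simp only [loopVec]
  have key : ∀ x y : Endpoint, P x.1 = true → P y.1 = true →
      ord (w.filter fun x => P x.1) x y = ord w x y := fun x y hx hy =>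
    ord_filter w (fun x => P x.1) hx hy
  rw [key _ _ he ha, key _ _ he ha, key _ _ he ha, key _ _ he ha]
  exact ⟨rfl, rfl⟩

/-! ### The first and second Reidemeister moves -/

/-- The loop at `a` vanishes at all other endpoints, and every loop has equal values at the two ends
of `a`. So `a` contributes nothing to intersection numbers and its loop is in the radical. -/
theorem wordRank_fr1 {w : List Endpoint} {a : ℕ} (ha : a ∈ (w.map Prod.fst).toFinset)
    (hadj : ∀ z : Endpoint, z.1 ≠ a → ord w (O a) z = ord w (U a) z) (r : ℕ) :
    WordRank w r ↔ WordRank (w.filter fun x => decide (x.1 ≠ a)) r := by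
  rw [wordRank_filter w (fun b => decide (b ≠ a))]
  set A := (w.map Prod.fst).toFinset with hA
  set A' := A.filter fun b => decide (b ≠ a) = true with hA'
  have hins : A = insert a A' := by
    ext b
    simp only [hA', Finset.mem_insert, Finset.mem_filter, decide_eq_true_eq]
    grind
  have ha' : a ∉ A' := by simp [hA']
  have hne : ∀ e ∈ A', e ≠ a := fun e he h => ha' (h ▸ he)
  have hQ : ∀ x ∈ insert (1 : Endpoint → ℚ) (loopVec (ord w) '' A'), x (O a) = x (U a) := by
    rintro x (rfl | ⟨e, he, rfl⟩)
    · rfl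
    · have := hne e he
      simp only [loopVec]
      rw [ord_antisymm w (U e), ord_antisymm w (O e), ord_antisymm w (U e), ord_antisymm w (O e),
        hadj _ this, hadj _ this]
  have hsum : ∀ g h : Endpoint → ℚ, crossForm (insert a A') g h =
      (g (O a) * h (U a) - g (U a) * h (O a)) + crossForm A' g h := fun g h => by
    rw [crossForm_apply, Finset.sum_insert ha', crossForm_apply]
  unfold WordRank
  rw [← hA, hins]
  refine fillRank_insert_iff ha' (crossForm_skew _) (fun x hx y hy => ?_) fun x hx => ?_
  · rw [hsum, hQ x hx, hQ y hy]; ring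
  · have h0 : crossForm A' (loopVec (ord w) a) x = 0 := by
      rw [crossForm_apply]
      refine Finset.sum_eq_zero fun b hb => ?_
      simp only [loopVec]
      rw [hadj _ (hne b hb), hadj _ (hne b hb)]
      ring
    have hxx : x (O a) = x (U a) := by
      rcases hx with rfl | ⟨e, he, rfl⟩
      · rfl
      · rw [Finset.coe_insert] at he
        rcases he with rfl | he
        · simp only [loopVec, ord_self]
          rw [ord_antisymm w (O e) (U e)]
          ring
        · exact hQ _ (Or.inr ⟨e, he, rfl⟩)
    rw [hsum, h0, hxx]
    simp only [loopVec, ord_self]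
    rw [ord_antisymm w (O a) (U a)]
    ring

/-- Every loop at another arrow has equal values at `O a`, `U b` and at `U a`, `O b`, so the terms
of `a` and `b` cancel. The sum of the loops at `a` and `b` vanishes away from these arrows and is in
the radical. -/
theorem wordRank_fr2 {w : List Endpoint} {a b : ℕ} (ha : a ∈ (w.map Prod.fst).toFinset)
    (hb : b ∈ (w.map Prod.fst).toFinset) (hab : a ≠ b)
    (hp : ∀ z, z ≠ O a → z ≠ U b → ord w (O a) z = ord w (U b) z)
    (hq : ∀ z, z ≠ U a → z ≠ O b → ord w (U a) z = ord w (O b) z) (r : ℕ) :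
    WordRank w r ↔ WordRank (w.filter fun x => decide (x.1 ≠ a ∧ x.1 ≠ b)) r := by
  rw [wordRank_filter w (fun c => decide (c ≠ a ∧ c ≠ b))]
  set A := (w.map Prod.fst).toFinset with hA
  set A' := A.filter fun c => decide (c ≠ a ∧ c ≠ b) = true with hA'
  have hins : A = insert a (insert b A') := by
    ext c
    simp only [hA', Finset.mem_insert, Finset.mem_filter, decide_eq_true_eq]
    grind
  have ha' : a ∉ A' := by simp [hA']
  have hb' : b ∉ A' := by simp [hA']
  have hne : ∀ e ∈ A', e ≠ a ∧ e ≠ b := fun e he => ⟨fun h => ha' (h ▸ he), fun h => hb' (h ▸ he)⟩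
  have hpo : ∀ e ∈ A', ∀ f, ord w (O a) (e, f) = ord w (U b) (e, f) := fun e he f =>
    hp _ (by simp [(hne e he).1]) (by simp [(hne e he).2])
  have hqo : ∀ e ∈ A', ∀ f, ord w (U a) (e, f) = ord w (O b) (e, f) := fun e he f =>
    hq _ (by simp [(hne e he).1]) (by simp [(hne e he).2])
  have hQ : ∀ x ∈ insert (1 : Endpoint → ℚ) (loopVec (ord w) '' A'),
      x (O a) = x (U b) ∧ x (U a) = x (O b) := by
    rintro x (rfl | ⟨e, he, rfl⟩)
    · exact ⟨rfl, rfl⟩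
    · simp only [loopVec]
      rw [ord_antisymm w (U e), ord_antisymm w (O e), ord_antisymm w (U e) (U b),
        ord_antisymm w (O e) (U b), ord_antisymm w (U e) (U a), ord_antisymm w (O e) (U a),
        ord_antisymm w (U e) (O b), ord_antisymm w (O e) (O b), hpo e he, hpo e he, hqo e he,
        hqo e he]
      exact ⟨rfl, rfl⟩
  have hsum : ∀ g h : Endpoint → ℚ, crossForm (insert a (insert b A')) g h =
      (g (O a) * h (U a) - g (U a) * h (O a)) + ((g (O b) * h (U b) - g (U b) * h (O b)) +
        crossForm A' g h) := fun g h => by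
    rw [crossForm_apply, Finset.sum_insert (by simp [hab, ha']), Finset.sum_insert hb',
      crossForm_apply]
  unfold WordRank
  rw [← hA, hins]
  refine fillRank_insert_insert_iff ha' hb' hab (crossForm_skew _) (fun x hx y hy => ?_)
    fun x hx => ?_
  · rw [hsum, (hQ x hx).1, (hQ y hy).1, (hQ x hx).2, (hQ y hy).2]; ring
  · have h0 : crossForm A' (loopVec (ord w) a + loopVec (ord w) b) x = 0 := by
      rw [crossForm_apply]
      refine Finset.sum_eq_zero fun c hc => ?_
      simp only [loopVec, Pi.add_apply]
      rw [hpo c hc, hpo c hc, hqo c hc, hqo c hc]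
      ring
    -- Together with skewness, adjacency expresses all orders between endpoints of different strands
    -- through `ord w (O a) (U a)`. The orders within the strands remain free and drop out.
    have v1 : ord w (U b) (U a) = ord w (O a) (U a) := (hp _ (by simp) (by simp [hab])).symm
    have v2 : ord w (U b) (O b) = ord w (O a) (O b) := (hp _ (by simp [hab.symm]) (by simp)).symm
    have v3 : ord w (O a) (O b) = ord w (O a) (U a) := by
      rw [ord_antisymm w (O a), ord_antisymm w (O a), hq _ (by simp) (by simp [hab])]
    have v4 := ord_antisymm w (U a) (O a)
    have v5 := ord_antisymm w (O b) (O a)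
    have v6 := ord_antisymm w (U a) (U b)
    have v7 := ord_antisymm w (O b) (U b)
    have v8 := ord_antisymm w (U b) (O a)
    have v9 := ord_antisymm w (O b) (U a)
    rw [hsum, h0]
    rcases hx with rfl | ⟨e, he, rfl⟩
    · simp only [loopVec, Pi.add_apply, Pi.one_apply, ord_self, v4, v5, v6, v7, v8, v9, v1, v2, v3]
      ring
    · rw [Finset.coe_insert, Finset.coe_insert] at he
      rcases he with rfl | rfl | he
      · simp only [loopVec, Pi.add_apply, ord_self, v4, v5, v6, v7, v8, v9, v1, v2, v3]
        ring
      · simp only [loopVec, Pi.add_apply, ord_self, v4, v5, v6, v7, v8, v9, v1, v2, v3]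
        ring
      · obtain ⟨q1, q2⟩ := hQ _ (Or.inr ⟨e, he, rfl⟩)
        rw [q1, q2]
        simp only [loopVec, Pi.add_apply, ord_self, v4, v5, v6, v7, v8, v9, v1, v2, v3]
        ring

/-! ### The third Reidemeister move -/

/-- The values of a loop at the six endpoints of a triangle before and after a move of the third
kind; `s₀`, `s₁`, `s₂` are the directions of the arrows. -/
def TriangleValues (x₀ y₀ x₁ y₁ x₂ y₂ : Endpoint) (s₀ s₁ s₂ : ℚ) (g g' : Endpoint → ℚ) : Prop :=
  ∃ φ₀ φ₁ φ₂ t₀ t₁ t₂ : ℚ,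
    (g x₀ = φ₀ + t₂ * s₀ ∧ g y₀ = φ₀ + t₀ * s₂ ∧ g x₁ = φ₁ + t₀ * s₁ ∧ g y₁ = φ₁ + t₁ * s₀ ∧
      g x₂ = φ₂ + t₁ * s₂ ∧ g y₂ = φ₂ + t₂ * s₁) ∧
    (g' x₀ = φ₀ - t₂ * s₀ ∧ g' y₀ = φ₀ - t₀ * s₂ ∧ g' x₁ = φ₁ - t₀ * s₁ ∧ g' y₁ = φ₁ - t₁ * s₀ ∧
      g' x₂ = φ₂ - t₁ * s₂ ∧ g' y₂ = φ₂ - t₂ * s₁)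

theorem TriangleValues.rotate {x₀ y₀ x₁ y₁ x₂ y₂ : Endpoint} {s₀ s₁ s₂ : ℚ} {g g' : Endpoint → ℚ}
    (h : TriangleValues x₁ y₁ x₂ y₂ x₀ y₀ s₁ s₂ s₀ g g') :
    TriangleValues x₀ y₀ x₁ y₁ x₂ y₂ s₀ s₁ s₂ g g' := by
  obtain ⟨φ₁, φ₂, φ₀, t₁, t₂, t₀, ⟨h1, h2, h3, h4, h5, h6⟩, h1', h2', h3', h4', h5', h6'⟩ := h
  exact ⟨φ₀, φ₁, φ₂, t₀, t₁, t₂, ⟨h5, h6, h1, h2, h3, h4⟩, h5', h6', h1', h2', h3', h4'⟩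

/-- `1` for a tail and `-1` for a head. -/
def dir (e : Bool) : ℚ := if e then 1 else -1

/-- The move negates the parameters `t` and `u` of the two loops. In the contribution of the
triangle, the terms of first order in these parameters cancel cyclically over the three arrows,
while the terms of order zero and two are unaffected by the sign. -/
theorem crossForm_triangle {A : Finset ℕ} {a b c : ℕ} (ha : a ∈ A) (hb : b ∈ A) (hc : c ∈ A)
    (hab : a ≠ b) (hbc : b ≠ c) (hac : a ≠ c) {e₀ e₁ e₂ : Bool} {g g' h h' : Endpoint → ℚ}
    (hg : TriangleValues (a, e₀) (c, !e₂) (b, e₁) (a, !e₀) (c, e₂) (b, !e₁) (dir e₀) (dir e₁) (dir e₂)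
      g g')
    (hh : TriangleValues (a, e₀) (c, !e₂) (b, e₁) (a, !e₀) (c, e₂) (b, !e₁) (dir e₀) (dir e₁) (dir e₂)
      h h')
    (hgo : ∀ x : Endpoint, x.1 ≠ a → x.1 ≠ b → x.1 ≠ c → g x = g' x)
    (hho : ∀ x : Endpoint, x.1 ≠ a → x.1 ≠ b → x.1 ≠ c → h x = h' x) :
    crossForm A g h = crossForm A g' h' := by
  have hA : A = insert a (insert b (insert c (A.filter fun d => d ≠ a ∧ d ≠ b ∧ d ≠ c))) := by
    ext d
    simp only [Finset.mem_insert, Finset.mem_filter]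
    grind
  have hsum : ∀ g h, crossForm A g h =
      (g (O a) * h (U a) - g (U a) * h (O a)) + ((g (O b) * h (U b) - g (U b) * h (O b)) +
      ((g (O c) * h (U c) - g (U c) * h (O c)) +
        crossForm (A.filter fun d => d ≠ a ∧ d ≠ b ∧ d ≠ c) g h)) := by
    intro g h
    conv_lhs => rw [hA]
    rw [crossForm_apply, Finset.sum_insert (by simp [hab, hac]), Finset.sum_insert (by simp [hbc]),
      Finset.sum_insert (by simp), crossForm_apply]
  have hout : crossForm (A.filter fun d => d ≠ a ∧ d ≠ b ∧ d ≠ c) g h =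
      crossForm (A.filter fun d => d ≠ a ∧ d ≠ b ∧ d ≠ c) g' h' := by
    apply crossForm_congr
    · intro d hd
      obtain ⟨-, h1, h2, h3⟩ := Finset.mem_filter.1 hd
      exact ⟨hgo _ h1 h2 h3, hgo _ h1 h2 h3⟩
    · intro d hd
      obtain ⟨-, h1, h2, h3⟩ := Finset.mem_filter.1 hd
      exact ⟨hho _ h1 h2 h3, hho _ h1 h2 h3⟩
  rw [hsum, hsum, hout]
  obtain ⟨φ₀, φ₁, φ₂, t₀, t₁, t₂, ⟨h1, h2, h3, h4, h5, h6⟩, h1', h2', h3', h4', h5', h6'⟩ := hg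
  obtain ⟨ψ₀, ψ₁, ψ₂, u₀, u₁, u₂, ⟨k1, k2, k3, k4, k5, k6⟩, k1', k2', k3', k4', k5', k6'⟩ := hh
  clear hout hsum hA hgo hho
  cases e₀ <;> cases e₁ <;> cases e₂ <;>
    simp only [Bool.not_true, Bool.not_false, dir, if_true, Bool.false_eq_true, if_false] at * <;>
    rw [h1, h2, h3, h4, h5, h6, h1', h2', h3', h4', h5', h6', k1, k2, k3, k4, k5, k6,
      k1', k2', k3', k4', k5', k6'] <;> ring

/-- How the orders before and after a move of the third kind are related. -/
structure TriangleOrder (ε ε' : Endpoint → Endpoint → ℚ) (x₀ y₀ x₁ y₁ x₂ y₂ : Endpoint)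
    (s₀ s₁ s₂ : ℚ) : Prop where
  skew : ∀ x y, ε x y = -ε y x
  skew' : ∀ x y, ε' x y = -ε' y x
  adj₀ : ∀ z, z ≠ x₀ → z ≠ y₀ → ε x₀ z = ε y₀ z
  adj₁ : ∀ z, z ≠ x₁ → z ≠ y₁ → ε x₁ z = ε y₁ z
  adj₂ : ∀ z, z ≠ x₂ → z ≠ y₂ → ε x₂ z = ε y₂ z
  out : ∀ x y, ¬ ((x = x₀ ∨ x = y₀) ∧ (y = x₀ ∨ y = y₀)) → ¬ ((x = x₁ ∨ x = y₁) ∧ (y = x₁ ∨ y = y₁)) →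
    ¬ ((x = x₂ ∨ x = y₂) ∧ (y = x₂ ∨ y = y₂)) → ε' x y = ε x y
  val₀ : ε x₀ y₀ = -(s₀ * s₂)
  val₁ : ε x₁ y₁ = -(s₁ * s₀)
  val₂ : ε x₂ y₂ = -(s₂ * s₁)
  val₀' : ε' x₀ y₀ = s₀ * s₂
  val₁' : ε' x₁ y₁ = s₁ * s₀
  val₂' : ε' x₂ y₂ = s₂ * s₁

theorem TriangleOrder.rotate {ε ε' : Endpoint → Endpoint → ℚ} {x₀ y₀ x₁ y₁ x₂ y₂ : Endpoint}
    {s₀ s₁ s₂ : ℚ} (h : TriangleOrder ε ε' x₀ y₀ x₁ y₁ x₂ y₂ s₀ s₁ s₂) :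
    TriangleOrder ε ε' x₁ y₁ x₂ y₂ x₀ y₀ s₁ s₂ s₀ :=
  ⟨h.skew, h.skew', h.adj₁, h.adj₂, h.adj₀, fun x y h1 h2 h3 => h.out x y h3 h1 h2, h.val₁, h.val₂,
    h.val₀, h.val₁', h.val₂', h.val₀'⟩

theorem self_eq_zero_of_skew {ε : Endpoint → Endpoint → ℚ} (h : ∀ x y, ε x y = -ε y x) (x : Endpoint) :
    ε x x = 0 := by
  have := h x x
  linarith

/-- The values at the triangle of a loop at a corner of the triangle. -/
theorem TriangleOrder.values_corner {ε ε' : Endpoint → Endpoint → ℚ} {a b c : ℕ} {e₀ e₁ e₂ : Bool}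
    (hab : a ≠ b) (hbc : b ≠ c) (hac : a ≠ c)
    (h : TriangleOrder ε ε' (a, e₀) (c, !e₂) (b, e₁) (a, !e₀) (c, e₂) (b, !e₁) (dir e₀) (dir e₁)
      (dir e₂)) :
    TriangleValues (a, e₀) (c, !e₂) (b, e₁) (a, !e₀) (c, e₂) (b, !e₁) (dir e₀) (dir e₁) (dir e₂)
      (loopVec ε a) (loopVec ε' a) := by
  have hs : ∀ e, dir e * dir e = 1 := by intro e; cases e <;> norm_num [dir]
  have hl : ∀ ε : Endpoint → Endpoint → ℚ, ∀ z,
      loopVec ε a z = dir e₀ * (ε (a, !e₀) z - ε (a, e₀) z) := by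
    intro ε z
    cases e₀ <;> simp [loopVec, dir]
  have hba := hab.symm
  have hcb := hbc.symm
  have hca := hac.symm
  have o1 : ε' (a, !e₀) (a, e₀) = ε (a, !e₀) (a, e₀) :=
    h.out _ _ (by simp [hac]) (by simp [hab]) (by simp [hab, hac])
  have o2 : ε' (a, !e₀) (c, !e₂) = ε (a, !e₀) (c, !e₂) :=
    h.out _ _ (by simp [hac]) (by simp [hca, hcb]) (by simp [hab, hac])
  have o3 : ε' (a, e₀) (b, e₁) = ε (a, e₀) (b, e₁) :=
    h.out _ _ (by simp [hba, hbc]) (by simp [hab]) (by simp [hab, hac])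
  have o4 : ε' (a, e₀) (a, !e₀) = ε (a, e₀) (a, !e₀) :=
    h.out _ _ (by simp [hac]) (by simp [hab]) (by simp [hab, hac])
  have o5 : ∀ f, ε' (a, f) (b, !e₁) = ε (a, f) (b, !e₁) := fun f =>
    h.out _ _ (by simp [hba, hbc]) (by simp [hba]) (by simp [hab, hac])
  have o6 : ∀ f, ε' (a, f) (c, e₂) = ε (a, f) (c, e₂) := fun f =>
    h.out _ _ (by simp [hca]) (by simp [hca, hcb]) (by simp [hab, hac])
  have z := self_eq_zero_of_skew h.skew
  have z' := self_eq_zero_of_skew h.skew'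
  have q1 : ε (a, !e₀) (c, !e₂) = ε (a, !e₀) (a, e₀) := by
    rw [h.skew, ← h.adj₀ _ (by simp) (by simp [hac]), ← h.skew]
  have q2 : ε (a, e₀) (b, e₁) = ε (a, e₀) (a, !e₀) := by
    rw [h.skew, h.adj₁ _ (by simp [hab]) (by simp), ← h.skew]
  have q3 : ∀ f, ε (a, f) (b, !e₁) = ε (a, f) (c, e₂) := fun f => by
    rw [h.skew, ← h.adj₂ _ (by simp [hac]) (by simp [hab]), ← h.skew]
  have w1 : ε (a, !e₀) (b, e₁) = dir e₁ * dir e₀ := by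
    rw [h.skew, h.val₁]; ring
  have w1' : ε' (a, !e₀) (b, e₁) = -(dir e₁ * dir e₀) := by
    rw [h.skew', h.val₁']
  -- The first three entries are the loop's base values on the strands. The parameters `1, 0, 0`
  -- record that the loop turns at the crossing `a` and at neither of the other two, which affects
  -- the remaining endpoints of the two strands through `a`.
  refine ⟨dir e₀ * ε (a, !e₀) (a, e₀), -(dir e₀ * ε (a, e₀) (a, !e₀)),
    dir e₀ * (ε (a, !e₀) (c, e₂) - ε (a, e₀) (c, e₂)), 1, 0, 0, ⟨?_, ?_, ?_, ?_, ?_, ?_⟩,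
    ?_, ?_, ?_, ?_, ?_, ?_⟩ <;> rw [hl]
  · rw [z]; ring
  · rw [h.val₀, q1]; linear_combination dir e₂ * hs e₀
  · rw [w1, q2]; linear_combination dir e₁ * hs e₀
  · rw [z]; ring
  · ring
  · rw [q3, q3]; ring
  · rw [z', o1]; ring
  · rw [h.val₀', o2, q1]; linear_combination -dir e₂ * hs e₀
  · rw [w1', o3, q2]; linear_combination -dir e₁ * hs e₀
  · rw [z', o4]; ring
  · rw [o6, o6]; ring
  · rw [o5, o5, q3, q3]; ring

/-- The values at the triangle of a loop at a different crossing. -/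
theorem TriangleOrder.values_out {ε ε' : Endpoint → Endpoint → ℚ} {a b c e : ℕ} {e₀ e₁ e₂ : Bool}
    (hea : e ≠ a) (heb : e ≠ b) (hec : e ≠ c)
    (h : TriangleOrder ε ε' (a, e₀) (c, !e₂) (b, e₁) (a, !e₀) (c, e₂) (b, !e₁) (dir e₀) (dir e₁)
      (dir e₂)) :
    TriangleValues (a, e₀) (c, !e₂) (b, e₁) (a, !e₀) (c, e₂) (b, !e₁) (dir e₀) (dir e₁) (dir e₂)
      (loopVec ε e) (loopVec ε' e) := by
  have ho : ∀ f x, ε' (e, f) x = ε (e, f) x := fun f x =>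
    h.out _ _ (by simp [hea, hec]) (by simp [hea, heb]) (by simp [heb, hec])
  have q0 : ∀ f, ε (e, f) (c, !e₂) = ε (e, f) (a, e₀) := fun f => by
    rw [h.skew, ← h.adj₀ _ (by simp [hea]) (by simp [hec]), ← h.skew]
  have q1 : ∀ f, ε (e, f) (a, !e₀) = ε (e, f) (b, e₁) := fun f => by
    rw [h.skew, ← h.adj₁ _ (by simp [heb]) (by simp [hea]), ← h.skew]
  have q2 : ∀ f, ε (e, f) (b, !e₁) = ε (e, f) (c, e₂) := fun f => by
    rw [h.skew, ← h.adj₂ _ (by simp [hec]) (by simp [heb]), ← h.skew]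
  refine ⟨loopVec ε e (a, e₀), loopVec ε e (b, e₁), loopVec ε e (c, e₂), 0, 0, 0, ⟨?_, ?_, ?_, ?_, ?_, ?_⟩,
    ?_, ?_, ?_, ?_, ?_, ?_⟩ <;> simp only [loopVec, ho, q0, q1, q2] <;> ring

theorem TriangleOrder.values {ε ε' : Endpoint → Endpoint → ℚ} {a b c : ℕ} {e₀ e₁ e₂ : Bool}
    (hab : a ≠ b) (hbc : b ≠ c) (hac : a ≠ c)
    (h : TriangleOrder ε ε' (a, e₀) (c, !e₂) (b, e₁) (a, !e₀) (c, e₂) (b, !e₁) (dir e₀) (dir e₁)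
      (dir e₂)) (e : ℕ) :
    TriangleValues (a, e₀) (c, !e₂) (b, e₁) (a, !e₀) (c, e₂) (b, !e₁) (dir e₀) (dir e₁) (dir e₂)
      (loopVec ε e) (loopVec ε' e) := by
  by_cases hea : e = a
  · subst hea
    exact h.values_corner hab hbc hac
  by_cases heb : e = b
  · subst heb
    exact (h.rotate.values_corner hbc hac.symm hab.symm).rotate
  by_cases hec : e = c
  · subst hec
    exact (h.rotate.rotate.values_corner hac.symm hab hbc.symm).rotate.rotate
  · exact h.values_out hea heb hec

theorem TriangleOrder.out_eq {ε ε' : Endpoint → Endpoint → ℚ} {a b c : ℕ} {e₀ e₁ e₂ : Bool}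
    (h : TriangleOrder ε ε' (a, e₀) (c, !e₂) (b, e₁) (a, !e₀) (c, e₂) (b, !e₁) (dir e₀) (dir e₁)
      (dir e₂)) (e : ℕ) (x : Endpoint) (ha : x.1 ≠ a) (hb : x.1 ≠ b) (hc : x.1 ≠ c) :
    loopVec ε e x = loopVec ε' e x := by
  have ho : ∀ z, ε' z x = ε z x := by
    intro z
    refine h.out _ _ ?_ ?_ ?_ <;> rintro ⟨-, rfl | rfl⟩ <;> contradiction
  simp only [loopVec, ho]

theorem TriangleOrder.fillRank {ε ε' : Endpoint → Endpoint → ℚ} {a b c : ℕ} {e₀ e₁ e₂ : Bool}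
    (hab : a ≠ b) (hbc : b ≠ c) (hac : a ≠ c)
    (h : TriangleOrder ε ε' (a, e₀) (c, !e₂) (b, e₁) (a, !e₀) (c, e₂) (b, !e₁) (dir e₀) (dir e₁)
      (dir e₂)) {A : Finset ℕ} (ha : a ∈ A) (hb : b ∈ A) (hc : c ∈ A) (r : ℕ) :
    FillRank (crossForm A) 1 (loopVec ε) A r ↔ FillRank (crossForm A) 1 (loopVec ε') A r := by
  have h1 : TriangleValues (a, e₀) (c, !e₂) (b, e₁) (a, !e₀) (c, e₂) (b, !e₁) (dir e₀) (dir e₁)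
      (dir e₂) 1 1 := ⟨1, 1, 1, 0, 0, 0, by simp, by simp⟩
  have e1 : ∀ e, crossForm A 1 (loopVec ε e) = crossForm A 1 (loopVec ε' e) := fun e =>
    crossForm_triangle ha hb hc hab hbc hac h1 (h.values hab hbc hac e) (fun _ _ _ _ => rfl)
      (h.out_eq e)
  have e2 : ∀ e f, crossForm A (loopVec ε e) (loopVec ε f) =
      crossForm A (loopVec ε' e) (loopVec ε' f) := fun e f =>
    crossForm_triangle ha hb hc hab hbc hac (h.values hab hbc hac e) (h.values hab hbc hac f)
      (h.out_eq e) (h.out_eq f)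
  constructor
  · intro hr
    refine hr.of_eq 1 (fun _ => Iff.rfl) 1 0 (crossForm_skew _) (crossForm_skew _)
      (fun e _ => ?_) (fun e _ f _ => ?_)
    · simp [e1]
    · simp [e2]
  · intro hr
    refine hr.of_eq 1 (fun _ => Iff.rfl) 1 0 (crossForm_skew _) (crossForm_skew _)
      (fun e _ => ?_) (fun e _ f _ => ?_)
    · simp [e1]
    · simp [e2]

theorem wordRank_localMove {k : ℕ} {h h' : Fin k → List Endpoint} (hl : LocalMove h h')
    (c : List (Endpoint ⊕ Fin k)) (hc : ∀ i, c.count (Sum.inr i) = 1)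
    (hg : IsGauss (c.flatMap (Sum.elim (fun x => [x]) h)))
    (hg' : IsGauss (c.flatMap (Sum.elim (fun x => [x]) h'))) (r : ℕ) :
    WordRank (c.flatMap (Sum.elim (fun x => [x]) h)) r ↔
      WordRank (c.flatMap (Sum.elim (fun x => [x]) h')) r := by
  have hmem : ∀ i, ∀ x ∈ h i, x ∈ c.flatMap (Sum.elim (fun x => [x]) h) := by
    intro i x hx
    obtain ⟨A, B, he⟩ := exists_fill_mid h (hc i)
    rw [he]; simp [hx]
  have harr : ∀ i, ∀ x ∈ h i, x.1 ∈
      ((c.flatMap (Sum.elim (fun x => [x]) h)).map Prod.fst).toFinset := fun i x hx =>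
    List.mem_toFinset.2 (List.mem_map_of_mem (hmem i x hx))
  have hout : ∀ i, ∀ x ∈ h i, ∀ y ∈ outer c, y.1 ≠ x.1 := by
    intro i x hx
    obtain ⟨i, j, hi, hj⟩ := hl.exists_mem hx
    exact outer_ne_of_mem c hc h hg.1 hi hj
  have hadj : ∀ i, ∀ x ∈ h i, ∀ y ∈ h i, ∀ z, z ∉ h i →
      ord (c.flatMap (Sum.elim (fun x => [x]) h)) x z =
        ord (c.flatMap (Sum.elim (fun x => [x]) h)) y z := by
    intro i x hx y hy z hz
    obtain ⟨A, B, he⟩ := exists_fill_mid h (hc i)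
    rw [he]
    exact ord_adjacent (he ▸ hg.1) hx hy hz
  have hin : ∀ {h : Fin _ → List Endpoint}, IsGauss (c.flatMap (Sum.elim (fun x => [x]) h)) →
      ∀ i, ∀ x ∈ h i, ∀ y ∈ h i, ord (c.flatMap (Sum.elim (fun x => [x]) h)) x y = ord (h i) x y := by
    intro h hg i x hx y hy
    obtain ⟨A, B, he⟩ := exists_fill_mid h (hc i)
    rw [he]
    exact ord_mid (he ▸ hg.1) hx hy
  have hnd : ((List.finRange k).flatMap h).Nodup :=
    (List.nodup_append'.1 ((flatMap_elim_perm c hc h).nodup_iff.1 hg.1)).2.1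
  cases hl with
  | fr1 a e =>
    have h1 : (a, e) ∈ (![[(a, e), (a, !e)]] : Fin 1 → _) 0 := by simp
    have hO : O a ∈ (![[(a, e), (a, !e)]] : Fin 1 → _) 0 := by cases e <;> simp
    have hU : U a ∈ (![[(a, e), (a, !e)]] : Fin 1 → _) 0 := by cases e <;> simp
    rw [wordRank_fr1 (harr 0 _ h1) (fun z hz => hadj 0 _ hO _ hU z ?_), fill_filter]
    · have : (fun i => ((![[(a, e), (a, !e)]] : Fin 1 → List Endpoint) i).filter
          fun x => decide (x.1 ≠ a)) = ![[]] := by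
        funext i; fin_cases i; simp
      rw [this]
    · intro x hx
      simpa using hout 0 _ h1 x hx
    · intro hz'
      simp at hz'
      rcases hz' with rfl | rfl <;> exact hz rfl
  | fr2 a b p q hp hq =>
    have hOa : O a ∈ p := hp.mem_iff.2 (by simp)
    have hUb : U b ∈ p := hp.mem_iff.2 (by simp)
    have hUa : U a ∈ q := hq.mem_iff.2 (by simp)
    have hOb : O b ∈ q := hq.mem_iff.2 (by simp)
    have hab : a ≠ b := by
      rintro rfl
      simp [List.finRange_succ, List.nodup_append'] at hnd
      exact hnd.2.2 hOa hOb
    have hP : ∀ z, z ∈ p → z = O a ∨ z = U b := fun z hz => by simpa using hp.mem_iff.1 hz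
    have hQ : ∀ z, z ∈ q → z = U a ∨ z = O b := fun z hz => by simpa using hq.mem_iff.1 hz
    rw [wordRank_fr2 (harr 0 _ hOa) (harr 0 _ hUb) hab
      (fun z h1 h2 => hadj 0 _ hOa _ hUb z fun hz => (hP z hz).elim h1 h2)
      (fun z h1 h2 => hadj 1 _ hUa _ hOb z fun hz => (hQ z hz).elim h1 h2), fill_filter]
    · have : (fun i => ((![p, q] : Fin 2 → List Endpoint) i).filter
          fun x => decide (x.1 ≠ a ∧ x.1 ≠ b)) = ![[], []] := by
        funext i
        fin_cases i
        · refine List.filter_eq_nil_iff.2 fun x hx => ?_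
          rcases hP x hx with rfl | rfl <;> simp
        · refine List.filter_eq_nil_iff.2 fun x hx => ?_
          rcases hQ x hx with rfl | rfl <;> simp
      rw [this]
    · intro x hx
      simpa using ⟨hout 0 _ hOa x hx, hout 0 _ hUb x hx⟩
  | fr3 a b c' e₀ e₁ e₂ =>
    have hd : a ≠ b ∧ b ≠ c' ∧ a ≠ c' := by
      refine ⟨?_, ?_, ?_⟩ <;> rintro rfl <;> revert hnd <;> cases e₀ <;> cases e₁ <;> cases e₂ <;>
        simp [List.finRange_succ, triangleStrand]
    obtain ⟨hab, hbc, hac⟩ := hd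
    have hperm : ∀ i, ((![triangleStrand (a, e₀) (c', !e₂), triangleStrand (b, e₁) (a, !e₀),
        triangleStrand (c', e₂) (b, !e₁)] : Fin 3 → _) i).Perm
        ((![(triangleStrand (a, e₀) (c', !e₂)).reverse, (triangleStrand (b, e₁) (a, !e₀)).reverse,
        (triangleStrand (c', e₂) (b, !e₁)).reverse] : Fin 3 → _) i) := by
      intro i
      fin_cases i <;> exact (List.reverse_perm _).symm
    have hpw := (List.Perm.refl c).flatMap (f := Sum.elim (fun x => [x])
        (![triangleStrand (a, e₀) (c', !e₂), triangleStrand (b, e₁) (a, !e₀),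
        triangleStrand (c', e₂) (b, !e₁)] : Fin 3 → _)) (g := Sum.elim (fun x => [x])
        ((![(triangleStrand (a, e₀) (c', !e₂)).reverse, (triangleStrand (b, e₁) (a, !e₀)).reverse,
        (triangleStrand (c', e₂) (b, !e₁)).reverse] : Fin 3 → _)))
        (by
          rintro (x | i) -
          · exact List.Perm.refl _
          · exact hperm i)
    have hA := List.toFinset_eq_of_perm _ _ (hpw.map Prod.fst)
    have v : ∀ x y : Endpoint, x ≠ y → ord (triangleStrand x y) x y = if x.2 = y.2 then 1 else -1 := by
      intro x y hxy
      unfold triangleStrand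
      split_ifs <;> simp [ord, hxy, hxy.symm]
    have v' : ∀ x y : Endpoint, x ≠ y →
        ord (triangleStrand x y).reverse x y = if x.2 = y.2 then -1 else 1 := by
      intro x y hxy
      unfold triangleStrand
      split_ifs <;> simp [ord, hxy, hxy.symm]
    have vd : ∀ e f, (if e = !f then (1 : ℚ) else -1) = -(dir e * dir f) := by
      intro e f; cases e <;> cases f <;> norm_num [dir]
    have vd' : ∀ e f, (if e = !f then (-1 : ℚ) else 1) = dir e * dir f := by
      intro e f; cases e <;> cases f <;> norm_num [dir]
    have m : ∀ x y : Endpoint, x ∈ triangleStrand x y ∧ y ∈ triangleStrand x y := fun x y =>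
      ⟨mem_triangleStrand.2 (Or.inl rfl), mem_triangleStrand.2 (Or.inr rfl)⟩
    have m' : ∀ x y : Endpoint, x ∈ (triangleStrand x y).reverse ∧ y ∈ (triangleStrand x y).reverse :=
      fun x y => ⟨List.mem_reverse.2 (m x y).1, List.mem_reverse.2 (m x y).2⟩
    have n0 : ((a, e₀) : Endpoint) ≠ (c', !e₂) := by simp [hac]
    have n1 : ((b, e₁) : Endpoint) ≠ (a, !e₀) := by simp [hab.symm]
    have n2 : ((c', e₂) : Endpoint) ≠ (b, !e₁) := by simp [hbc.symm]
    have T : TriangleOrder (ord (c.flatMap (Sum.elim (fun x => [x])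
        ![triangleStrand (a, e₀) (c', !e₂), triangleStrand (b, e₁) (a, !e₀),
        triangleStrand (c', e₂) (b, !e₁)])))
        (ord (c.flatMap (Sum.elim (fun x => [x])
        ![(triangleStrand (a, e₀) (c', !e₂)).reverse, (triangleStrand (b, e₁) (a, !e₀)).reverse,
        (triangleStrand (c', e₂) (b, !e₁)).reverse])))
        (a, e₀) (c', !e₂) (b, e₁) (a, !e₀) (c', e₂) (b, !e₁) (dir e₀) (dir e₁) (dir e₂) := by
      refine ⟨ord_antisymm _, ord_antisymm _, ?_, ?_, ?_, ?_, ?_, ?_, ?_, ?_, ?_, ?_⟩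
      · exact fun z h1 h2 => hadj 0 _ (m _ _).1 _ (m _ _).2 z
          fun hz => (mem_triangleStrand.1 hz).elim h1 h2
      · exact fun z h1 h2 => hadj 1 _ (m _ _).1 _ (m _ _).2 z
          fun hz => (mem_triangleStrand.1 hz).elim h1 h2
      · exact fun z h1 h2 => hadj 2 _ (m _ _).1 _ (m _ _).2 z
          fun hz => (mem_triangleStrand.1 hz).elim h1 h2
      · intro x y h0 h1 h2
        refine (ord_fill_perm c hperm fun i hi => ?_).symm
        fin_cases i
        · exact h0 ⟨mem_triangleStrand.1 hi.1, mem_triangleStrand.1 hi.2⟩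
        · exact h1 ⟨mem_triangleStrand.1 hi.1, mem_triangleStrand.1 hi.2⟩
        · exact h2 ⟨mem_triangleStrand.1 hi.1, mem_triangleStrand.1 hi.2⟩
      · rw [hin hg 0 _ (m _ _).1 _ (m _ _).2]
        exact (v _ _ n0).trans (vd _ _)
      · rw [hin hg 1 _ (m _ _).1 _ (m _ _).2]
        exact (v _ _ n1).trans (vd _ _)
      · rw [hin hg 2 _ (m _ _).1 _ (m _ _).2]
        exact (v _ _ n2).trans (vd _ _)
      · rw [hin hg' 0 _ (m' _ _).1 _ (m' _ _).2]
        exact (v' _ _ n0).trans (vd' _ _)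
      · rw [hin hg' 1 _ (m' _ _).1 _ (m' _ _).2]
        exact (v' _ _ n1).trans (vd' _ _)
      · rw [hin hg' 2 _ (m' _ _).1 _ (m' _ _).2]
        exact (v' _ _ n2).trans (vd' _ _)
    unfold WordRank
    rw [← hA]
    exact T.fillRank hab hbc hac (harr 0 _ (m (a, e₀) _).1) (harr 1 _ (m (b, e₁) _).1)
      (harr 2 _ (m (c', e₂) _).1) r

/-! ### Invariance of the genus -/

theorem wordRank_move {w w' : List Endpoint} (hg : IsGauss w) (hg' : IsGauss w')
    (hm : Move [(0, w)] [(0, w')]) (r : ℕ) : WordRank w r ↔ WordRank w' r := by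
  generalize hC : [((0 : ℕ), w)] = C at hm
  generalize hC' : [((0 : ℕ), w')] = C' at hm
  cases hm with
  | perm h =>
    subst hC hC'
    rw [List.perm_singleton] at h
    have : w = w' := by simpa using h
    rw [this]
  | rotate t u v C =>
    simp only [List.cons.injEq, Prod.mk.injEq] at hC hC'
    obtain ⟨⟨rfl, rfl⟩, rfl⟩ := hC
    obtain ⟨⟨-, rfl⟩, -⟩ := hC'
    exact ⟨wordRank_rotate hg', wordRank_rotate hg⟩
  | rename σ =>
    subst hC
    simp only [List.map_cons, List.map_nil, List.cons.injEq, Prod.mk.injEq, true_and, and_true] at hC'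
    subst hC'
    refine ⟨fun h => wordRank_rename σ.symm ?_, wordRank_rename σ⟩
    simpa [Function.comp_def] using h
  | reidemeister T hloc hT hg1 hg2 =>
    obtain ⟨⟨t, c⟩, T', rfl, h1, h2⟩ := List.map_eq_cons_iff.1 hC.symm
    obtain rfl : T' = [] := by simpa using h2
    simp only [Tangle.fill, List.map_cons, List.map_nil, List.cons.injEq, Prod.mk.injEq,
      and_true] at hC hC'
    rw [hC.2] at hg ⊢
    rw [hC'.2] at hg' ⊢
    have hc : ∀ i, c.count (Sum.inr i) = 1 := by simpa using hT
    rcases hloc with hl | hl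
    · exact wordRank_localMove hl c hc hg hg' r
    · exact (wordRank_localMove hl c hc hg' hg r).symm

theorem FlatKnot.matrixGenus_eq {D D' : KnotDiagram} (h : D.toFlatKnot = D'.toFlatKnot) :
    matrixGenus D.basedMatrix = matrixGenus D'.basedMatrix :=
  congrArg (Quot.lift (fun D : KnotDiagram => matrixGenus D.basedMatrix) fun D D' hm => by
    simp only [KnotDiagram.matrixGenus_eq, wordRank_move D.gauss D'.gauss hm]) h

theorem KnotDiagram.hasAlgebraicGenus {D : KnotDiagram} {g : ℚ} (h : matrixGenus D.basedMatrix = g) :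
    D.toFlatKnot.HasAlgebraicGenus g := fun _ hD' => (FlatKnot.matrixGenus_eq hD').trans h

/-! ## The flat knots 6.464 and 4.2 -/

/-- The based matrix with the filling of an involution, on all natural numbers. -/
def KnotDiagram.fillMatrix (D : KnotDiagram) (τ : ℕ → ℕ) : Option ℕ → Option ℕ → ℤ
  | none, none => 0
  | some e, none => D.index e + if τ e = e then 0 else D.index (τ e)
  | none, some f => -(D.index f + if τ f = f then 0 else D.index (τ f))
  | some e, some f => (D.pairing e f + if τ f = f then 0 else D.pairing e (τ f)) +
      if τ e = e then 0 else D.pairing (τ e) f + if τ f = f then 0 else D.pairing (τ e) (τ f)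

theorem KnotDiagram.fillMatrix_eq (D : KnotDiagram) {τ : ℕ → ℕ} (hτ : ∀ e ∈ D.arrows, τ e ∈ D.arrows)
    (p q : Option D.arrows) :
    crossForm D.arrows (onArrows D.arrows (fillVec 1 D.arcVec τ) p)
      (onArrows D.arrows (fillVec 1 D.arcVec τ) q) =
      D.fillMatrix τ (p.map Subtype.val) (q.map Subtype.val) := by
  rcases p with _ | ⟨e, he⟩ <;> rcases q with _ | ⟨f, hf⟩
  · have := crossForm_skew D.arrows 1 1
    simp only [onArrows, fillVec, KnotDiagram.fillMatrix, Option.map_none]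
    push_cast
    linarith
  · simp only [onArrows, fillVec, KnotDiagram.fillMatrix, Option.map_none, Option.map_some]
    rw [crossForm_skew]
    split_ifs <;> simp only [map_add, map_zero, LinearMap.add_apply, LinearMap.zero_apply,
      D.crossForm_arcVec_one] <;> push_cast <;> rfl
  · simp only [onArrows, fillVec, KnotDiagram.fillMatrix, Option.map_none, Option.map_some]
    split_ifs <;> simp only [map_add, map_zero, LinearMap.add_apply, LinearMap.zero_apply,
      D.crossForm_arcVec_one] <;> push_cast <;> rfl
  · simp only [onArrows, fillVec, KnotDiagram.fillMatrix, Option.map_some]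
    have he' := hτ e he
    have hf' := hτ f hf
    split_ifs <;> simp only [map_add, map_zero, LinearMap.add_apply, LinearMap.zero_apply,
      D.crossForm_arcVec he hf, D.crossForm_arcVec he' hf, D.crossForm_arcVec he hf',
      D.crossForm_arcVec he' hf'] <;> push_cast <;> ring

/-- A factorization through `Fin r` bounds the rank by `r`; stated with integers over a finite set
of indices, it can be decided. -/
theorem KnotDiagram.wordRank_of_fillMatrix (D : KnotDiagram) {τ : ℕ → ℕ} (hinv : Function.Involutive τ)
    (hτ : ∀ e ∈ D.arrows, τ e ∈ D.arrows) {r : ℕ} (u v : Option ℕ → Fin r → ℤ)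
    (h : ∀ p ∈ insert none (D.arrows.map Function.Embedding.some),
      ∀ q ∈ insert none (D.arrows.map Function.Embedding.some),
        D.fillMatrix τ p q = ∑ i, u p i * v q i) : WordRank D.word r := by
  rw [D.wordRank_iff]
  refine ⟨τ, hinv, hτ, ?_⟩
  have hmem : ∀ p : Option D.arrows, p.map Subtype.val ∈
      insert none (D.arrows.map Function.Embedding.some) := by
    rintro (_ | ⟨e, he⟩) <;> simp [*]
  have : (Matrix.of fun p q => crossForm D.arrows (onArrows D.arrows (fillVec 1 D.arcVec τ) p)
      (onArrows D.arrows (fillVec 1 D.arcVec τ) q)) =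
      (Matrix.of fun (p : Option D.arrows) (i : Fin r) => (u (p.map Subtype.val) i : ℚ)) *
      (Matrix.of fun (i : Fin r) (q : Option D.arrows) => (v (q.map Subtype.val) i : ℚ)) := by
    ext p q
    rw [Matrix.of_apply, D.fillMatrix_eq hτ, h _ (hmem p) _ (hmem q), Matrix.mul_apply]
    push_cast
    rfl
  rw [this]
  refine (Matrix.rank_mul_le_left _ _).trans ((Matrix.rank_le_card_width _).trans ?_)
  simp

/-- If the index of some arrow `e` is not cancelled by the index of any other arrow, then every filling
has rank at least two. -/
theorem KnotDiagram.two_le_of_wordRank (D : KnotDiagram) {e : ℕ} (he : e ∈ D.arrows)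
    (h0 : D.index e ≠ 0) (h : ∀ f ∈ D.arrows, D.index e + D.index f ≠ 0) {r : ℕ}
    (hr : WordRank D.word r) : 2 ≤ r := by
  rw [D.wordRank_iff] at hr
  obtain ⟨τ, -, hτ, hr⟩ := hr
  set v := onArrows D.arrows (fillVec (1 : Endpoint → ℚ) D.arcVec τ) with hv
  -- The Gram matrix of `s` and the member of the filling containing `e` is skew of size 2. Its
  -- off-diagonal entry is, up to sign, the index of `e` plus that of its partner, if any, so it is
  -- invertible.
  have h1 : (Matrix.of fun i j : Fin 2 => crossForm D.arrows (![v none, v (some ⟨e, he⟩)] i)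
      (![v none, v (some ⟨e, he⟩)] j)).rank ≤ r := by
    refine (rank_gram_le _ _ _ v _ (fun i => ?_) fun _ _ => rfl).trans hr
    fin_cases i
    · exact Submodule.subset_span ⟨none, rfl⟩
    · exact Submodule.subset_span ⟨some ⟨e, he⟩, rfl⟩
  have h2 : crossForm D.arrows (v (some ⟨e, he⟩)) (v none) ≠ 0 := by
    rw [D.fillMatrix_eq hτ]
    simp only [KnotDiagram.fillMatrix, Option.map_none, Option.map_some]
    split_ifs
    · simpa using h0
    · exact_mod_cast h _ (hτ e he)
  have hz : ∀ x, crossForm D.arrows x x = 0 := fun x => by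
    have := crossForm_skew D.arrows x x
    linarith
  rw [Matrix.rank_of_isUnit] at h1
  · simpa using h1
  · rw [Matrix.isUnit_iff_isUnit_det, Matrix.det_fin_two, isUnit_iff_ne_zero]
    simp only [Matrix.of_apply, Matrix.cons_val_zero, Matrix.cons_val_one, hz]
    rw [crossForm_skew _ (v none)]
    simpa using h2

theorem matrixGenus_of_le {D : KnotDiagram} {r : ℕ} (hr : WordRank D.word r)
    (h : ∀ s, WordRank D.word s → r ≤ s) : matrixGenus D.basedMatrix = r / 2 := by
  rw [D.matrixGenus_eq]
  congr 2
  exact le_antisymm (Nat.sInf_le hr) (le_csInf ⟨r, hr⟩ h)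

/-- The involution of the arrows of the diagram of `6.464` exchanging `1` with `5`, `2` with `6` and
`3` with `4`. -/
def exchange6464 : ℕ → ℕ
  | 1 => 5 | 2 => 6 | 3 => 4 | 4 => 3 | 5 => 1 | 6 => 2 | n => n

theorem involutive_exchange6464 : Function.Involutive exchange6464 := by
  rintro (_ | _ | _ | _ | _ | _ | _ | n) <;> rfl

theorem algebraicallySlice_knot6464 : knot6464.AlgebraicallySlice := by
  refine KnotDiagram.hasAlgebraicGenus (D := diagram6464) ?_
  -- The indices 3 and -3, -1 and 1, 0 and 0 are paired, and all intersection numbers of the three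
  -- sums vanish as well.
  have hr : WordRank diagram6464.word 0 :=
    diagram6464.wordRank_of_fillMatrix involutive_exchange6464 (by decide)
      (fun _ _ => 0) (fun _ _ => 0) (by decide)
  rw [matrixGenus_of_le hr fun s _ => Nat.zero_le s]
  norm_num

/-- The involution exchanging `1` with `2` and `3` with `4`. -/
def exchange42 : ℕ → ℕ
  | 1 => 2 | 2 => 1 | 3 => 4 | 4 => 3 | n => n

theorem involutive_exchange42 : Function.Involutive exchange42 := by
  rintro (_ | _ | _ | _ | _ | n) <;> rfl

theorem hasAlgebraicGenus_knot42 : knot42.HasAlgebraicGenus 1 := by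
  refine KnotDiagram.hasAlgebraicGenus (D := diagram42) ?_
  -- A skew matrix of rank 2 has entries `x p * y q - y p * x q`: the first factor lists `(x, y)`
  -- and the second `(y, -x)`. The test `e ≤ 2` separates the parts {1, 2} and {3, 4}, of total
  -- index 2 and -2.
  have hr : WordRank diagram42.word 2 := diagram42.wordRank_of_fillMatrix involutive_exchange42
    (by decide) (fun p => p.elim ![0, 2] fun e => if e ≤ 2 then ![1, 0] else ![-1, 3])
    (fun p => p.elim ![2, 0] fun e => if e ≤ 2 then ![0, -1] else ![3, 1]) (by decide)
  rw [matrixGenus_of_le hr fun s hs =>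
    diagram42.two_le_of_wordRank (e := 1) (by decide) (by decide) (by decide) hs]
  norm_num

theorem hasAlgebraicGenus_negKnot42 : negKnot42.HasAlgebraicGenus 1 := by
  refine KnotDiagram.hasAlgebraicGenus (D := diagram42.reverse) ?_
  -- The same shape of factorization; the parts {1, 2} and {3, 4} now have total index -2 and 2.
  have hr : WordRank diagram42.reverse.word 2 :=
    diagram42.reverse.wordRank_of_fillMatrix involutive_exchange42
    (by decide) (fun p => p.elim ![0, -2] fun e => if e ≤ 2 then ![1, 0] else ![-1, -5])
    (fun p => p.elim ![-2, 0] fun e => if e ≤ 2 then ![0, -1] else ![-5, 1]) (by decide)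
  rw [matrixGenus_of_le hr fun s hs =>
    diagram42.reverse.two_le_of_wordRank (e := 1) (by decide) (by decide) (by decide) hs]
  norm_num

end FlatKnots

theorem mainTheorem2 :
    FlatKnots.knot6464.AlgebraicallySlice ∧
    ¬ FlatKnots.knot6464.Slice ∧
    FlatKnots.FlatKnot.IsCovering 3 FlatKnots.knot6464 FlatKnots.negKnot42 ∧
    FlatKnots.knot42.HasAlgebraicGenus 1 ∧
    FlatKnots.negKnot42.HasAlgebraicGenus 1 := by
  refine ⟨FlatKnots.algebraicallySlice_knot6464, FlatKnots.not_slice_knot6464, ?_,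
    FlatKnots.hasAlgebraicGenus_knot42, FlatKnots.hasAlgebraicGenus_negKnot42⟩
  rw [← FlatKnots.covering_knot6464]
  exact FlatKnots.FlatKnot.isCovering_covering 3 _
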